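/- Let $q\ge 0$ be an integer. Let $G=\mathrm{SOSp}^+_{cs}(1,1|2q)$ be the cs form of the complex supergroup of even supermatrices $g$ of size $2|2q$ with $g^{st}Jg=J$, $J=\mathrm{diag}(-1,1\,|\,J_q)$ (where $J_q$ is block diagonal with $q$ blocks $\begin{pmatrix}0&1\\-1&0\end{pmatrix}$), with underlying Lie group $G_0=\mathrm{SO}^+(1,1)\times \mathrm{USp}(2q)$, $\mathrm{SO}^+$ being the identity component. Let $K=\mathrm{SOSp}_{cs}(1|2q)$ be the fixed subsupergroup of $\theta(g)=\sigma g\sigma$, $\sigma=\mathrm{diag}(-1,1\,|\,1)$. Let $\mathfrak a=\mathbb C h_0$, where $h_0$ has entries $1$ in the positions $(1,2)$ and $(2,1)$ and zeros elsewhere, let $\alpha\in\mathfrak a^*$ with $\alpha(h_0)=1$, identify $\mathfrak a^*$ with $\mathbb C$ via $\lambda\mapsto\lambda(h_0)$, and put $\mathfrak n=\mathfrak g^\alpha=\{x\in\mathfrak g: [h_0,x]=x\}$ and $\varrho=\frac12m_\alpha=\frac12(\dim\mathfrak g^\alpha_{\bar 0}-\dim\mathfrak g^\alpha_{\bar 1})$.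 Let $M$ be the centraliser of $\mathfrak a$ in $K$, let $A$ and $N$ be the analytic subsupergroups with Lie superalgebras $\mathfrak a$ and $\mathfrak n$, and let $H$ be the Iwasawa projection, defined by $g=k\,e^{H(g)h_0}\,n$ with $k\in K$ and $n\in N$. Then: (a) $\varrho=-q$, and $K/M$, a superspace of dimension $0|2q$ over a point, carries a non-zero $K$-invariant Berezinian density. (b) Fix any non-zero $K$-invariant Berezinian density $|D\dot k|$ on $K/M$, and let $\phi_\lambda(g)=\int_{K/M}|D\dot k|\,e^{(\lambda-\varrho)H(gk)}$ be the spherical superfunction. There is a non-zero constant $c_1$ such that for all $\lambda\in\mathbb C$ and $t\in\mathbb R$ $$\phi_\lambda(e^{th_0})=c_1e^{\lambda t}\sum_{k=0}^{-\varrho}\binom{\lambda-\varrho}{k}\binom{-\lambda-\varrho}{-\varrho-k}e^{(-\varrho-2k)t}.$$ (c) There is a non-zero constant $c_0'$, depending only on $\varrho$ (and on the normalisation of $|D\dot k|$), such that for all $\lambda$ with $\Re\lambda>0$ the limit $c(\lambda)=\lim_{t\to\infty}e^{-(\lambda-\varrho)t}\phi_\lambda(e^{th_0})$ exists and $$c(\lambda)=c_0'\,\frac{\Gamma(\lambda)}{\Gamma(\lambda+\varrho)},$$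 where $1/\Gamma$ is understood to be $0$ at the poles of $\Gamma$. -/

import Mathlib

noncomputable section

namespace OrthoSymplectic

/-! ### Superpoints

The superpoint with odd coordinate space `V*` has the Grassmann algebra `⋀ V` as its algebra of
superfunctions.  Supergroups are described by their functors of points on superpoints; a morphism
from the superpoint of `W` to that of `V` is a unital parity preserving algebra homomorphism
`⋀ V → ⋀ W`. -/

/-- The algebra of superfunctions on a superpoint. -/
abbrev Gr (V : Type) [AddCommGroup V] [Module ℂ V] : Type := ExteriorAlgebra ℂ V

/-- The even (`i = 0`) and odd (`i = 1`) superfunctions. -/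
def parity (V : Type) [AddCommGroup V] [Module ℂ V] (i : ZMod 2) : Submodule ℂ (Gr V) :=
  CliffordAlgebra.evenOdd (0 : QuadraticForm ℂ V) i

/-- The value of a superfunction at the unique point of the underlying space. -/
def body {V : Type} [AddCommGroup V] [Module ℂ V] : Gr V →ₐ[ℂ] ℂ :=
  ExteriorAlgebra.algebraMapInv

/-- Parity preserving algebra homomorphisms, i.e. morphisms of superpoints. -/
def IsSuperHom {V W : Type} [AddCommGroup V] [Module ℂ V] [AddCommGroup W] [Module ℂ W]
    (φ : Gr V →ₐ[ℂ] Gr W) : Prop :=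
  ∀ i : ZMod 2, ∀ a ∈ parity V i, φ a ∈ parity W i

/-- Pullback of superfunctions along the projection of a product of superpoints onto the first
factor. -/
def pullFst (V W : Type) [AddCommGroup V] [Module ℂ V] [AddCommGroup W] [Module ℂ W] :
    Gr V →ₐ[ℂ] Gr (V × W) :=
  ExteriorAlgebra.map (LinearMap.inl ℂ V W)

/-- Pullback of superfunctions along the projection onto the second factor. -/
def pullSnd (V W : Type) [AddCommGroup V] [Module ℂ V] [AddCommGroup W] [Module ℂ W] :
    Gr W →ₐ[ℂ] Gr (V × W) :=
  ExteriorAlgebra.map (LinearMap.inr ℂ V W)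

/-- The (finite) exponential series of a nilpotent element of a complex algebra. -/
def nilExp {A : Type} [Ring A] [Algebra ℂ A] (a : A) : A :=
  letI : Module ℚ A := Module.compHom A (algebraMap ℚ ℂ)
  IsNilpotent.exp a

/-- The exponential in a Grassmann algebra: `a` is the sum of its value and a nilpotent. -/
def grExp {V : Type} [AddCommGroup V] [Module ℂ V] (a : Gr V) : Gr V :=
  Complex.exp (body a) • nilExp (a - algebraMap ℂ (Gr V) (body a))

/-! ### Supermatrices of size `2|2q` -/

/-- Square supermatrices of size `2|2q`; the index `(a, j) : Fin 2 × Fin q` is the basis vector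
number `a` of the `j`-th symplectic plane. -/
abbrev SMat (q : ℕ) (R : Type) : Type :=
  Matrix (Fin 2 ⊕ (Fin 2 × Fin q)) (Fin 2 ⊕ (Fin 2 × Fin q)) R

/-- The supertranspose `(R S; T V) ↦ (Rᵗ Tᵗ; -Sᵗ Vᵗ)`. -/
def superTranspose {q : ℕ} {R : Type} [Ring R] (x : SMat q R) : SMat q R :=
  Matrix.fromBlocks x.toBlocks₁₁.transpose x.toBlocks₂₁.transpose
    (-x.toBlocks₁₂.transpose) x.toBlocks₂₂.transpose

/-- The form `diag(-1, 1 | J_q)`, with `J_q` block diagonal with `q` blocks `(0 1; -1 0)`. -/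
def formJ (q : ℕ) (R : Type) [Ring R] : SMat q R :=
  Matrix.fromBlocks !![-1, 0; 0, 1] 0 0
    (Matrix.blockDiagonal (fun _ : Fin q => !![0, 1; -1, 0]))

/-- The matrix `σ = diag(-1, 1 | 1)` that defines the involution `θ(x) = σ x σ`. -/
def sigma (q : ℕ) (R : Type) [Ring R] : SMat q R :=
  Matrix.fromBlocks !![-1, 0; 0, 1] 0 0 1

/-- The generator `h₀` of the even Cartan subspace `𝔞`. -/
def hZero (q : ℕ) (R : Type) [Ring R] : SMat q R :=
  Matrix.fromBlocks !![0, 1; 1, 0] 0 0 0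

/-- The equation `xˢᵗ J + J x = 0` of the Lie superalgebra `𝔬𝔰𝔭(1,1|2q)`. -/
def IsOsp {q : ℕ} {R : Type} [Ring R] (x : SMat q R) : Prop :=
  superTranspose x * formJ q R + formJ q R * x = 0

/-- The restricted root space `𝔤^α = {x ∈ 𝔤 | [h₀, x] = x}` of the root `α` with `α(h₀) = 1`. -/
def rootSpace (q : ℕ) : Submodule ℂ (SMat q ℂ) where
  carrier := {x | IsOsp x ∧ hZero q ℂ * x - x * hZero q ℂ = x}
  zero_mem' := by
    refine ⟨?_, by simp⟩
    have : superTranspose (0 : SMat q ℂ) = 0 := by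
      ext (i | i) (j | j) <;>
        simp [superTranspose, Matrix.toBlocks₁₁, Matrix.toBlocks₁₂, Matrix.toBlocks₂₁,
          Matrix.toBlocks₂₂]
    simp [IsOsp, this]
  add_mem' := by
    rintro x y ⟨hx, hx'⟩ ⟨hy, hy'⟩
    have h : superTranspose (x + y) = superTranspose x + superTranspose y := by
      ext (i | i) (j | j) <;>
        simp [superTranspose, Matrix.toBlocks₁₁, Matrix.toBlocks₁₂, Matrix.toBlocks₂₁,
          Matrix.toBlocks₂₂, add_comm]
    refine ⟨?_, ?_⟩
    · unfold IsOsp at *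
      rw [h, add_mul, mul_add, add_add_add_comm, hx, hy, add_zero]
    · rw [mul_add, add_mul, add_sub_add_comm, hx', hy']
  smul_mem' := by
    rintro c x ⟨hx, hx'⟩
    have h : superTranspose (c • x) = c • superTranspose x := by
      ext (i | i) (j | j) <;>
        simp [superTranspose, Matrix.toBlocks₁₁, Matrix.toBlocks₁₂, Matrix.toBlocks₂₁,
          Matrix.toBlocks₂₂]
    refine ⟨?_, ?_⟩
    · unfold IsOsp at *
      rw [h, Matrix.smul_mul, Matrix.mul_smul, ← smul_add, hx, smul_zero]
    · rw [Matrix.smul_mul, Matrix.mul_smul, ← smul_sub, hx']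

/-- The even (block diagonal) complex supermatrices. -/
def evenMat (q : ℕ) : Submodule ℂ (SMat q ℂ) where
  carrier := {x | (∀ i j, x (Sum.inl i) (Sum.inr j) = 0) ∧ ∀ i j, x (Sum.inr i) (Sum.inl j) = 0}
  zero_mem' := by simp
  add_mem' := by
    rintro x y ⟨hx, hx'⟩ ⟨hy, hy'⟩
    exact ⟨fun i j => by simp [hx i j, hy i j], fun i j => by simp [hx' i j, hy' i j]⟩
  smul_mem' := by
    rintro c x ⟨hx, hx'⟩
    exact ⟨fun i j => by simp [hx i j], fun i j => by simp [hx' i j]⟩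

/-- The odd (block off-diagonal) complex supermatrices. -/
def oddMat (q : ℕ) : Submodule ℂ (SMat q ℂ) where
  carrier := {x | (∀ i j, x (Sum.inl i) (Sum.inl j) = 0) ∧ ∀ i j, x (Sum.inr i) (Sum.inr j) = 0}
  zero_mem' := by simp
  add_mem' := by
    rintro x y ⟨hx, hx'⟩ ⟨hy, hy'⟩
    exact ⟨fun i j => by simp [hx i j, hy i j], fun i j => by simp [hx' i j, hy' i j]⟩
  smul_mem' := by
    rintro c x ⟨hx, hx'⟩
    exact ⟨fun i j => by simp [hx i j], fun i j => by simp [hx' i j]⟩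

/-- The multiplicity `m_α = dim 𝔤^α_even - dim 𝔤^α_odd`. -/
def rootMult (q : ℕ) : ℤ :=
  (Module.finrank ℂ (rootSpace q ⊓ evenMat q : Submodule ℂ (SMat q ℂ)) : ℤ) -
    (Module.finrank ℂ (rootSpace q ⊓ oddMat q : Submodule ℂ (SMat q ℂ)) : ℤ)

/-- `ϱ = ½ m_α α`, identified with the number `ϱ(h₀)`; `α` is the only positive root. -/
def rho (q : ℕ) : ℝ := (rootMult q : ℝ) / 2

/-! ### The supergroups `G`, `K`, `M`, `A`, `N`, on superpoints -/

section Points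

variable (q : ℕ) (V : Type) [AddCommGroup V] [Module ℂ V]

/-- Even supermatrices over `⋀ V`: even entries in the diagonal blocks, odd entries in the
off-diagonal blocks. -/
def IsEvenSMat (x : SMat q (Gr V)) : Prop :=
  (∀ i j, x.toBlocks₁₁ i j ∈ parity V 0) ∧ (∀ i j, x.toBlocks₁₂ i j ∈ parity V 1) ∧
    (∀ i j, x.toBlocks₂₁ i j ∈ parity V 1) ∧ (∀ i j, x.toBlocks₂₂ i j ∈ parity V 0)

/-- The points of `G = SOSp⁺(1,1|2q)`: points of the complex orthosymplectic supergroup whose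
underlying matrix lies in `SO⁺(1,1) × USp(2q)`, where `SO⁺(1,1)` is the identity component of
`SO(1,1)`.  (The equations for the form `J` in these two groups are those of the first line.) -/
def ptsG : Set (SMat q (Gr V)) :=
  {g | IsEvenSMat q V g ∧ superTranspose g * formJ q (Gr V) * g = formJ q (Gr V) ∧
    (∃ a : Matrix (Fin 2) (Fin 2) ℝ,
      g.toBlocks₁₁.map body = a.map (fun r : ℝ => (r : ℂ)) ∧ a.det = 1 ∧ 0 < a 0 0) ∧
    g.toBlocks₂₂.map body ∈ Matrix.unitaryGroup (Fin 2 × Fin q) ℂ}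

/-- The points of `K = SOSp(1|2q)`, the fixed points of `θ` in `G`. -/
def ptsK : Set (SMat q (Gr V)) :=
  {g | g ∈ ptsG q V ∧ sigma q (Gr V) * g * sigma q (Gr V) = g}

/-- The points of `M`, the centraliser of `𝔞` in `K`. -/
def ptsM : Set (SMat q (Gr V)) :=
  {g | g ∈ ptsK q V ∧ g * hZero q (Gr V) = hZero q (Gr V) * g}

/-- The points of `N`: exponentials of the even supermatrices in `⋀ V ⊗ 𝔤^α` (which satisfy
`x³ = 0`). -/
def ptsN : Set (SMat q (Gr V)) :=
  {n | ∃ x : SMat q (Gr V), IsEvenSMat q V x ∧ IsOsp x ∧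
    hZero q (Gr V) * x - x * hZero q (Gr V) = x ∧ n = nilExp x}

/-- The points of the affine superspace of `𝔞_ℝ = ℝ h₀`: even superfunctions with real value. -/
def ptsa : Set (Gr V) := {h | h ∈ parity V 0 ∧ (body h).im = 0}

end Points

/-- The matrix exponential `e^{h h₀}`, namely `(cosh h, sinh h; sinh h, cosh h)` in the upper left
block and the identity in the lower right block (recall `h₀³ = h₀`). -/
def expA (q : ℕ) {V : Type} [AddCommGroup V] [Module ℂ V] (h : Gr V) : SMat q (Gr V) :=
  Matrix.fromBlocks
    !![(2⁻¹ : ℂ) • (grExp h + grExp (-h)), (2⁻¹ : ℂ) • (grExp h - grExp (-h));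
       (2⁻¹ : ℂ) • (grExp h - grExp (-h)), (2⁻¹ : ℂ) • (grExp h + grExp (-h))] 0 0 1

open Classical in
/-- The Iwasawa projection `H`: `g = k e^{H(g) h₀} n` with `k` in `K` and `n` in `N`. -/
def iwasawaH (q : ℕ) {V : Type} [AddCommGroup V] [Module ℂ V] (g : SMat q (Gr V)) : Gr V :=
  if hg : ∃ h ∈ ptsa V, ∃ k ∈ ptsK q V, ∃ n ∈ ptsN q V, g = k * expA q h * n
  then hg.choose else 0

/-! ### The superspace `K/M`, Berezinian densities and Berezin integrals -/

/-- The span of `n` odd coordinates `ξ_1, …, ξ_n`; the Grassmann algebra on it is the algebra of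
superfunctions on the affine superspace of dimension `0|n`. -/
abbrev Coord (n : ℕ) : Type := Fin n → ℂ

/-- `s`, a point of `K` over the affine superspace of dimension `0|2q`, is a global coordinate chart
of `K/M`: the induced morphism `y ↦ s(y)M` to `K/M` is an isomorphism, i.e. every point `k` of `K`
is congruent modulo `M` to `s(y)` for exactly one point `y` of the affine superspace.
(The space underlying `K/M` is a single point, so such charts are defined on all of `K/M`.) -/
def IsChart (q : ℕ) (s : SMat q (Gr (Coord (2 * q)))) : Prop :=
  s ∈ ptsK q (Coord (2 * q)) ∧
    ∀ (V : Type) [AddCommGroup V] [Module ℂ V] [FiniteDimensional ℂ V],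
      ∀ k ∈ ptsK q V, ∃! y : Gr (Coord (2 * q)) →ₐ[ℂ] Gr V,
        IsSuperHom y ∧ ∃ m ∈ ptsM q V, k = s.map y * m

/-- Successive left derivatives along odd directions, `d 0` being applied first. -/
def oddDerivs {U : Type} [AddCommGroup U] [Module ℂ U] {n : ℕ} (d : Fin n → Module.Dual ℂ U)
    (f : Gr U) : Gr U :=
  (List.finRange n).foldl
    (fun a i => CliffordAlgebra.contractLeft (Q := (0 : QuadraticForm ℂ U)) (d i) a) f

/-- The Berezin integral over the affine superspace of dimension `0|n`: the coefficient of
`ξ_1 ⋯ ξ_n`. -/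
def berezin {n : ℕ} (f : Gr (Coord n)) : ℂ :=
  body (oddDerivs (fun i => LinearMap.proj i) f)

/-- The Berezin fibre integral along the projection of `S × 𝔸^{0|n}` to `S`, where `S` is the
superpoint of `V`. -/
def berezinFibre (V : Type) [AddCommGroup V] [Module ℂ V] {n : ℕ} (f : Gr (V × Coord n)) : Gr V :=
  ExteriorAlgebra.map (LinearMap.fst ℂ V (Coord n))
    (oddDerivs (fun i => LinearMap.proj i ∘ₗ LinearMap.snd ℂ V (Coord n)) f)

/-- A Berezinian density on `K/M`, written `|Dξ| f` in a coordinate chart `ξ`. -/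
structure BerDensity (q : ℕ) where
  /-- the chart, as a parametrisation by a point of `K` -/
  chart : SMat q (Gr (Coord (2 * q)))
  isChart : IsChart q chart
  /-- the coefficient function `f` -/
  coeff : Gr (Coord (2 * q))

/-- `K`-invariance of the density `ω`: the integral of `f(gx)` against `ω(x)` over `K/M` is that of
`f(x)`, for all superfunctions `f` on `K/M` and all points `g` of `K` over superpoints `S`.  In the
chart `s`, the action of `g` is the morphism `y` from `S × 𝔸^{0|2q}` to `𝔸^{0|2q}` with
`g s(ξ) M = s(y) M`. -/
def BerDensity.IsInvariant {q : ℕ} (ω : BerDensity q) : Prop :=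
  ∀ (V : Type) [AddCommGroup V] [Module ℂ V] [FiniteDimensional ℂ V],
    ∀ g ∈ ptsK q V, ∀ y : Gr (Coord (2 * q)) →ₐ[ℂ] Gr (V × Coord (2 * q)), IsSuperHom y →
      ∀ m ∈ ptsM q (V × Coord (2 * q)),
        g.map (pullFst V (Coord (2 * q))) * ω.chart.map (pullSnd V (Coord (2 * q))) =
          ω.chart.map y * m →
        ∀ f : Gr (Coord (2 * q)),
          berezinFibre V (pullSnd V (Coord (2 * q)) ω.coeff * y f) =
            algebraMap ℂ (Gr V) (berezin (ω.coeff * f))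

/-- The spherical superfunction `φ_λ(g) = ∫_{K/M} |Dk̇| e^{(λ-ϱ)(H(gk))}` at a point `g` of `G` over
the superpoint of `V`.  The integrand is right `M`-invariant in `k`, so it is evaluated in the chart
of `K/M`. -/
def sphericalFn {q : ℕ} (ω : BerDensity q) (lam : ℂ) {V : Type} [AddCommGroup V] [Module ℂ V]
    (g : SMat q (Gr V)) : Gr V :=
  berezinFibre V
    (pullSnd V (Coord (2 * q)) ω.coeff *
      grExp ((lam - (rho q : ℂ)) •
        iwasawaH q (g.map (pullFst V (Coord (2 * q))) *
          ω.chart.map (pullSnd V (Coord (2 * q))))))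

/-- The value `φ_λ(e^{t h₀})` at the ordinary point `e^{t h₀}`, `t` real; ordinary points are points
over the superpoint of dimension `0|0`. -/
def sphericalAt {q : ℕ} (ω : BerDensity q) (lam : ℂ) (t : ℝ) : ℂ :=
  body (sphericalFn ω lam (V := Coord 0) (expA q (algebraMap ℂ (Gr (Coord 0)) (t : ℂ))))

end OrthoSymplectic

end

/-!
The column `(b, ξ)` with index `1` of a point `k` of `K` satisfies `b² = 1 - ξᵗ J_q ξ` and
determines the coset `kM`, so the `2q` odd coordinates `ξ` form a chart of `K/M`, with
`b = √(1 - ξᵗ J_q ξ)`. The density `|Dξ| / b` is invariant: `K` is generated by `M` and by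
points moving along a single coordinate, for which the action is explicit. It is unique up to a
scalar, since infinitesimal invariance says that `a ↦ ∫ |Dk̇| b a` kills all derivatives `∂ᵢ a`, and
the only such functionals are the multiples of the Berezin integral.

Since `N` fixes `e₀ + e₁` and `K` fixes the upper row, `e^{H(g)}` is the upper entry of
`g (e₀ + e₁)`. Hence
`e^{H(e^{t h₀} k)} = cosh t + b sinh t = e^t (1 + ½ (1 - e^{-2t}) (b - 1))`, and as `b - 1` is
nilpotent, `φ_λ(e^{t h₀})` is a finite binomial series whose coefficients are the moments
`∫ |Dξ| b⁻¹ (b - 1)^j`. Integrating the image of `(b - 1)^j` under the Euler operator `∑ ξᵢ ∂ᵢ`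
yields a first order recursion, so the `j`-th moment is proportional to `(-2)^j binom(2q - j, q)`,
and a binomial identity turns the series into the asserted sum. As `t → ∞` only its term `k = 0`
survives, and `binom(-λ + q, q)` is the quotient of Gamma functions up to a constant.
-/

noncomputable section

namespace OrthoSymplectic

open ExteriorAlgebra (ι)
open CliffordAlgebra (contractLeft_ι contractLeft_algebraMap contractLeft_contractLeft
  contractLeft_comm contractLeft_ι_mul)
open Sum (inl inr elim_inl elim_inr)

/-! ### Grassmann algebras -/

section Grassmann

variable {V W U : Type} [AddCommGroup V] [Module ℂ V] [AddCommGroup W] [Module ℂ W]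
  [AddCommGroup U] [Module ℂ U]

theorem ι_mem_parity_one (v : V) : ι ℂ v ∈ parity V 1 :=
  CliffordAlgebra.ι_mem_evenOdd_one _ v

theorem algebraMap_mem_parity_zero (c : ℂ) : algebraMap ℂ (Gr V) c ∈ parity V 0 :=
  SetLike.algebraMap_mem_graded (CliffordAlgebra.evenOdd (0 : QuadraticForm ℂ V)) c

theorem one_mem_parity_zero : (1 : Gr V) ∈ parity V 0 := by
  simpa using algebraMap_mem_parity_zero (V := V) 1

theorem mul_mem_parity_add {i j : ZMod 2} {a b : Gr V} (ha : a ∈ parity V i)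
    (hb : b ∈ parity V j) : a * b ∈ parity V (i + j) :=
  SetLike.mul_mem_graded (A := CliffordAlgebra.evenOdd (0 : QuadraticForm ℂ V)) ha hb

theorem even_mul_even {a b : Gr V} (ha : a ∈ parity V 0) (hb : b ∈ parity V 0) :
    a * b ∈ parity V 0 := by simpa using mul_mem_parity_add ha hb

theorem even_mul_odd {a b : Gr V} (ha : a ∈ parity V 0) (hb : b ∈ parity V 1) :
    a * b ∈ parity V 1 := by simpa using mul_mem_parity_add ha hb

theorem odd_mul_even {a b : Gr V} (ha : a ∈ parity V 1) (hb : b ∈ parity V 0) :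
    a * b ∈ parity V 1 := by simpa using mul_mem_parity_add ha hb

theorem odd_mul_odd {a b : Gr V} (ha : a ∈ parity V 1) (hb : b ∈ parity V 1) :
    a * b ∈ parity V 0 := by
  have := mul_mem_parity_add ha hb
  rwa [show (1 : ZMod 2) + 1 = 0 from rfl] at this

theorem even_pow {a : Gr V} (ha : a ∈ parity V 0) (n : ℕ) : a ^ n ∈ parity V 0 :=
  pow_mem (S := CliffordAlgebra.even (0 : QuadraticForm ℂ V)) ha n

theorem ι_mul_ι_eq_neg (v w : V) : ι ℂ v * ι ℂ w = -(ι ℂ w * ι ℂ v) :=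
  eq_neg_of_add_eq_zero_left (ExteriorAlgebra.ι_add_mul_swap v w)

theorem commute_ι_mul_ι (v w : V) (b : Gr V) : Commute (ι ℂ v * ι ℂ w) b := by
  induction b using ExteriorAlgebra.induction with
  | algebraMap r => exact (Algebra.commutes r _).symm
  | ι x =>
    change _ * _ = _ * _
    rw [mul_assoc, ι_mul_ι_eq_neg w x, mul_neg, ← mul_assoc, ι_mul_ι_eq_neg v x, neg_mul, neg_neg,
      mul_assoc]
  | mul a b ha hb => exact ha.mul_right hb
  | add a b ha hb => exact ha.add_right hb

theorem commute_of_even {a : Gr V} (ha : a ∈ parity V 0) (b : Gr V) : Commute a b := by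
  induction a, ha using CliffordAlgebra.even_induction with
  | algebraMap r => exact Algebra.commutes r _
  | add _ _ _ _ ihx ihy => exact ihx.add_left ihy
  | ι_mul_ι_mul v w x _ ih => exact (commute_ι_mul_ι v w b).mul_left ih

/-- The parity automorphism of a Grassmann algebra, `1` on even and `-1` on odd superfunctions. -/
abbrev parityAut (V : Type) [AddCommGroup V] [Module ℂ V] : Gr V →ₐ[ℂ] Gr V :=
  CliffordAlgebra.involute (Q := (0 : QuadraticForm ℂ V))

theorem parityAut_ι (v : V) : parityAut V (ι ℂ v) = -ι ℂ v :=
  CliffordAlgebra.involute_ι v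

theorem parityAut_parityAut (a : Gr V) : parityAut V (parityAut V a) = a :=
  CliffordAlgebra.involute_involute a

theorem parityAut_of_even {a : Gr V} (ha : a ∈ parity V 0) : parityAut V a = a :=
  CliffordAlgebra.involute_eq_of_mem_even ha

theorem parityAut_of_odd {a : Gr V} (ha : a ∈ parity V 1) : parityAut V a = -a :=
  CliffordAlgebra.involute_eq_of_mem_odd ha

theorem ι_mul_eq_parityAut_mul (v : V) (b : Gr V) : ι ℂ v * b = parityAut V b * ι ℂ v := by
  induction b using ExteriorAlgebra.induction with
  | algebraMap r => rw [AlgHom.commutes]; exact (Algebra.commutes r _).symm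
  | ι x => rw [parityAut_ι, neg_mul]; exact ι_mul_ι_eq_neg v x
  | mul x y hx hy => rw [map_mul, ← mul_assoc, hx, mul_assoc, hy, mul_assoc]
  | add x y hx hy => rw [mul_add, hx, hy, map_add, add_mul]

theorem odd_mul_eq_parityAut_mul {a : Gr V} (ha : a ∈ parity V 1) (b : Gr V) :
    a * b = parityAut V b * a := by
  induction a, ha using CliffordAlgebra.odd_induction with
  | ι v => exact ι_mul_eq_parityAut_mul v b
  | add _ _ _ _ ihx ihy => rw [add_mul, ihx, ihy, mul_add]
  | ι_mul_ι_mul u w x _ ih =>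
    have huw := (commute_ι_mul_ι u w (parityAut V b)).eq
    change ι ℂ u * ι ℂ w * x * b = parityAut V b * (ι ℂ u * ι ℂ w * x)
    rw [mul_assoc, ih, ← mul_assoc, huw, mul_assoc]

theorem odd_mul_odd_eq_neg {a b : Gr V} (ha : a ∈ parity V 1) (hb : b ∈ parity V 1) :
    a * b = -(b * a) := by
  rw [odd_mul_eq_parityAut_mul ha, parityAut_of_odd hb, neg_mul]

theorem odd_mul_self {a : Gr V} (ha : a ∈ parity V 1) : a * a = 0 := by
  have h : (2 : ℂ) • (a * a) = 0 := by
    rw [two_smul]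
    exact eq_neg_iff_add_eq_zero.mp (odd_mul_odd_eq_neg ha ha)
  exact (smul_eq_zero.mp h).resolve_left two_ne_zero

theorem body_algebraMap (c : ℂ) : body (algebraMap ℂ (Gr V) c) = c :=
  (body (V := V)).commutes c

theorem body_ι (v : V) : body (ι ℂ v) = 0 := by
  simp [body, ExteriorAlgebra.algebraMapInv]

theorem body_of_odd {a : Gr V} (ha : a ∈ parity V 1) : body a = 0 := by
  induction a, ha using CliffordAlgebra.odd_induction with
  | ι v => exact body_ι v
  | add _ _ _ _ ihx ihy => rw [map_add, ihx, ihy, add_zero]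
  | ι_mul_ι_mul _ _ _ _ ih => rw [map_mul, ih, mul_zero]

theorem body_of_isNilpotent {a : Gr V} (ha : IsNilpotent a) : body a = 0 :=
  (ha.map (body (V := V))).eq_zero

theorem isNilpotent_ι_mul_ι (v w : V) : IsNilpotent (ι ℂ v * ι ℂ w) := by
  refine ⟨2, ?_⟩
  rw [pow_two, mul_assoc, ← mul_assoc (ι ℂ w), ι_mul_ι_eq_neg w v, neg_mul, mul_neg, mul_assoc,
    ExteriorAlgebra.ι_sq_zero, mul_zero, mul_zero, neg_zero]

theorem isNilpotent_sub_body {a : Gr V} (ha : a ∈ parity V 0) :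
    IsNilpotent (a - algebraMap ℂ (Gr V) (body a)) := by
  induction a, ha using CliffordAlgebra.even_induction with
  | algebraMap r =>
    change IsNilpotent (algebraMap ℂ (Gr V) r - algebraMap ℂ (Gr V) (body (algebraMap ℂ (Gr V) r)))
    rw [body_algebraMap, sub_self]
    exact IsNilpotent.zero
  | add x y hx _ ihx ihy =>
    rw [map_add, map_add, add_sub_add_comm]
    exact (commute_of_even (sub_mem hx (algebraMap_mem_parity_zero _)) _).isNilpotent_add ihx ihy
  | ι_mul_ι_mul v w x _ _ =>
    have hnil : IsNilpotent (ι ℂ v * ι ℂ w * x) :=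
      (commute_ι_mul_ι v w x).isNilpotent_mul_right (isNilpotent_ι_mul_ι v w)
    change IsNilpotent (ι ℂ v * ι ℂ w * x - algebraMap ℂ (Gr V) (body (ι ℂ v * ι ℂ w * x)))
    rwa [body_of_isNilpotent hnil, map_zero, sub_zero]

theorem isNilpotent_of_body_eq_zero {a : Gr V} (ha : a ∈ parity V 0) (h : body a = 0) :
    IsNilpotent a := by
  simpa [h] using isNilpotent_sub_body ha

instance finite_gr [FiniteDimensional ℂ V] : Module.Finite ℂ (Gr V) :=
  Module.Finite.of_basis (Module.finBasis ℂ V).ExteriorAlgebra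

instance isStablyFiniteRing_gr [FiniteDimensional ℂ V] : IsStablyFiniteRing (Gr V) where
  isDedekindFiniteMonoid n :=
    have := IsArtinianRing.of_finite ℂ (Matrix (Fin n) (Fin n) (Gr V))
    inferInstance

/-- The commutative algebra of even superfunctions. -/
abbrev EvenGr (V : Type) [AddCommGroup V] [Module ℂ V] : Subalgebra ℂ (Gr V) :=
  CliffordAlgebra.even (0 : QuadraticForm ℂ V)

instance commRing_evenGr : CommRing (EvenGr V) where
  mul_comm a b := Subtype.ext (commute_of_even a.2 b)

theorem isNilpotent_evenGr_iff {a : EvenGr V} : IsNilpotent a ↔ IsNilpotent (a : Gr V) :=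
  (IsNilpotent.map_iff (f := (EvenGr V).val) Subtype.val_injective).symm

theorem isUnit_evenGr {a : EvenGr V} (h : body (a : Gr V) ≠ 0) : IsUnit a := by
  have hunit : IsUnit (algebraMap ℂ (EvenGr V) (body (a : Gr V))) := (IsUnit.mk0 _ h).map _
  have hnil : IsNilpotent (a - algebraMap ℂ (EvenGr V) (body (a : Gr V))) :=
    isNilpotent_evenGr_iff.mpr (isNilpotent_sub_body a.2)
  simpa using hnil.isUnit_add_left_of_commute hunit (Commute.all _ _)

theorem exists_even_inverse {a : Gr V} (ha : a ∈ parity V 0) (h : body a ≠ 0) :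
    ∃ b ∈ parity V 0, a * b = 1 ∧ b * a = 1 := by
  obtain ⟨u, hu⟩ := isUnit_evenGr (a := ⟨a, ha⟩) h
  obtain rfl : (u : Gr V) = a := congrArg Subtype.val hu
  exact ⟨_, (u⁻¹ : (EvenGr V)ˣ).1.2, congrArg Subtype.val u.mul_inv,
    congrArg Subtype.val u.inv_mul⟩

theorem eq_of_mul_self_eq_of_body_eq_one {a b : Gr V} (ha : a ∈ parity V 0) (hb : b ∈ parity V 0)
    (ha1 : body a = 1) (hb1 : body b = 1) (h : a * a = b * b) : a = b := by
  have hbody : body (a + b) ≠ 0 := by rw [map_add, ha1, hb1]; norm_num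
  obtain ⟨c, -, -, hc⟩ := exists_even_inverse (add_mem ha hb) hbody
  have hprod : (a + b) * (a - b) = 0 := by
    rw [← (commute_of_even ha b).mul_self_sub_mul_self_eq, h, sub_self]
  rw [← sub_eq_zero, ← one_mul (a - b), ← hc, mul_assoc, hprod, mul_zero]

/-! ### Morphisms of superpoints -/

theorem isSuperHom_of_ι {φ : Gr V →ₐ[ℂ] Gr W} (h : ∀ v, φ (ι ℂ v) ∈ parity W 1) :
    IsSuperHom φ := by
  intro i a ha
  fin_cases i
  · induction a, ha using CliffordAlgebra.even_induction with
    | algebraMap r => exact (φ.commutes r).symm ▸ algebraMap_mem_parity_zero r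
    | add _ _ _ _ ihx ihy => rw [map_add]; exact add_mem ihx ihy
    | ι_mul_ι_mul v w _ _ ih =>
      rw [map_mul, map_mul]
      exact even_mul_even (odd_mul_odd (h v) (h w)) ih
  · induction a, ha using CliffordAlgebra.odd_induction with
    | ι v => exact h v
    | add _ _ _ _ ihx ihy => rw [map_add]; exact add_mem ihx ihy
    | ι_mul_ι_mul v w _ _ ih =>
      rw [map_mul, map_mul]
      exact even_mul_odd (odd_mul_odd (h v) (h w)) ih

theorem IsSuperHom.comp {φ : Gr V →ₐ[ℂ] Gr W} {ψ : Gr U →ₐ[ℂ] Gr V} (hφ : IsSuperHom φ)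
    (hψ : IsSuperHom ψ) : IsSuperHom (φ.comp ψ) :=
  fun i a ha => hφ i _ (hψ i a ha)

theorem isSuperHom_id : IsSuperHom (AlgHom.id ℂ (Gr V)) := fun _ _ h => h

theorem isSuperHom_map (f : V →ₗ[ℂ] W) : IsSuperHom (ExteriorAlgebra.map f) :=
  isSuperHom_of_ι fun v => by rw [ExteriorAlgebra.map_apply_ι]; exact ι_mem_parity_one _

theorem isSuperHom_pullFst : IsSuperHom (pullFst V W) := isSuperHom_map _

theorem isSuperHom_pullSnd : IsSuperHom (pullSnd V W) := isSuperHom_map _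

theorem IsSuperHom.body_apply {φ : Gr V →ₐ[ℂ] Gr W} (hφ : IsSuperHom φ) (a : Gr V) :
    body (φ a) = body a := by
  have : (body (V := W)).comp φ = body := by
    ext v
    change body (φ (ι ℂ v)) = body (ι ℂ v)
    rw [body_ι, body_of_odd (hφ 1 _ (ι_mem_parity_one v))]
  exact DFunLike.congr_fun this a

theorem IsSuperHom.apply_parityAut {φ : Gr V →ₐ[ℂ] Gr W} (hφ : IsSuperHom φ) (a : Gr V) :
    φ (parityAut V a) = parityAut W (φ a) := by
  have : φ.comp (parityAut V) = (parityAut W).comp φ := by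
    ext v
    change φ (parityAut V (ι ℂ v)) = parityAut W (φ (ι ℂ v))
    rw [parityAut_ι, map_neg, parityAut_of_odd (hφ 1 _ (ι_mem_parity_one v))]
  exact DFunLike.congr_fun this a

section Coordinates

variable {n : ℕ}

/-- The odd coordinate `ξ_i` of the affine superspace of dimension `0|n`. -/
def oddCoord (i : Fin n) : Gr (Coord n) := ι ℂ (Pi.single i 1)

theorem oddCoord_mem (i : Fin n) : oddCoord i ∈ parity (Coord n) 1 := ι_mem_parity_one _

theorem ι_eq_sum_smul_oddCoord (v : Coord n) : ι ℂ v = ∑ i, v i • oddCoord i := by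
  conv_lhs => rw [pi_eq_sum_univ' v, map_sum]
  exact Finset.sum_congr rfl fun i _ => map_smul _ _ _

theorem algHom_ext_oddCoord {A : Type} [Ring A] [Algebra ℂ A] {φ ψ : Gr (Coord n) →ₐ[ℂ] A}
    (h : ∀ i, φ (oddCoord i) = ψ (oddCoord i)) : φ = ψ := by
  ext v
  exact h v

variable (x : Fin n → Gr V) (hx : ∀ i, x i ∈ parity V 1)

/-- The morphism from the superpoint of `V` to the affine superspace of dimension `0|n` with odd
components `x i`. -/
def coordLift : Gr (Coord n) →ₐ[ℂ] Gr V :=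
  ExteriorAlgebra.lift ℂ ⟨Fintype.linearCombination ℂ x, fun v => odd_mul_self <| by
    rw [Fintype.linearCombination_apply]
    exact sum_mem fun i _ => Submodule.smul_mem _ _ (hx i)⟩

theorem coordLift_oddCoord (i : Fin n) : coordLift x hx (oddCoord i) = x i := by
  rw [coordLift, oddCoord, ExteriorAlgebra.lift_ι_apply]
  simp

theorem isSuperHom_coordLift : IsSuperHom (coordLift x hx) :=
  isSuperHom_of_ι fun v => by
    rw [ι_eq_sum_smul_oddCoord, map_sum]
    refine sum_mem fun i _ => ?_
    rw [map_smul, coordLift_oddCoord]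
    exact Submodule.smul_mem _ _ (hx i)

end Coordinates

end Grassmann

/-! ### Binomial coefficients with complex upper argument -/

section Binomial

open Finset

theorem sub_one_pow_eq_sum_range {R : Type*} [CommRing R] (x : R) {j m : ℕ}
    (hj : j < m) :
    (x - 1) ^ j = ∑ k ∈ range m, x ^ k * ((-1) ^ (j - k) * (j.choose k : R)) := by
  rw [sub_eq_add_neg, add_pow]
  simp only [mul_assoc]
  refine sum_subset (range_mono (Nat.succ_le_of_lt hj)) fun k _ hk => ?_
  rw [Nat.choose_eq_zero_of_lt (by simpa using hk), Nat.cast_zero, mul_zero, mul_zero]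

section BinomialRing

variable {R : Type*} [CommRing R] [BinomialRing R]

theorem ringChoose_neg (r : R) (n : ℕ) :
    Ring.choose (-r) n = (-1) ^ n * Ring.choose (r + n - 1) n := by
  rw [Ring.choose_neg, Units.smul_def, zsmul_eq_mul, Int.negOnePow_def, zpow_natCast]
  push_cast
  rfl

theorem ringChoose_add_mul_natChoose (μ : R) (k i m : ℕ) :
    Ring.choose μ (k + i) * ((-1) ^ i * ((k + i).choose k : R)) * ((k + i + 2 * m).choose m : R) =
      Ring.choose μ k * ((-1) ^ (i + m) *
        (Ring.choose (μ - k) i * Ring.choose (-((k + i + m + 1 : ℕ) : R)) m)) := by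
  have hmul : ((k + i).choose k : R) * Ring.choose μ (k + i) =
      Ring.choose μ k * Ring.choose (μ - k) i := by
    have := Ring.choose_smul_choose μ (Nat.le_add_right k i)
    rwa [nsmul_eq_mul, Nat.add_sub_cancel_left] at this
  have hneg : Ring.choose (-((k + i + m + 1 : ℕ) : R)) m =
      (-1) ^ m * ((k + i + 2 * m).choose m : R) := by
    rw [ringChoose_neg, ← Ring.choose_natCast]
    congr 2
    push_cast
    ring
  have hsign : ((-1 : R) ^ m) * (-1) ^ m = 1 := by rw [← mul_pow]; simp
  rw [hneg, pow_add]
  linear_combination ((-1) ^ i * ((k + i + 2 * m).choose m : R)) * hmul -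
    (Ring.choose μ k * (-1) ^ i * Ring.choose (μ - k) i * ((k + i + 2 * m).choose m : R)) * hsign

theorem sum_ringChoose_mul_natChoose (μ : R) (k n : ℕ) :
    ∑ j ∈ range (k + n + 1), Ring.choose μ j * ((-1) ^ (j - k) * (j.choose k : R)) *
      ((2 * (k + n) - j).choose (k + n) : R) =
    Ring.choose μ k * Ring.choose (2 * (k + n : ℕ) - μ) n := by
  rw [add_assoc, sum_range_add, sum_eq_zero fun j hj => by
    rw [Nat.choose_eq_zero_of_lt (mem_range.mp hj)]; simp, zero_add]
  have hterm : ∀ i ∈ range (n + 1), Ring.choose μ (k + i) *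
      ((-1) ^ (k + i - k) * ((k + i).choose k : R)) *
        ((2 * (k + n) - (k + i)).choose (k + n) : R) =
      Ring.choose μ k * ((-1) ^ n *
        (Ring.choose (μ - k) i * Ring.choose (-((k + n + 1 : ℕ) : R)) (n - i))) := by
    intro i hi
    obtain ⟨m, rfl⟩ := Nat.exists_eq_add_of_le (mem_range_succ_iff.mp hi)
    rw [show 2 * (k + (i + m)) - (k + i) = k + (i + m) + m by omega,
      Nat.choose_symm_add (a := k + (i + m)), show k + (i + m) + m = k + i + 2 * m by omega,
      Nat.add_sub_cancel_left, Nat.add_sub_cancel_left, ringChoose_add_mul_natChoose,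
      add_assoc k i m]
  rw [sum_congr rfl hterm, ← mul_sum, ← mul_sum, ← Nat.sum_antidiagonal_eq_sum_range_succ
    (fun a b => Ring.choose (μ - k) a * Ring.choose (-((k + n + 1 : ℕ) : R)) b),
    ← Ring.add_choose_eq n (Commute.all _ _), ← neg_sub μ, ringChoose_neg]
  congr 3
  push_cast
  ring

theorem sum_ringChoose_mul_sub_one_pow (q : ℕ) (μ x : R) :
    ∑ j ∈ range (q + 1), Ring.choose μ j * ((x - 1) ^ j * ((2 * q - j).choose q : R)) =
      ∑ k ∈ range (q + 1), Ring.choose μ k * Ring.choose (2 * q - μ) (q - k) * x ^ k :=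
  calc ∑ j ∈ range (q + 1), Ring.choose μ j * ((x - 1) ^ j * ((2 * q - j).choose q : R))
      = ∑ j ∈ range (q + 1), ∑ k ∈ range (q + 1), Ring.choose μ j *
          ((-1) ^ (j - k) * (j.choose k : R)) * ((2 * q - j).choose q : R) * x ^ k := by
        refine sum_congr rfl fun j hj => ?_
        rw [sub_one_pow_eq_sum_range x (mem_range.mp hj), sum_mul, mul_sum]
        exact sum_congr rfl fun k _ => by ring
    _ = ∑ k ∈ range (q + 1), Ring.choose μ k * Ring.choose (2 * q - μ) (q - k) * x ^ k := by
        rw [sum_comm]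
        refine sum_congr rfl fun k hk => ?_
        obtain ⟨n, rfl⟩ := Nat.exists_eq_add_of_le (mem_range_succ_iff.mp hk)
        rw [← sum_mul, sum_ringChoose_mul_natChoose, Nat.add_sub_cancel_left]

end BinomialRing

theorem ringChoose_eq_prod {K : Type*} [Field K] [CharZero K] (a : K) (n : ℕ) :
    Ring.choose a n = (n.factorial : K)⁻¹ * ∏ i ∈ range n, (a - i) := by
  rw [Ring.choose_eq_smul, smul_eq_mul, ← descPochhammer_eval_eq_prod_range,
    ← Polynomial.aeval_eq_smeval, ← descPochhammer_map (Int.castRingHom K) n, Polynomial.eval_map]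
  rfl

open Polynomial in
theorem exists_polynomial_eval_eq_ringChoose {K : Type*} [Field K] [CharZero K] (n : ℕ) :
    ∃ p : K[X], ∀ a : K, Ring.choose a n = p.eval a :=
  ⟨C ((n.factorial : K)⁻¹) * ∏ i ∈ range n, (X - C (i : K)), fun a => by
    simp only [ringChoose_eq_prod, eval_mul, eval_C, eval_prod, eval_sub, eval_X]⟩

theorem inv_Gamma_sub_natCast (lam : ℂ) (n : ℕ) : (Complex.Gamma (lam - n))⁻¹ =
    (∏ i ∈ range n, (lam - 1 - i)) * (Complex.Gamma lam)⁻¹ := by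
  induction n with
  | zero => simp
  | succ n ih =>
    have h := Complex.one_div_Gamma_eq_self_mul_one_div_Gamma_add_one (lam - (n + 1 : ℕ))
    rw [show lam - (n + 1 : ℕ) + 1 = lam - n by push_cast; ring, ih] at h
    rw [h, prod_range_succ]
    push_cast
    ring

theorem ringChoose_neg_add_eq_Gamma_div {lam : ℂ} (h : 0 < lam.re) (q : ℕ) :
    Ring.choose (-lam + q) q =
      ((-1) ^ q * (q.factorial : ℂ)⁻¹) * (Complex.Gamma lam / Complex.Gamma (lam - q)) := by
  rw [show -lam + q = -(lam - q) by ring, ringChoose_neg,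
    show lam - q + q - 1 = lam - 1 by ring, ringChoose_eq_prod, div_eq_mul_inv,
    inv_Gamma_sub_natCast, mul_comm (∏ i ∈ range q, _),
    mul_inv_cancel_left₀ (Complex.Gamma_ne_zero_of_re_pos h), mul_assoc]

end Binomial

/-! ### Exponentials of nilpotent elements -/

section NilExp

variable {A B : Type} [Ring A] [Algebra ℂ A] [Ring B] [Algebra ℂ B]

theorem nilExp_eq_sum {a : A} {k : ℕ} (h : a ^ k = 0) :
    nilExp a = ∑ i ∈ Finset.range k, ((i.factorial : ℂ)⁻¹) • a ^ i := by
  let : Module ℚ A := Module.compHom A (algebraMap ℚ ℂ)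
  rw [nilExp, IsNilpotent.exp_eq_sum (A := A) h]
  refine Finset.sum_congr rfl fun i _ => ?_
  change (algebraMap ℚ ℂ ((i.factorial : ℚ)⁻¹)) • a ^ i = _
  rw [map_inv₀, map_natCast]

theorem nilExp_add {a b : A} (h : Commute a b) (ha : IsNilpotent a) (hb : IsNilpotent b) :
    nilExp (a + b) = nilExp a * nilExp b := by
  let : Module ℚ A := Module.compHom A (algebraMap ℚ ℂ)
  exact IsNilpotent.exp_add_of_commute h ha hb

theorem nilExp_zero : nilExp (0 : A) = 1 := by
  let : Module ℚ A := Module.compHom A (algebraMap ℚ ℂ)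
  exact IsNilpotent.exp_zero

theorem nilExp_mul_nilExp_neg {a : A} (ha : IsNilpotent a) : nilExp a * nilExp (-a) = 1 := by
  rw [← nilExp_add (Commute.neg_right (Commute.refl a)) ha ha.neg, add_neg_cancel, nilExp_zero]

theorem nilExp_nsmul {a : A} (ha : IsNilpotent a) (n : ℕ) : nilExp (n • a) = nilExp a ^ n := by
  induction n with
  | zero => rw [zero_smul, nilExp_zero, pow_zero]
  | succ n ih =>
    rw [succ_nsmul, nilExp_add ((Commute.refl a).smul_left n) (ha.smul n) ha, ih, pow_succ]

theorem map_nilExp (φ : A →ₐ[ℂ] B) {a : A} (ha : IsNilpotent a) :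
    φ (nilExp a) = nilExp (φ a) := by
  obtain ⟨k, hk⟩ := ha
  rw [nilExp_eq_sum hk, nilExp_eq_sum (k := k) (by rw [← map_pow, hk, map_zero]), map_sum]
  simp only [map_smul, map_pow]

theorem one_add_pow_eq_sum_ringChoose {X : A} {k : ℕ} (hX : X ^ k = 0) (n : ℕ) :
    (1 + X) ^ n = ∑ j ∈ Finset.range k, Ring.choose (n : ℂ) j • X ^ j := by
  have hzero : ∀ j ∉ Finset.range (n + 1) ∩ Finset.range k,
      Ring.choose (n : ℂ) j • X ^ j = 0 := by
    intro j hj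
    simp only [Finset.mem_inter, Finset.mem_range, not_and_or, not_lt] at hj
    rcases hj with hj | hj
    · rw [Ring.choose_natCast, Nat.choose_eq_zero_of_lt hj, Nat.cast_zero, zero_smul]
    · rw [pow_eq_zero_of_le hj hX, smul_zero]
  calc (1 + X) ^ n = ∑ j ∈ Finset.range (n + 1), Ring.choose (n : ℂ) j • X ^ j := by
        rw [add_comm, (Commute.one_right X).add_pow]
        refine Finset.sum_congr rfl fun j _ => ?_
        rw [Ring.choose_natCast, one_pow, mul_one, Nat.cast_smul_eq_nsmul, nsmul_eq_mul,
          Nat.cast_comm]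
    _ = ∑ j ∈ Finset.range (n + 1) ∩ Finset.range k, Ring.choose (n : ℂ) j • X ^ j :=
        (Finset.sum_subset Finset.inter_subset_left fun j _ => hzero j).symm
    _ = ∑ j ∈ Finset.range k, Ring.choose (n : ℂ) j • X ^ j :=
        Finset.sum_subset Finset.inter_subset_right fun j _ => hzero j

open Polynomial in
/- Both sides are polynomial in `μ` and agree for natural numbers `μ`. -/
theorem nilExp_smul_eq_sum_ringChoose {N X : A} (hN : IsNilpotent N) (hX : nilExp N = 1 + X)
    {k : ℕ} (hk : X ^ k = 0) (μ : ℂ) :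
    nilExp (μ • N) = ∑ j ∈ Finset.range k, Ring.choose μ j • X ^ j := by
  obtain ⟨m, hm⟩ := hN
  rw [← sub_eq_zero, ← Module.forall_dual_apply_eq_zero_iff ℂ]
  intro ℓ
  choose p hp using exists_polynomial_eval_eq_ringChoose (K := ℂ)
  set P : ℂ[X] := (∑ i ∈ Finset.range m, C ((i.factorial : ℂ)⁻¹ * ℓ (N ^ i)) * Polynomial.X ^ i) -
    ∑ j ∈ Finset.range k, C (ℓ (X ^ j)) * p j with hP
  have hev (ν : ℂ) : ℓ (nilExp (ν • N) - ∑ j ∈ Finset.range k, Ring.choose ν j • X ^ j) =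
      P.eval ν := by
    rw [nilExp_eq_sum (k := m) (by rw [_root_.smul_pow, hm, smul_zero])]
    simp only [hP, map_sub, map_sum, map_smul, _root_.smul_pow, smul_eq_mul, eval_sub,
      eval_finsetSum, eval_mul, eval_C, eval_pow, eval_X, hp]
    congr 1
    · exact Finset.sum_congr rfl fun i _ => by ring
    · exact Finset.sum_congr rfl fun j _ => mul_comm _ _
  have hP0 : P = 0 := by
    refine Polynomial.eq_zero_of_infinite_isRoot P
      ((Set.infinite_range_of_injective (Nat.cast_injective (R := ℂ))).mono ?_)
    rintro _ ⟨n, rfl⟩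
    change P.eval (n : ℂ) = 0
    rw [← hev, Nat.cast_smul_eq_nsmul, nilExp_nsmul ⟨m, hm⟩, hX, one_add_pow_eq_sum_ringChoose hk,
      sub_self, map_zero]
  rw [hev, hP0, eval_zero]

end NilExp

section NilLog

variable {A : Type} [CommRing A] [Algebra ℂ A]

theorem exists_nilExp_neg_eq {x : A} (hx : IsNilpotent x) :
    ∃ s, nilExp (-x) = 1 - x + x ^ 2 * s := by
  obtain ⟨n, hn⟩ := hx
  have hn' : (-x) ^ (n + 2) = 0 := by rw [neg_pow, pow_add x, hn, zero_mul, mul_zero]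
  refine ⟨∑ i ∈ Finset.range n, (((i + 2).factorial : ℂ)⁻¹) • (-x) ^ i, ?_⟩
  have hpow (i : ℕ) : (-x) ^ (i + 1 + 1) = x ^ 2 * (-x) ^ i := by ring
  rw [nilExp_eq_sum hn', Finset.sum_range_succ', Finset.sum_range_succ']
  simp only [hpow, Finset.mul_sum, mul_smul_comm, add_assoc, Nat.reduceAdd, zero_add, pow_one,
    pow_zero, Nat.factorial_zero, Nat.factorial_one, Nat.cast_one, inv_one, one_smul]
  ring

/- Multiplying `1 + x` by `exp (-x)` replaces `x` by a multiple of `x²`. -/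
theorem exists_nilExp_eq_one_add {x : A} (hx : IsNilpotent x) :
    ∃ N, IsNilpotent N ∧ nilExp N = 1 + x := by
  obtain ⟨n, hn⟩ := hx
  induction n using Nat.strong_induction_on generalizing x with
  | _ n ih =>
    obtain hn1 | hn1 := le_or_gt n 1
    · have hx0 : x = 0 := by simpa using pow_eq_zero_of_le hn1 hn
      exact ⟨0, IsNilpotent.zero, by rw [nilExp_zero, hx0, add_zero]⟩
    have hx : IsNilpotent x := ⟨n, hn⟩
    obtain ⟨s, hs⟩ := exists_nilExp_neg_eq hx
    have hmul : (1 + x) * nilExp (-x) = 1 + x ^ 2 * (-1 + s + x * s) := by rw [hs]; ring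
    have hpow : (x ^ 2 * (-1 + s + x * s)) ^ (n - 1) = 0 := by
      rw [mul_pow, ← pow_mul, pow_eq_zero_of_le (by omega) hn, zero_mul]
    obtain ⟨N, hN, hexp⟩ := ih (n - 1) (by omega) hpow
    refine ⟨x + N, (Commute.all x N).isNilpotent_add hx hN, ?_⟩
    rw [nilExp_add (Commute.all x N) hx hN, hexp, ← hmul, mul_left_comm, nilExp_mul_nilExp_neg hx,
      mul_one]

end NilLog

/-! ### The exponential of a superfunction -/

section GrExp

variable {V W : Type} [AddCommGroup V] [Module ℂ V] [AddCommGroup W] [Module ℂ W]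

theorem nilExp_mem_parity {a : Gr V} (ha : a ∈ parity V 0) (hn : IsNilpotent a) :
    nilExp a ∈ parity V 0 := by
  obtain ⟨k, hk⟩ := hn
  rw [nilExp_eq_sum hk]
  exact sum_mem fun i _ => Submodule.smul_mem _ _ (even_pow ha i)

theorem body_nilExp {a : Gr V} (hn : IsNilpotent a) : body (nilExp a) = 1 := by
  rw [map_nilExp _ hn, body_of_isNilpotent hn, nilExp_zero]

theorem exists_even_log {x : Gr V} (hx : x ∈ parity V 0) (h : body x = 1) :
    ∃ N ∈ parity V 0, IsNilpotent N ∧ nilExp N = x := by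
  have hx1 : x - 1 ∈ parity V 0 := sub_mem hx one_mem_parity_zero
  obtain ⟨N, hN, hexp⟩ := exists_nilExp_eq_one_add (A := EvenGr V) (x := ⟨x - 1, hx1⟩) <|
    isNilpotent_evenGr_iff.mpr <|
      isNilpotent_of_body_eq_zero hx1 (by rw [map_sub, map_one, h, sub_self])
  refine ⟨N, N.2, isNilpotent_evenGr_iff.mp hN, ?_⟩
  have := (map_nilExp (EvenGr V).val hN).symm.trans (congrArg (EvenGr V).val hexp)
  simpa using this

theorem exists_even_sqrt {x : Gr V} (hx : x ∈ parity V 0) (h : body x = 1) :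
    ∃ b ∈ parity V 0, body b = 1 ∧ b * b = x := by
  obtain ⟨N, hN, hNnil, hexp⟩ := exists_even_log hx h
  have hnil := hNnil.smul (2⁻¹ : ℂ)
  refine ⟨nilExp ((2⁻¹ : ℂ) • N), nilExp_mem_parity (Submodule.smul_mem _ _ hN) hnil,
    body_nilExp hnil, ?_⟩
  rw [← nilExp_add (Commute.refl _) hnil hnil, ← add_smul, ← hexp]
  norm_num

theorem grExp_algebraMap_add (z : ℂ) {N : Gr V} (hN : IsNilpotent N) :
    grExp (algebraMap ℂ (Gr V) z + N) = Complex.exp z • nilExp N := by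
  rw [grExp, map_add, body_algebraMap, body_of_isNilpotent hN, add_zero, add_sub_cancel_left]

theorem grExp_add {a b : Gr V} (ha : a ∈ parity V 0) (hb : b ∈ parity V 0) :
    grExp (a + b) = grExp a * grExp b := by
  have hcomm := commute_of_even (sub_mem ha (algebraMap_mem_parity_zero (body a)))
    (b - algebraMap ℂ (Gr V) (body b))
  have hsplit : a + b - algebraMap ℂ (Gr V) (body (a + b)) =
      (a - algebraMap ℂ (Gr V) (body a)) + (b - algebraMap ℂ (Gr V) (body b)) := by
    rw [map_add, map_add, add_sub_add_comm]
  rw [grExp, hsplit, nilExp_add hcomm (isNilpotent_sub_body ha) (isNilpotent_sub_body hb),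
    map_add, Complex.exp_add, grExp, grExp, smul_mul_smul_comm]

theorem grExp_algebraMap (z : ℂ) :
    grExp (algebraMap ℂ (Gr V) z) = algebraMap ℂ (Gr V) (Complex.exp z) := by
  simpa only [add_zero, nilExp_zero, Algebra.algebraMap_eq_smul_one] using
    grExp_algebraMap_add z (IsNilpotent.zero (R := Gr V))

theorem grExp_zero : grExp (0 : Gr V) = 1 := by
  simpa using grExp_algebraMap (V := V) 0

theorem grExp_mul_grExp_neg {a : Gr V} (ha : a ∈ parity V 0) : grExp a * grExp (-a) = 1 := by
  rw [← grExp_add ha (neg_mem ha), add_neg_cancel, grExp_zero]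

theorem grExp_mem_parity {a : Gr V} (ha : a ∈ parity V 0) : grExp a ∈ parity V 0 :=
  Submodule.smul_mem _ _ <|
    nilExp_mem_parity (sub_mem ha (algebraMap_mem_parity_zero _)) (isNilpotent_sub_body ha)

theorem body_grExp {a : Gr V} (ha : a ∈ parity V 0) :
    body (grExp a) = Complex.exp (body a) := by
  rw [grExp, map_smul, body_nilExp (isNilpotent_sub_body ha), smul_eq_mul, mul_one]

theorem map_grExp {φ : Gr V →ₐ[ℂ] Gr W} (hφ : IsSuperHom φ) {a : Gr V} (ha : a ∈ parity V 0) :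
    φ (grExp a) = grExp (φ a) := by
  rw [grExp, map_smul, map_nilExp _ (isNilpotent_sub_body ha), grExp, hφ.body_apply, map_sub,
    AlgHom.commutes]

theorem grExp_smul_eq_sum_ringChoose {h X : Gr V} (hh : h ∈ parity V 0)
    (hX : grExp h = Complex.exp (body h) • (1 + X)) {k : ℕ} (hk : X ^ k = 0) (μ : ℂ) :
    grExp (μ • h) = Complex.exp (μ * body h) •
      ∑ j ∈ Finset.range k, Ring.choose μ j • X ^ j := by
  have hnil := isNilpotent_sub_body hh
  have hsplit : μ • h =
      algebraMap ℂ (Gr V) (μ * body h) + μ • (h - algebraMap ℂ (Gr V) (body h)) := by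
    simp only [Algebra.algebraMap_eq_smul_one, mul_smul, smul_sub]
    abel
  rw [hsplit, grExp_algebraMap_add _ (hnil.smul μ), nilExp_smul_eq_sum_ringChoose hnil
    (smul_right_injective _ (Complex.exp_ne_zero (body h)) hX) hk]

end GrExp

/-! ### Odd derivatives and Berezin integrals -/

section Derivative

variable {W U : Type} [AddCommGroup W] [Module ℂ W] [AddCommGroup U] [Module ℂ U]

/-- The left derivative of superfunctions along an odd direction. -/
abbrev oddDeriv (d : Module.Dual ℂ U) : Gr U →ₗ[ℂ] Gr U :=
  CliffordAlgebra.contractLeft (Q := (0 : QuadraticForm ℂ U)) d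

theorem oddDeriv_mul (d : Module.Dual ℂ U) (a b : Gr U) :
    oddDeriv d (a * b) = oddDeriv d a * b + parityAut U a * oddDeriv d b := by
  induction a using ExteriorAlgebra.induction generalizing b with
  | algebraMap r =>
    rw [contractLeft_algebraMap, zero_mul, zero_add, AlgHom.commutes, ← Algebra.smul_def, map_smul,
      Algebra.smul_def]
  | ι v =>
    rw [contractLeft_ι_mul, contractLeft_ι, parityAut_ι, neg_mul, ← Algebra.smul_def,
      sub_eq_add_neg]
  | mul x y hx hy => rw [mul_assoc, hx, hy, hx, map_mul]; noncomm_ring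
  | add x y hx hy => rw [add_mul, map_add, hx, hy, map_add, map_add]; noncomm_ring

theorem oddDeriv_parityAut (d : Module.Dual ℂ U) (a : Gr U) :
    oddDeriv d (parityAut U a) = -parityAut U (oddDeriv d a) := by
  induction a using ExteriorAlgebra.induction with
  | algebraMap r => rw [AlgHom.commutes, contractLeft_algebraMap, map_zero, neg_zero]
  | ι v => rw [parityAut_ι, map_neg, contractLeft_ι, AlgHom.commutes]
  | mul x y hx hy =>
    rw [map_mul, oddDeriv_mul, hx, hy, oddDeriv_mul, map_add, map_mul, map_mul]
    noncomm_ring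
  | add x y hx hy => rw [map_add, map_add, hx, hy, map_add, map_add, neg_add]

theorem oddDeriv_map (d : Module.Dual ℂ W) (f : U →ₗ[ℂ] W) (a : Gr U) :
    oddDeriv d (ExteriorAlgebra.map f a) = ExteriorAlgebra.map f (oddDeriv (d ∘ₗ f) a) := by
  induction a using ExteriorAlgebra.induction with
  | algebraMap r =>
    rw [AlgHom.commutes, contractLeft_algebraMap, contractLeft_algebraMap, map_zero]
  | ι v =>
    rw [ExteriorAlgebra.map_apply_ι, contractLeft_ι, contractLeft_ι, AlgHom.commutes,
      LinearMap.comp_apply]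
  | mul x y hx hy =>
    rw [map_mul, oddDeriv_mul, hx, hy, oddDeriv_mul, map_add, map_mul, map_mul,
      (isSuperHom_map f).apply_parityAut]
  | add x y hx hy => rw [map_add, map_add, hx, hy, map_add, map_add]

theorem sub_ι_mul_oddDeriv (d : Module.Dual ℂ U) (v : U) (a : Gr U) :
    a - ι ℂ v * oddDeriv d a = ExteriorAlgebra.map (LinearMap.id - d.smulRight v) a := by
  induction a using CliffordAlgebra.left_induction with
  | algebraMap r =>
    rw [contractLeft_algebraMap, mul_zero, sub_zero]
    exact (AlgHom.commutes _ r).symm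
  | add x y hx hy => rw [map_add, mul_add, map_add, ← hx, ← hy]; abel
  | ι_mul x w hx =>
    have hw : ExteriorAlgebra.map (LinearMap.id - d.smulRight v) (ι ℂ w) =
        ι ℂ w - d w • ι ℂ v := by
      rw [ExteriorAlgebra.map_apply_ι, ← map_smul, ← map_sub]
      rfl
    have hvv : ι ℂ v * (ι ℂ v * oddDeriv d x) = 0 := by
      rw [← mul_assoc, ExteriorAlgebra.ι_sq_zero, zero_mul]
    have hvw : ι ℂ v * (ι ℂ w * oddDeriv d x) = -(ι ℂ w * (ι ℂ v * oddDeriv d x)) := by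
      rw [← mul_assoc, ι_mul_ι_eq_neg, neg_mul, mul_assoc]
    change ι ℂ w * x - ι ℂ v * oddDeriv d (ι ℂ w * x) =
      ExteriorAlgebra.map (LinearMap.id - d.smulRight v) (ι ℂ w * x)
    rw [contractLeft_ι_mul, map_mul, ← hx, hw, sub_mul, mul_sub, mul_sub, mul_sub, smul_mul_assoc,
      smul_mul_assoc, hvv, hvw, smul_zero, mul_smul_comm]
    abel

section Lists

variable {n : ℕ}

/-- Successive left derivatives along a list of directions, the head of the list being applied
first; the recursive form of `oddDerivs`. -/
def oddDerivList (d : Fin n → Module.Dual ℂ U) : List (Fin n) → Gr U →ₗ[ℂ] Gr U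
  | [] => LinearMap.id
  | i :: l => oddDerivList d l ∘ₗ oddDeriv (d i)

variable (d : Fin n → Module.Dual ℂ U)

theorem oddDerivList_cons (i : Fin n) (l : List (Fin n)) (a : Gr U) :
    oddDerivList d (i :: l) a = oddDerivList d l (oddDeriv (d i) a) := rfl

theorem oddDerivList_concat (l : List (Fin n)) (i : Fin n) (a : Gr U) :
    oddDerivList d (l ++ [i]) a = oddDeriv (d i) (oddDerivList d l a) := by
  induction l generalizing a with
  | nil => rfl
  | cons j _ ih => exact ih _

theorem oddDerivs_eq_oddDerivList (a : Gr U) :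
    oddDerivs d a = oddDerivList d (List.finRange n) a := by
  unfold oddDerivs
  induction List.finRange n generalizing a with
  | nil => rfl
  | cons _ _ ih => exact ih _

theorem oddDerivList_oddDeriv_of_mem {l : List (Fin n)} {i : Fin n} (hi : i ∈ l) (a : Gr U) :
    oddDerivList d l (oddDeriv (d i) a) = 0 := by
  induction l generalizing a with
  | nil => exact absurd hi List.not_mem_nil
  | cons j l ih =>
    rw [oddDerivList_cons]
    rcases List.mem_cons.mp hi with rfl | hi
    · rw [contractLeft_contractLeft, map_zero]
    · rw [contractLeft_comm, map_neg, ih hi, neg_zero]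

theorem oddDeriv_oddDerivList_of_oddDeriv_eq_zero (l : List (Fin n)) {i : Fin n} {a : Gr U}
    (ha : oddDeriv (d i) a = 0) : oddDeriv (d i) (oddDerivList d l a) = 0 := by
  induction l generalizing a with
  | nil => exact ha
  | cons _ _ ih => exact ih (by rw [contractLeft_comm, ha, map_zero, neg_zero])

theorem oddDeriv_oddDerivList_of_mem {l : List (Fin n)} {i : Fin n} (hi : i ∈ l) (a : Gr U) :
    oddDeriv (d i) (oddDerivList d l a) = 0 := by
  induction l generalizing a with
  | nil => exact absurd hi List.not_mem_nil
  | cons j l ih =>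
    rcases List.mem_cons.mp hi with rfl | hi
    · exact oddDeriv_oddDerivList_of_oddDeriv_eq_zero d l (contractLeft_contractLeft _ _)
    · exact ih hi _

theorem oddDerivList_mul_of_oddDeriv_eq_zero (l : List (Fin n)) (a : Gr U) {b : Gr U}
    (hb : ∀ i, oddDeriv (d i) b = 0) : oddDerivList d l (a * b) = oddDerivList d l a * b := by
  induction l generalizing a with
  | nil => rfl
  | cons i l ih => rw [oddDerivList_cons, oddDeriv_mul, hb, mul_zero, add_zero, ih,
      oddDerivList_cons]

theorem oddDerivList_map (d : Fin n → Module.Dual ℂ W) (f : U →ₗ[ℂ] W) (l : List (Fin n))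
    (a : Gr U) : oddDerivList d l (ExteriorAlgebra.map f a) =
      ExteriorAlgebra.map f (oddDerivList (fun i => d i ∘ₗ f) l a) := by
  induction l generalizing a with
  | nil => rfl
  | cons i l ih => rw [oddDerivList_cons, oddDeriv_map, ih, oddDerivList_cons]

end Lists

section DualFamily

variable {n : ℕ} {d : Fin n → Module.Dual ℂ U} {e : Fin n → U}
  (hde : ∀ i j, d i (e j) = if i = j then 1 else 0)
include hde

theorem exists_map_eq_self_of_oddDeriv_eq_zero (s : Finset (Fin n)) {a : Gr U}
    (ha : ∀ i, oddDeriv (d i) a = 0) :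
    ∃ π : U →ₗ[ℂ] U, (∀ u, π u = u - ∑ i ∈ s, d i u • e i) ∧ ExteriorAlgebra.map π a = a := by
  induction s using Finset.induction_on with
  | empty => exact ⟨LinearMap.id, by simp, by rw [ExteriorAlgebra.map_id]; rfl⟩
  | insert i s hi ih =>
    obtain ⟨π, hπ, hπa⟩ := ih
    have hdπ : ∀ u, d i (π u) = d i u := fun u => by
      rw [hπ, map_sub, map_sum, Finset.sum_eq_zero, sub_zero]
      intro j hj
      rw [map_smul, hde, if_neg (by rintro rfl; exact hi hj), smul_zero]
    refine ⟨(LinearMap.id - (d i).smulRight (e i)) ∘ₗ π, fun u => ?_, ?_⟩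
    · change π u - d i (π u) • e i = _
      rw [hdπ, hπ, Finset.sum_insert hi]
      abel
    · rw [← ExteriorAlgebra.map_comp_map, AlgHom.comp_apply, hπa, ← sub_ι_mul_oddDeriv, ha,
        mul_zero, sub_zero]

theorem map_eq_self_of_oddDeriv_eq_zero {π : U →ₗ[ℂ] U} (hπ : ∀ u, π u = u - ∑ i, d i u • e i)
    {a : Gr U} (ha : ∀ i, oddDeriv (d i) a = 0) : ExteriorAlgebra.map π a = a := by
  obtain ⟨ρ, hρ, hρa⟩ := exists_map_eq_self_of_oddDeriv_eq_zero hde Finset.univ ha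
  rwa [show π = ρ from LinearMap.ext fun u => by rw [hπ, hρ]]

theorem apply_eq_apply_ι_mul_oddDeriv {X : Type} [AddCommGroup X] [Module ℂ X]
    {J : Gr U →ₗ[ℂ] X} (hJ : ∀ i a, J (oddDeriv (d i) a) = 0) (i : Fin n) (a : Gr U) :
    J a = J (ι ℂ (e i) * oddDeriv (d i) a) := by
  have := hJ i (ι ℂ (e i) * a)
  rwa [contractLeft_ι_mul, hde, if_pos rfl, one_smul, map_sub, sub_eq_zero] at this

/- `T` is, up to sign, the product of the coordinates in `l`: integration by parts, one coordinate
at a time. -/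
theorem exists_apply_eq_apply_mul_oddDerivList {l : List (Fin n)} (hl : l.Nodup) :
    ∃ T : Gr U, (∀ j ∉ l, oddDeriv (d j) T = 0) ∧
      ∀ {X : Type} [AddCommGroup X] [Module ℂ X] (J : Gr U →ₗ[ℂ] X),
        (∀ i a, J (oddDeriv (d i) a) = 0) → ∀ a, J a = J (T * oddDerivList d l a) := by
  induction l using List.reverseRecOn with
  | nil =>
    refine ⟨1, fun j _ => CliffordAlgebra.contractLeft_one _ _, fun J _ a => ?_⟩
    rw [one_mul]
    rfl
  | append_singleton l i ih =>
    rw [← List.concat_eq_append, List.nodup_concat] at hl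
    obtain ⟨T, hT, hJT⟩ := ih hl.2
    refine ⟨ι ℂ (e i) * parityAut U T, fun j hj => ?_, fun J hJ a => ?_⟩
    · obtain ⟨hjl, hji⟩ : j ∉ l ∧ j ≠ i := by simpa using hj
      rw [contractLeft_ι_mul, hde, if_neg hji, zero_smul, oddDeriv_parityAut, hT j hjl, map_zero,
        neg_zero, mul_zero, sub_zero]
    · rw [hJT J hJ, apply_eq_apply_ι_mul_oddDeriv hde hJ i, oddDeriv_mul, hT i hl.1, zero_mul,
        zero_add, oddDerivList_concat, mul_assoc]

theorem oddDerivList_ne_zero {l : List (Fin n)} (hl : l.Nodup) {c : Gr U} (hc : c ≠ 0)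
    (h : ∀ i ∈ l, c * ι ℂ (e i) = 0) : oddDerivList d l c ≠ 0 := by
  induction l generalizing c with
  | nil => exact hc
  | cons i l ih =>
    have hmul : ∀ j, oddDeriv (d i) c * ι ℂ (e j) =
        oddDeriv (d i) (c * ι ℂ (e j)) - (if i = j then (1 : ℂ) else 0) • parityAut U c := by
      intro j
      rw [oddDeriv_mul, contractLeft_ι, hde, add_sub_assoc, ← Algebra.commutes, ← Algebra.smul_def,
        sub_self, add_zero]
    refine ih hl.of_cons (fun hzero => hc ?_) fun j hj => ?_
    · have := hmul i
      rw [hzero, zero_mul, h i List.mem_cons_self, map_zero, zero_sub, if_pos rfl, one_smul,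
        eq_comm, neg_eq_zero] at this
      rw [← parityAut_parityAut c, this, map_zero]
    · have hij : i ≠ j := by rintro rfl; exact (List.nodup_cons.mp hl).1 hj
      rw [hmul, h j (List.mem_cons_of_mem _ hj), map_zero, if_neg hij, zero_smul, sub_zero]

end DualFamily

end Derivative

section Berezin

variable {n : ℕ}

/-- The coordinate functionals on `Coord n`, the directions of the partial derivatives on the
affine superspace of dimension `0|n`. -/
abbrev coordDual (i : Fin n) : Module.Dual ℂ (Coord n) := LinearMap.proj i

theorem coordDual_single (i j : Fin n) :
    coordDual i (Pi.single j (1 : ℂ) : Coord n) = if i = j then 1 else 0 := by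
  simp [Pi.single_apply]

/-- The Berezin integral as a linear functional. -/
def berezinLinear (n : ℕ) : Gr (Coord n) →ₗ[ℂ] ℂ :=
  body.toLinearMap ∘ₗ oddDerivList coordDual (List.finRange n)

theorem berezinLinear_apply (a : Gr (Coord n)) : berezinLinear n a = berezin a := by
  rw [berezin, oddDerivs_eq_oddDerivList]
  rfl

theorem oddDerivList_finRange_coord (a : Gr (Coord n)) :
    oddDerivList coordDual (List.finRange n) a = algebraMap ℂ _ (berezin a) := by
  have hself := map_eq_self_of_oddDeriv_eq_zero (π := 0) (coordDual_single (n := n))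
    (fun u => (sub_eq_zero.mpr (pi_eq_sum_univ' u)).symm)
    (fun i => oddDeriv_oddDerivList_of_mem coordDual (List.mem_finRange i) a)
  have hzero : ExteriorAlgebra.map (0 : Coord n →ₗ[ℂ] Coord n) =
      (Algebra.ofId ℂ (Gr (Coord n))).comp body := by
    refine algHom_ext_oddCoord fun i => ?_
    rw [oddCoord, ExteriorAlgebra.map_apply_ι, AlgHom.comp_apply, body_ι, map_zero]
    exact map_zero _
  rw [hzero] at hself
  rw [berezin, oddDerivs_eq_oddDerivList]
  exact hself.symm

theorem berezin_ne_zero {c : Gr (Coord n)} (hc : c ≠ 0) (h : ∀ i, c * oddCoord i = 0) :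
    berezin c ≠ 0 := by
  have := oddDerivList_ne_zero coordDual_single (List.nodup_finRange n) hc fun i _ => h i
  rw [oddDerivList_finRange_coord] at this
  exact fun hzero => this (by rw [hzero, map_zero])

theorem exists_mul_ne_zero_and_mul_oddCoord_eq_zero {c : Gr (Coord n)} (hc : c ≠ 0)
    (s : Finset (Fin n)) : ∃ f, c * f ≠ 0 ∧ ∀ i ∈ s, c * f * oddCoord i = 0 := by
  induction s using Finset.induction_on with
  | empty => exact ⟨1, by rwa [mul_one], by simp⟩
  | insert i s _ ih =>
    obtain ⟨f, hf, hfs⟩ := ih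
    by_cases h : c * f * oddCoord i = 0
    · exact ⟨f, hf, Finset.forall_mem_insert _ _ _ |>.mpr ⟨h, hfs⟩⟩
    refine ⟨f * oddCoord i, by rwa [← mul_assoc], fun j hj => ?_⟩
    rw [← mul_assoc, mul_assoc]
    rcases Finset.mem_insert.mp hj with rfl | hj
    · rw [odd_mul_self (oddCoord_mem j), mul_zero]
    · rw [odd_mul_odd_eq_neg (oddCoord_mem i) (oddCoord_mem j), mul_neg, ← mul_assoc, hfs j hj,
        zero_mul, neg_zero]

theorem exists_berezin_mul_ne_zero {c : Gr (Coord n)} (hc : c ≠ 0) : ∃ f, berezin (c * f) ≠ 0 := by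
  obtain ⟨f, hf, hfi⟩ := exists_mul_ne_zero_and_mul_oddCoord_eq_zero hc Finset.univ
  exact ⟨f, berezin_ne_zero hf fun i => hfi i (Finset.mem_univ i)⟩

theorem exists_eq_mul_berezin (J : Gr (Coord n) →ₗ[ℂ] ℂ)
    (hJ : ∀ i a, J (oddDeriv (coordDual i) a) = 0) : ∃ c : ℂ, ∀ a, J a = c * berezin a := by
  obtain ⟨T, -, hT⟩ := exists_apply_eq_apply_mul_oddDerivList (coordDual_single (n := n))
    (List.nodup_finRange n)
  refine ⟨J T, fun a => ?_⟩
  rw [hT J hJ a, oddDerivList_finRange_coord, ← Algebra.commutes, ← Algebra.smul_def, map_smul,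
    smul_eq_mul, mul_comm]

variable (V : Type) [AddCommGroup V] [Module ℂ V]

/-- The coordinate functionals of the second factor on `V × Coord n`, the directions of the partial
derivatives along the fibres of the projection of `S × 𝔸^{0|n}` to the superpoint `S` of `V`. -/
abbrev fibreDual (i : Fin n) : Module.Dual ℂ (V × Coord n) :=
  LinearMap.proj i ∘ₗ LinearMap.snd ℂ V (Coord n)

/-- The Berezin fibre integral as a linear map. -/
def berezinFibreLinear (n : ℕ) : Gr (V × Coord n) →ₗ[ℂ] Gr V :=
  (ExteriorAlgebra.map (LinearMap.fst ℂ V (Coord n))).toLinearMap ∘ₗ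
    oddDerivList (fibreDual V) (List.finRange n)

variable {V}

theorem fibreDual_single (i j : Fin n) :
    fibreDual V i ((0, Pi.single j (1 : ℂ)) : V × Coord n) = if i = j then 1 else 0 := by
  simp [Pi.single_apply]

theorem berezinFibreLinear_apply (a : Gr (V × Coord n)) :
    berezinFibreLinear V n a = berezinFibre V a := by
  rw [berezinFibre, oddDerivs_eq_oddDerivList]
  rfl

theorem berezinFibre_oddDeriv (i : Fin n) (a : Gr (V × Coord n)) :
    berezinFibre V (oddDeriv (fibreDual V i) a) = 0 := by
  rw [berezinFibre, oddDerivs_eq_oddDerivList,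
    oddDerivList_oddDeriv_of_mem _ (List.mem_finRange i), map_zero]

theorem oddDeriv_pullFst (i : Fin n) (v : Gr V) :
    oddDeriv (fibreDual V i) (pullFst V (Coord n) v) = 0 := by
  have h : fibreDual V i ∘ₗ LinearMap.inl ℂ V (Coord n) = 0 := by ext; simp
  rw [pullFst, oddDeriv_map, h, oddDeriv, map_zero, LinearMap.zero_apply, map_zero]

theorem oddDeriv_pullSnd (i : Fin n) (a : Gr (Coord n)) :
    oddDeriv (fibreDual V i) (pullSnd V (Coord n) a) =
      pullSnd V (Coord n) (oddDeriv (coordDual i) a) :=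
  oddDeriv_map _ _ _

theorem map_fst_pullFst (v : Gr V) :
    ExteriorAlgebra.map (LinearMap.fst ℂ V (Coord n)) (pullFst V (Coord n) v) = v := by
  rw [pullFst, ← AlgHom.comp_apply, ExteriorAlgebra.map_comp_map, LinearMap.fst_comp_inl,
    ExteriorAlgebra.map_id]
  rfl

theorem berezinFibre_mul_pullFst (a : Gr (V × Coord n)) (v : Gr V) :
    berezinFibre V (a * pullFst V (Coord n) v) = berezinFibre V a * v := by
  rw [berezinFibre, oddDerivs_eq_oddDerivList,
    oddDerivList_mul_of_oddDeriv_eq_zero _ _ _ fun i => oddDeriv_pullFst i v, map_mul,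
    map_fst_pullFst, berezinFibre, oddDerivs_eq_oddDerivList]

theorem berezinFibre_pullSnd (a : Gr (Coord n)) :
    berezinFibre V (pullSnd V (Coord n) a) = algebraMap ℂ (Gr V) (berezin a) := by
  rw [berezinFibre, oddDerivs_eq_oddDerivList, pullSnd, oddDerivList_map]
  change ExteriorAlgebra.map _ (ExteriorAlgebra.map _ (oddDerivList coordDual _ a)) = _
  rw [oddDerivList_finRange_coord, AlgHom.commutes, AlgHom.commutes]

theorem oddDerivList_finRange_fibre (a : Gr (V × Coord n)) :
    oddDerivList (fibreDual V) (List.finRange n) a =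
      pullFst V (Coord n) (berezinFibre V a) := by
  have hproj : ∀ u : V × Coord n, (LinearMap.inl ℂ V (Coord n) ∘ₗ LinearMap.fst ℂ V (Coord n)) u =
      u - ∑ i, fibreDual V i u • ((0, Pi.single i (1 : ℂ)) : V × Coord n) := fun u => by
    have hsum := congrArg (LinearMap.inr ℂ V (Coord n)) (pi_eq_sum_univ' u.2)
    simp only [map_sum, map_smul] at hsum
    exact eq_sub_of_add_eq (hsum ▸ Prod.fst_add_snd u)
  have hself := map_eq_self_of_oddDeriv_eq_zero fibreDual_single hproj
    fun i => oddDeriv_oddDerivList_of_mem (fibreDual V) (List.mem_finRange i) a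
  rw [← ExteriorAlgebra.map_comp_map, AlgHom.comp_apply] at hself
  rw [berezinFibre, oddDerivs_eq_oddDerivList]
  exact hself.symm

theorem exists_apply_eq_apply_mul_pullFst_berezinFibre (V : Type) [AddCommGroup V] [Module ℂ V]
    (n : ℕ) :
    ∃ T : Gr (V × Coord n), ∀ {X : Type} [AddCommGroup X] [Module ℂ X]
      (J : Gr (V × Coord n) →ₗ[ℂ] X), (∀ i a, J (oddDeriv (fibreDual V i) a) = 0) →
        ∀ a, J a = J (T * pullFst V (Coord n) (berezinFibre V a)) := by
  obtain ⟨T, -, hT⟩ := exists_apply_eq_apply_mul_oddDerivList (fibreDual_single (V := V) (n := n))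
    (List.nodup_finRange n)
  exact ⟨T, fun J hJ a => by rw [hT J hJ a, oddDerivList_finRange_fibre]⟩

end Berezin

/-! ### Even supermatrices and the orthosymplectic supergroup -/

section SuperMatrix

variable {q : ℕ} {V W : Type} [AddCommGroup V] [Module ℂ V] [AddCommGroup W] [Module ℂ W]
  {R S : Type} [Ring R] [Ring S]

/-- The parity of the basis vectors of `ℂ^{2|2q}`. -/
def indexParity : Fin 2 ⊕ (Fin 2 × Fin q) → ZMod 2 := Sum.elim (fun _ => 0) (fun _ => 1)

theorem isEvenSMat_iff {x : SMat q (Gr V)} :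
    IsEvenSMat q V x ↔ ∀ i j, x i j ∈ parity V (indexParity i + indexParity j) := by
  have hone : (1 : ZMod 2) + 1 = 0 := rfl
  simp only [IsEvenSMat, Matrix.toBlocks₁₁, Matrix.toBlocks₁₂, Matrix.toBlocks₂₁,
    Matrix.toBlocks₂₂, Matrix.of_apply, Sum.forall, indexParity, elim_inl, elim_inr, hone, add_zero,
    zero_add, forall_and, and_assoc]
  exact and_congr_right' and_left_comm

theorem IsEvenSMat.mul {x y : SMat q (Gr V)} (hx : IsEvenSMat q V x) (hy : IsEvenSMat q V y) :
    IsEvenSMat q V (x * y) := by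
  rw [isEvenSMat_iff] at *
  intro i j
  rw [Matrix.mul_apply]
  refine sum_mem fun k _ => ?_
  have h := mul_mem_parity_add (hx i k) (hy k j)
  rwa [add_assoc, ← add_assoc (indexParity k), CharTwo.add_self_eq_zero, zero_add] at h

theorem IsEvenSMat.map {x : SMat q (Gr V)} (hx : IsEvenSMat q V x) {φ : Gr V →ₐ[ℂ] Gr W}
    (hφ : IsSuperHom φ) : IsEvenSMat q W (x.map φ) := by
  rw [isEvenSMat_iff] at *
  exact fun i j => hφ _ _ (hx i j)

theorem isEvenSMat_one : IsEvenSMat q V 1 := by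
  rw [isEvenSMat_iff]
  intro i j
  by_cases h : i = j
  · rw [h, Matrix.one_apply_eq, CharTwo.add_self_eq_zero]
    exact one_mem_parity_zero
  · rw [Matrix.one_apply_ne h]
    exact zero_mem _

theorem IsEvenSMat.map_body {x : SMat q (Gr V)} (hx : IsEvenSMat q V x) :
    x.map body = Matrix.fromBlocks (x.toBlocks₁₁.map body) 0 0 (x.toBlocks₂₂.map body) := by
  ext (i | i) (j | j)
  · rfl
  · exact body_of_odd (hx.2.1 i j)
  · exact body_of_odd (hx.2.2.1 i j)
  · rfl

theorem IsEvenSMat.map_body_mul {x y : SMat q (Gr V)} (hx : IsEvenSMat q V x)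
    (hy : IsEvenSMat q V y) :
    (x * y).map body = Matrix.fromBlocks (x.toBlocks₁₁.map body * y.toBlocks₁₁.map body) 0 0
      (x.toBlocks₂₂.map body * y.toBlocks₂₂.map body) := by
  rw [Matrix.map_mul, hx.map_body, hy.map_body, Matrix.fromBlocks_multiply]
  simp only [Matrix.mul_zero, Matrix.zero_mul, add_zero, zero_add]

theorem IsEvenSMat.toBlocks₁₁_mul_map_body {x y : SMat q (Gr V)} (hx : IsEvenSMat q V x)
    (hy : IsEvenSMat q V y) :
    (x * y).toBlocks₁₁.map body = x.toBlocks₁₁.map body * y.toBlocks₁₁.map body :=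
  congrArg Matrix.toBlocks₁₁ (hx.map_body_mul hy)

theorem IsEvenSMat.toBlocks₂₂_mul_map_body {x y : SMat q (Gr V)} (hx : IsEvenSMat q V x)
    (hy : IsEvenSMat q V y) :
    (x * y).toBlocks₂₂.map body = x.toBlocks₂₂.map body * y.toBlocks₂₂.map body :=
  congrArg Matrix.toBlocks₂₂ (hx.map_body_mul hy)

theorem transpose_mul_of_commute {l m n : Type} [Fintype m] {A : Matrix l m R} {B : Matrix m n R}
    (h : ∀ i j k, Commute (A i j) (B j k)) :
    (A * B).transpose = B.transpose * A.transpose := by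
  ext i j
  simp only [Matrix.transpose_apply, Matrix.mul_apply]
  exact Finset.sum_congr rfl fun k _ => h _ _ _

theorem transpose_mul_of_anticommute {l m n : Type} [Fintype m] {A : Matrix l m R}
    {B : Matrix m n R} (h : ∀ i j k, A i j * B j k = -(B j k * A i j)) :
    (A * B).transpose = -(B.transpose * A.transpose) := by
  ext i j
  simp only [Matrix.transpose_apply, Matrix.mul_apply, Matrix.neg_apply, ← Finset.sum_neg_distrib]
  exact Finset.sum_congr rfl fun k _ => h _ _ _

theorem superTranspose_fromBlocks (A : Matrix (Fin 2) (Fin 2) R)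
    (B : Matrix (Fin 2) (Fin 2 × Fin q) R) (C : Matrix (Fin 2 × Fin q) (Fin 2) R)
    (D : Matrix (Fin 2 × Fin q) (Fin 2 × Fin q) R) :
    superTranspose (Matrix.fromBlocks A B C D) =
      Matrix.fromBlocks A.transpose C.transpose (-B.transpose) D.transpose := by
  simp [superTranspose]

theorem superTranspose_inl_inl (x : SMat q R) (a b : Fin 2) :
    superTranspose x (inl a) (inl b) = x (inl b) (inl a) := rfl

theorem superTranspose_inl_inr (x : SMat q R) (a : Fin 2) (k : Fin 2 × Fin q) :
    superTranspose x (inl a) (inr k) = x (inr k) (inl a) := rfl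

theorem superTranspose_inr_inl (x : SMat q R) (k : Fin 2 × Fin q) (a : Fin 2) :
    superTranspose x (inr k) (inl a) = -x (inl a) (inr k) := rfl

theorem superTranspose_inr_inr (x : SMat q R) (k l : Fin 2 × Fin q) :
    superTranspose x (inr k) (inr l) = x (inr l) (inr k) := rfl

theorem superTranspose_mul {x y : SMat q (Gr V)} (hx : IsEvenSMat q V x)
    (hy : IsEvenSMat q V y) : superTranspose (x * y) = superTranspose y * superTranspose x := by
  obtain ⟨hA, hB, hC, hD⟩ := hx
  obtain ⟨hA', hB', hC', hD'⟩ := hy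
  rw [← Matrix.fromBlocks_toBlocks x, ← Matrix.fromBlocks_toBlocks y, Matrix.fromBlocks_multiply]
  simp only [superTranspose_fromBlocks, Matrix.fromBlocks_multiply, Matrix.transpose_add]
  rw [transpose_mul_of_commute (fun i j _ => commute_of_even (hA i j) _),
    transpose_mul_of_anticommute (fun i j k => odd_mul_odd_eq_neg (hB i j) (hC' j k)),
    transpose_mul_of_commute (fun i j _ => commute_of_even (hA i j) _),
    transpose_mul_of_commute (fun _ j k => (commute_of_even (hD' j k) _).symm),
    transpose_mul_of_commute (fun _ j k => (commute_of_even (hA' j k) _).symm),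
    transpose_mul_of_commute (fun i j _ => commute_of_even (hD i j) _),
    transpose_mul_of_anticommute (fun i j k => odd_mul_odd_eq_neg (hC i j) (hB' j k)),
    transpose_mul_of_commute (fun i j _ => commute_of_even (hD i j) _)]
  congr 1 <;> simp [add_comm]

theorem superTranspose_map (φ : R →+* S) (x : SMat q R) :
    superTranspose (x.map φ) = (superTranspose x).map φ := by
  ext (i | i) (j | j) <;> simp [superTranspose, Matrix.toBlocks₁₁, Matrix.toBlocks₁₂,
    Matrix.toBlocks₂₁, Matrix.toBlocks₂₂]

theorem superTranspose_one : superTranspose (1 : SMat q R) = 1 := by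
  rw [← Matrix.fromBlocks_one, superTranspose_fromBlocks]
  simp

theorem IsEvenSMat.superTranspose {x : SMat q (Gr V)} (hx : IsEvenSMat q V x) :
    IsEvenSMat q V (superTranspose x) := by
  obtain ⟨hA, hB, hC, hD⟩ := hx
  exact ⟨fun i j => hA j i, fun i j => hC j i, fun i j => neg_mem (hB j i), fun i j => hD j i⟩

/-- The action of `J_q` on column vectors. -/
def symp (v : Fin 2 × Fin q → R) (i : Fin 2 × Fin q) : R :=
  if i.1 = 0 then v (1, i.2) else -v (0, i.2)

@[simp] theorem symp_zero (v : Fin 2 × Fin q → R) (j : Fin q) : symp v (0, j) = v (1, j) := rfl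

@[simp] theorem symp_one (v : Fin 2 × Fin q → R) (j : Fin q) : symp v (1, j) = -v (0, j) := rfl

theorem symp_symp (v : Fin 2 × Fin q → R) : symp (symp v) = -v := by
  ext ⟨a, j⟩
  fin_cases a <;> simp

theorem symp_add (v w : Fin 2 × Fin q → R) : symp (v + w) = symp v + symp w := by
  ext ⟨a, j⟩
  fin_cases a <;> simp [add_comm]

theorem symp_neg (v : Fin 2 × Fin q → R) : symp (-v) = -symp v := by
  funext ⟨c, j⟩
  fin_cases c <;> simp

theorem symp_mul (a b : R) (v : Fin 2 × Fin q → R) (i : Fin 2 × Fin q) :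
    symp (fun k => a * v k * b) i = a * symp v i * b := by
  obtain ⟨c, j⟩ := i
  fin_cases c <;> simp

theorem symp_mem {i : ZMod 2} {v : Fin 2 × Fin q → Gr V} (hv : ∀ k, v k ∈ parity V i)
    (k : Fin 2 × Fin q) : symp v k ∈ parity V i := by
  obtain ⟨c, j⟩ := k
  fin_cases c
  · exact hv _
  · exact neg_mem (hv _)

theorem symp_map (φ : R →+* S) (v : Fin 2 × Fin q → R) (i : Fin 2 × Fin q) :
    φ (symp v i) = symp (fun k => φ (v k)) i := by
  obtain ⟨c, j⟩ := i
  fin_cases c <;> simp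

/-- The bilinear form `vᵗ J_q w`. -/
def sympForm (v w : Fin 2 × Fin q → R) : R := ∑ i, v i * symp w i

theorem sum_mul_symp_one (v : Fin 2 × Fin q → R) (j : Fin 2 × Fin q) :
    ∑ i, v i * symp (fun k => (1 : Matrix _ _ R) k j) i = -symp v j := by
  obtain ⟨c, j⟩ := j
  rw [Fintype.sum_prod_type]
  fin_cases c <;> simp [Fin.sum_univ_two, Matrix.one_apply]

theorem formJ_mulVec_inl_zero (v : Fin 2 ⊕ (Fin 2 × Fin q) → R) :
    (formJ q R).mulVec v (inl 0) = -v (inl 0) := by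
  simp [formJ, Matrix.mulVec, dotProduct]

theorem formJ_mulVec_inl_one (v : Fin 2 ⊕ (Fin 2 × Fin q) → R) :
    (formJ q R).mulVec v (inl 1) = v (inl 1) := by
  simp [formJ, Matrix.mulVec, dotProduct]

theorem formJ_mulVec_inr (v : Fin 2 ⊕ (Fin 2 × Fin q) → R) (i : Fin 2 × Fin q) :
    (formJ q R).mulVec v (inr i) = symp (fun k => v (inr k)) i := by
  obtain ⟨c, j⟩ := i
  simp only [formJ, Matrix.mulVec, dotProduct, Fintype.sum_sum_type, Fintype.sum_prod_type,
    Matrix.fromBlocks_apply₂₁, Matrix.fromBlocks_apply₂₂, Matrix.zero_apply, zero_mul,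
    Finset.sum_const_zero, zero_add, Matrix.blockDiagonal_apply, ite_mul]
  fin_cases c <;> simp [Fin.sum_univ_two]

theorem formJ_inr_inr (i j : Fin 2 × Fin q) :
    formJ q R (inr i) (inr j) = symp (fun k => (1 : Matrix _ _ R) k j) i := by
  calc formJ q R (inr i) (inr j)
      = (formJ q R).mulVec (Pi.single (inr j) (1 : R)) (inr i) := by
        rw [Matrix.mulVec_single_one, Matrix.col_apply]
    _ = symp (fun k => (1 : Matrix _ _ R) k j) i := by
        rw [formJ_mulVec_inr]
        simp only [Pi.single_apply, Matrix.one_apply, Sum.inr.injEq]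

theorem formJ_map (φ : R →+* S) : (formJ q R).map φ = formJ q S := by
  ext (i | i) (j | j)
  · fin_cases i <;> fin_cases j <;> simp [formJ]
  · simp [formJ]
  · simp [formJ]
  · rw [Matrix.map_apply, formJ_inr_inr, formJ_inr_inr, symp_map]
    simp only [Matrix.one_apply, apply_ite φ, map_one, map_zero]

theorem isEvenSMat_formJ : IsEvenSMat q V (formJ q (Gr V)) := by
  refine ⟨fun i j => ?_, fun _ _ => ?_, fun _ _ => ?_, fun i j => ?_⟩
  · fin_cases i <;> fin_cases j <;> simp [formJ, one_mem_parity_zero]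
  · simp [formJ]
  · simp [formJ]
  · change formJ q (Gr V) (inr i) (inr j) ∈ _
    rw [formJ_inr_inr]
    refine symp_mem (fun k => ?_) i
    rw [Matrix.one_apply]
    split_ifs
    exacts [one_mem_parity_zero, zero_mem _]

/-- The inverse of `J`: as `J² = diag(1, 1 | -1)`, it is `J` with the sign of the odd block
reversed. -/
def formJInv (q : ℕ) (R : Type) [Ring R] : SMat q R :=
  Matrix.fromBlocks 1 0 0 (-1) * formJ q R

theorem formJ_mul_formJ : formJ q R * formJ q R = Matrix.fromBlocks 1 0 0 (-1) := by
  have hplane : (!![0, 1; -1, 0] : Matrix (Fin 2) (Fin 2) R) * !![0, 1; -1, 0] = -1 := by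
    ext i j
    fin_cases i <;> fin_cases j <;> simp
  rw [formJ, Matrix.fromBlocks_multiply, ← Matrix.blockDiagonal_mul]
  simp only [hplane, Matrix.zero_mul, Matrix.mul_zero, zero_add, add_zero]
  congr 1
  · ext i j
    fin_cases i <;> fin_cases j <;> simp
  · rw [← Matrix.blockDiagonal_one, ← Matrix.blockDiagonal_neg]
    rfl

theorem formJInv_mul_formJ : formJInv q R * formJ q R = 1 := by
  rw [formJInv, mul_assoc, formJ_mul_formJ, Matrix.fromBlocks_multiply]
  simp

theorem formJInv_eq_formJ_mul : formJInv q R = formJ q R * Matrix.fromBlocks 1 0 0 (-1) := by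
  rw [formJInv, ← formJ_mul_formJ, mul_assoc]

theorem formJ_mul_formJInv : formJ q R * formJInv q R = 1 := by
  rw [formJInv_eq_formJ_mul, ← mul_assoc, formJ_mul_formJ, Matrix.fromBlocks_multiply]
  simp

theorem isEvenSMat_formJInv : IsEvenSMat q V (formJInv q (Gr V)) := by
  rw [formJInv, ← formJ_mul_formJ]
  exact (isEvenSMat_formJ.mul isEvenSMat_formJ).mul isEvenSMat_formJ

/-- Points of the complex orthosymplectic supergroup. -/
structure IsOSpPt (x : SMat q (Gr V)) : Prop where
  isEvenSMat : IsEvenSMat q V x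
  form_eq : superTranspose x * formJ q (Gr V) * x = formJ q (Gr V)

theorem IsOSpPt.mul {x y : SMat q (Gr V)} (hx : IsOSpPt x) (hy : IsOSpPt y) :
    IsOSpPt (x * y) := by
  refine ⟨hx.isEvenSMat.mul hy.isEvenSMat, ?_⟩
  calc superTranspose (x * y) * formJ q (Gr V) * (x * y)
      = superTranspose y * (superTranspose x * formJ q (Gr V) * x) * y := by
        rw [superTranspose_mul hx.isEvenSMat hy.isEvenSMat]
        simp only [mul_assoc]
    _ = formJ q (Gr V) := by rw [hx.form_eq, hy.form_eq]

theorem IsOSpPt.map {x : SMat q (Gr V)} (hx : IsOSpPt x) {φ : Gr V →ₐ[ℂ] Gr W}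
    (hφ : IsSuperHom φ) : IsOSpPt (x.map φ) := by
  refine ⟨hx.isEvenSMat.map hφ, ?_⟩
  have h := congrArg (fun m => m.map (φ : Gr V →+* Gr W)) hx.form_eq
  simp only [Matrix.map_mul, formJ_map, ← superTranspose_map] at h
  exact h

theorem IsOSpPt.inv_mul {x : SMat q (Gr V)} (hx : IsOSpPt x) :
    formJInv q (Gr V) * superTranspose x * formJ q (Gr V) * x = 1 := by
  rw [mul_assoc, mul_assoc, ← mul_assoc (superTranspose x), hx.form_eq, formJInv_mul_formJ]

theorem IsOSpPt.exists_inv [FiniteDimensional ℂ V] {x : SMat q (Gr V)} (hx : IsOSpPt x) :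
    ∃ y, IsOSpPt y ∧ x * y = 1 ∧ y * x = 1 := by
  have hyx := hx.inv_mul
  set y := formJInv q (Gr V) * superTranspose x * formJ q (Gr V)
  have hxy : x * y = 1 := mul_eq_one_comm.mp hyx
  have hy : IsEvenSMat q V y :=
    (isEvenSMat_formJInv.mul hx.isEvenSMat.superTranspose).mul isEvenSMat_formJ
  refine ⟨y, ⟨hy, ?_⟩, hxy, hyx⟩
  calc superTranspose y * formJ q (Gr V) * y
      = superTranspose y * (superTranspose x * formJ q (Gr V) * x) * y := by rw [hx.form_eq]
    _ = superTranspose (x * y) * formJ q (Gr V) * (x * y) := by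
        rw [superTranspose_mul hx.isEvenSMat hy]
        simp only [mul_assoc]
    _ = formJ q (Gr V) := by rw [hxy, superTranspose_one, one_mul, mul_one]

theorem mul_formJ_mul_apply (x y : SMat q R) (i j : Fin 2 ⊕ (Fin 2 × Fin q)) :
    (x * formJ q R * y) i j = -(x i (inl 0) * y (inl 0) j) + x i (inl 1) * y (inl 1) j +
      ∑ k, x i (inr k) * symp (fun l => y (inr l) j) k := by
  have h : ∀ a, (formJ q R * y) a j = (formJ q R).mulVec (fun b => y b j) a := fun _ => rfl
  rw [mul_assoc, Matrix.mul_apply]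
  simp only [h, Fintype.sum_sum_type, Fin.sum_univ_two, formJ_mulVec_inl_zero,
    formJ_mulVec_inl_one, formJ_mulVec_inr, mul_neg]

theorem IsOSpPt.form_apply_inl {x : SMat q (Gr V)} (hx : IsOSpPt x) (a : Fin 2)
    (j : Fin 2 ⊕ (Fin 2 × Fin q)) :
    -(x (inl 0) (inl a) * x (inl 0) j) + x (inl 1) (inl a) * x (inl 1) j +
      ∑ k, x (inr k) (inl a) * symp (fun l => x (inr l) j) k = formJ q (Gr V) (inl a) j := by
  rw [← hx.form_eq, mul_formJ_mul_apply]
  rfl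

end SuperMatrix

/-! ### The subgroups `K` and `M` -/

section Subgroups

variable {q : ℕ} {V W : Type} [AddCommGroup V] [Module ℂ V] [AddCommGroup W] [Module ℂ W]

/-- The row and the column of `x` with index `a` are those of the identity matrix, i.e. `x` fixes
the `a`-th basis vector and preserves the span of the others. -/
def FixesIndex {n R : Type} [DecidableEq n] [Ring R] (x : Matrix n n R) (a : n) : Prop :=
  (∀ j, x a j = (1 : Matrix n n R) a j) ∧ ∀ i, x i a = (1 : Matrix n n R) i a

section FixesIndex

variable {n R S : Type} [DecidableEq n] [Ring R] [Ring S] {x y : Matrix n n R} {a : n}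

theorem FixesIndex.mul_apply_row [Fintype n] (hx : FixesIndex x a) (y : Matrix n n R) (j : n) :
    (x * y) a j = y a j := by
  simp only [Matrix.mul_apply, hx.1]
  rw [← Matrix.mul_apply, one_mul]

theorem FixesIndex.mul_apply_col [Fintype n] (hx : FixesIndex x a) (y : Matrix n n R) (i : n) :
    (y * x) i a = y i a := by
  simp only [Matrix.mul_apply, hx.2]
  rw [← Matrix.mul_apply, mul_one]

theorem FixesIndex.mul [Fintype n] (hx : FixesIndex x a) (hy : FixesIndex y a) :
    FixesIndex (x * y) a :=
  ⟨fun j => by rw [hx.mul_apply_row, hy.1], fun i => by rw [hy.mul_apply_col, hx.2]⟩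

theorem FixesIndex.of_mul_eq_one [Fintype n] (hx : FixesIndex x a) (hxy : x * y = 1)
    (hyx : y * x = 1) : FixesIndex y a :=
  ⟨fun j => by rw [← hx.mul_apply_row y, hxy], fun i => by rw [← hx.mul_apply_col y, hyx]⟩

theorem FixesIndex.map (hx : FixesIndex x a) (φ : R →+* S) : FixesIndex (x.map φ) a := by
  have hone : ∀ i j, φ ((1 : Matrix n n R) i j) = (1 : Matrix n n S) i j := fun i j => by
    rw [Matrix.one_apply, Matrix.one_apply, apply_ite φ, map_one, map_zero]
  exact ⟨fun j => by rw [Matrix.map_apply, hx.1, hone],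
    fun i => by rw [Matrix.map_apply, hx.2, hone]⟩

theorem fixesIndex_iff : FixesIndex x a ↔
    x a a = 1 ∧ (∀ j, j ≠ a → x a j = 0) ∧ ∀ i, i ≠ a → x i a = 0 := by
  constructor
  · rintro ⟨hr, hc⟩
    exact ⟨by rw [hr, Matrix.one_apply_eq], fun j hj => by rw [hr, Matrix.one_apply_ne hj.symm],
      fun i hi => by rw [hc, Matrix.one_apply_ne hi]⟩
  · rintro ⟨ha, hr, hc⟩
    refine ⟨fun j => ?_, fun i => ?_⟩
    · obtain rfl | hj := eq_or_ne j a
      · rw [ha, Matrix.one_apply_eq]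
      · rw [hr j hj, Matrix.one_apply_ne hj.symm]
    · obtain rfl | hi := eq_or_ne i a
      · rw [ha, Matrix.one_apply_eq]
      · rw [hc i hi, Matrix.one_apply_ne hi]

end FixesIndex

theorem sigma_mul_mul_sigma_apply {R : Type} [Ring R] (x : SMat q R)
    (i j : Fin 2 ⊕ (Fin 2 × Fin q)) :
    (sigma q R * x * sigma q R) i j = (if i = inl 0 then -1 else 1) * x i j *
      (if j = inl 0 then -1 else 1) := by
  have h : sigma q R = Matrix.diagonal (fun i => if i = inl 0 then -1 else 1) := by
    ext (a | a) (b | b)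
    · fin_cases a <;> fin_cases b <;> simp [sigma, Matrix.diagonal]
    · simp [sigma, Matrix.diagonal]
    · simp [sigma, Matrix.diagonal]
    · simp [sigma, Matrix.diagonal, Matrix.one_apply]
  rw [h, Matrix.mul_diagonal, Matrix.diagonal_mul]

theorem sigma_mul_mul_sigma_eq_iff {x : SMat q (Gr V)} :
    sigma q (Gr V) * x * sigma q (Gr V) = x ↔
      (∀ j, j ≠ inl 0 → x (inl 0) j = 0) ∧ ∀ i, i ≠ inl 0 → x i (inl 0) = 0 := by
  have : IsAddTorsionFree (Gr V) := .of_isTorsionFree ℂ (Gr V)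
  constructor
  · intro h
    refine ⟨fun j hj => self_eq_neg.mp ?_, fun i hi => self_eq_neg.mp ?_⟩
    · simpa [sigma_mul_mul_sigma_apply, hj] using (congrFun (congrFun h (inl 0)) j).symm
    · simpa [sigma_mul_mul_sigma_apply, hi] using (congrFun (congrFun h i) (inl 0)).symm
  · rintro ⟨hr, hc⟩
    ext i j
    rw [sigma_mul_mul_sigma_apply]
    by_cases hi : i = inl 0 <;> by_cases hj : j = inl 0
    · simp [hi, hj]
    · simp [hi, hr j hj]
    · simp [hj, hc i hi]
    · simp [hi, hj]

theorem isOSpPt_of_mem_ptsK {k : SMat q (Gr V)} (hk : k ∈ ptsK q V) : IsOSpPt k :=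
  ⟨hk.1.1, hk.1.2.1⟩

theorem fixesIndex_zero_of_mem_ptsK {k : SMat q (Gr V)} (hk : k ∈ ptsK q V) :
    FixesIndex k (inl 0) := by
  obtain ⟨⟨he, hJ, ⟨a, ha, -, hpos⟩, -⟩, hσ⟩ := hk
  obtain ⟨hr, hc⟩ := sigma_mul_mul_sigma_eq_iff.mp hσ
  refine fixesIndex_iff.mpr ⟨?_, hr, hc⟩
  have hbody : body (k (inl 0) (inl 0)) = (a 0 0 : ℂ) := congrFun (congrFun ha 0) 0
  have hsq : k (inl 0) (inl 0) * k (inl 0) (inl 0) = 1 := by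
    have h := (IsOSpPt.mk he hJ).form_apply_inl 0 (inl 0)
    simp only [hc (inl 1) (by simp), hc (inr _) (by simp), zero_mul, Finset.sum_const_zero,
      add_zero] at h
    simpa [formJ] using h
  have haa : a 0 0 = 1 := by
    have h : a 0 0 * a 0 0 = 1 := by
      have h' := congrArg body hsq
      rw [map_mul, hbody, map_one] at h'
      exact_mod_cast h'
    nlinarith
  exact eq_of_mul_self_eq_of_body_eq_one (he.1 0 0) one_mem_parity_zero
    (by rw [hbody, haa, Complex.ofReal_one]) (map_one _) (by rw [hsq, one_mul])

theorem body_one_one_of_mem_ptsK {k : SMat q (Gr V)} (hk : k ∈ ptsK q V) :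
    body (k (inl 1) (inl 1)) = 1 := by
  obtain ⟨hfix, -⟩ := fixesIndex_zero_of_mem_ptsK hk
  obtain ⟨⟨-, -, ⟨a, ha, hdet, -⟩, -⟩, -⟩ := hk
  have hbody : ∀ i j, body (k (inl i) (inl j)) = (a i j : ℂ) := fun i j =>
    congrFun (congrFun ha i) j
  have h00 : a 0 0 = 1 := by
    have h := hbody 0 0
    rw [hfix, Matrix.one_apply_eq, map_one] at h
    exact_mod_cast h.symm
  have h01 : a 0 1 = 0 := by
    have h := hbody 0 1
    rw [hfix, Matrix.one_apply_ne (by simp), map_zero] at h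
    exact_mod_cast h.symm
  rw [Matrix.det_fin_two, h00, h01, one_mul, zero_mul, sub_zero] at hdet
  rw [hbody, hdet, Complex.ofReal_one]

theorem mem_ptsK_iff {k : SMat q (Gr V)} : k ∈ ptsK q V ↔ IsOSpPt k ∧ FixesIndex k (inl 0) ∧
    body (k (inl 1) (inl 1)) = 1 ∧
    k.toBlocks₂₂.map body ∈ Matrix.unitaryGroup (Fin 2 × Fin q) ℂ := by
  refine ⟨fun hk => ⟨isOSpPt_of_mem_ptsK hk, fixesIndex_zero_of_mem_ptsK hk,
    body_one_one_of_mem_ptsK hk, hk.1.2.2.2⟩, ?_⟩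
  rintro ⟨⟨he, hJ⟩, hfix, hb, hu⟩
  refine ⟨⟨he, hJ, ⟨1, ?_, by simp, by simp⟩, hu⟩,
    sigma_mul_mul_sigma_eq_iff.mpr (fixesIndex_iff.mp hfix).2⟩
  rw [← Matrix.ext_iff]
  simp [Fin.forall_fin_two, Matrix.toBlocks₁₁, hfix.1, hfix.2, hb, Matrix.one_apply]

theorem mul_mem_ptsK {x y : SMat q (Gr V)} (hx : x ∈ ptsK q V) (hy : y ∈ ptsK q V) :
    x * y ∈ ptsK q V := by
  rw [mem_ptsK_iff] at *
  obtain ⟨hx, hxfix, hxb, hxu⟩ := hx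
  obtain ⟨hy, hyfix, hyb, hyu⟩ := hy
  refine ⟨hx.mul hy, hxfix.mul hyfix, ?_, ?_⟩
  · have h := congrFun (congrFun (hx.1.toBlocks₁₁_mul_map_body hy.1) 1) 1
    simpa [Matrix.mul_apply, Matrix.toBlocks₁₁, hxfix.2, hxb, hyb] using h
  · rw [hx.1.toBlocks₂₂_mul_map_body hy.1]
    exact mul_mem hxu hyu

theorem exists_inv_mem_ptsK [FiniteDimensional ℂ V] {x : SMat q (Gr V)} (hx : x ∈ ptsK q V) :
    ∃ y ∈ ptsK q V, x * y = 1 ∧ y * x = 1 := by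
  rw [mem_ptsK_iff] at hx
  obtain ⟨hx, hxfix, hxb, hxu⟩ := hx
  obtain ⟨y, hy, hxy, hyx⟩ := hx.exists_inv
  refine ⟨y, mem_ptsK_iff.mpr ⟨hy, hxfix.of_mul_eq_one hxy hyx, ?_, ?_⟩, hxy, hyx⟩
  · have h := congrFun (congrFun (hx.1.toBlocks₁₁_mul_map_body hy.1) 1) 1
    rw [hxy] at h
    simpa [Matrix.mul_apply, Matrix.toBlocks₁₁, hxfix.2, hxb] using h.symm
  · have hinv : x.toBlocks₂₂.map body * y.toBlocks₂₂.map body = 1 := by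
      rw [← hx.1.toBlocks₂₂_mul_map_body hy.1, hxy]
      ext i j
      simp [Matrix.toBlocks₂₂, Matrix.one_apply, apply_ite body]
    have hstar : y.toBlocks₂₂.map body = star (x.toBlocks₂₂.map body) :=
      (left_inv_eq_right_inv (Matrix.mem_unitaryGroup_iff'.mp hxu) hinv).symm
    rw [hstar]
    exact Unitary.star_mem hxu

theorem map_mem_ptsK {x : SMat q (Gr V)} (hx : x ∈ ptsK q V) {φ : Gr V →ₐ[ℂ] Gr W}
    (hφ : IsSuperHom φ) : x.map φ ∈ ptsK q W := by
  rw [mem_ptsK_iff] at *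
  obtain ⟨hx, hxfix, hxb, hxu⟩ := hx
  refine ⟨hx.map hφ, hxfix.map (φ : Gr V →+* Gr W), ?_, ?_⟩
  · rw [Matrix.map_apply, hφ.body_apply, hxb]
  · convert hxu using 1
    ext i j
    exact hφ.body_apply _

section hZero

variable {R : Type} [Ring R] (x : SMat q R)

theorem mul_hZero_apply (i j : Fin 2 ⊕ (Fin 2 × Fin q)) : (x * hZero q R) i j =
    if j = inl 0 then x i (inl 1) else if j = inl 1 then x i (inl 0) else 0 := by
  revert j
  simp [Sum.forall, Fin.forall_fin_two, Matrix.mul_apply, hZero]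

theorem hZero_mul_apply (i j : Fin 2 ⊕ (Fin 2 × Fin q)) : (hZero q R * x) i j =
    if i = inl 0 then x (inl 1) j else if i = inl 1 then x (inl 0) j else 0 := by
  revert i
  simp [Sum.forall, Fin.forall_fin_two, Matrix.mul_apply, hZero]

end hZero

theorem mem_ptsM_iff {m : SMat q (Gr V)} :
    m ∈ ptsM q V ↔ m ∈ ptsK q V ∧ FixesIndex m (inl 1) := by
  refine and_congr_right fun hm => ?_
  have hfix := fixesIndex_zero_of_mem_ptsK hm
  constructor
  · intro hcomm
    refine ⟨fun j => ?_, fun i => ?_⟩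
    · have h : (m * hZero q (Gr V)) (inl 0) j = m (inl 1) j := by
        rw [hcomm, hZero_mul_apply, if_pos rfl]
      rw [← h, hfix.mul_apply_row]
      revert j
      simp [Sum.forall, Fin.forall_fin_two, hZero]
    · have h : (hZero q (Gr V) * m) i (inl 0) = m i (inl 1) := by
        rw [← hcomm, mul_hZero_apply, if_pos rfl]
      rw [← h, hfix.mul_apply_col]
      revert i
      simp [Sum.forall, Fin.forall_fin_two, hZero]
  · intro hfix'
    ext i j
    rw [mul_hZero_apply, hZero_mul_apply, hfix'.1, hfix'.2, hfix.1, hfix.2]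
    revert i j
    simp [Sum.forall, Fin.forall_fin_two]

theorem mul_self_add_sympForm_col_eq_one {k : SMat q (Gr V)} (hk : k ∈ ptsK q V) :
    k (inl 1) (inl 1) * k (inl 1) (inl 1) +
      sympForm (fun i => k (inr i) (inl 1)) (fun i => k (inr i) (inl 1)) = 1 := by
  have h := (isOSpPt_of_mem_ptsK hk).form_apply_inl 1 (inl 1)
  rw [(fixesIndex_zero_of_mem_ptsK hk).1, Matrix.one_apply_ne (by simp), mul_zero, neg_zero,
    zero_add] at h
  simpa [formJ, sympForm] using h

/-- The even entry is the square root with value `1` of `1 - ξᵗ J_q ξ`, where `ξ` is the odd part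
of the column. -/
theorem col_eq_of_inr_col_eq {k l : SMat q (Gr V)} (hk : k ∈ ptsK q V) (hl : l ∈ ptsK q V)
    (h : ∀ i, k (inr i) (inl 1) = l (inr i) (inl 1)) (i : Fin 2 ⊕ (Fin 2 × Fin q)) :
    k i (inl 1) = l i (inl 1) := by
  have h0 : k (inl 0) (inl 1) = l (inl 0) (inl 1) := by
    rw [(fixesIndex_zero_of_mem_ptsK hk).1, (fixesIndex_zero_of_mem_ptsK hl).1]
  have h1 : k (inl 1) (inl 1) = l (inl 1) (inl 1) := by
    refine eq_of_mul_self_eq_of_body_eq_one (hk.1.1.1 1 1) (hl.1.1.1 1 1)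
      (body_one_one_of_mem_ptsK hk) (body_one_one_of_mem_ptsK hl) ?_
    have hk' := mul_self_add_sympForm_col_eq_one hk
    simp only [h] at hk'
    exact add_right_cancel (hk'.trans (mul_self_add_sympForm_col_eq_one hl).symm)
  revert i
  simpa only [Sum.forall, Fin.forall_fin_two] using ⟨⟨h0, h1⟩, h⟩

theorem one_mem_ptsM : (1 : SMat q (Gr V)) ∈ ptsM q V := by
  have hone : (1 : SMat q (Gr V)).toBlocks₂₂.map body = 1 := by
    ext i j
    simp [Matrix.toBlocks₂₂, Matrix.one_apply, apply_ite body]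
  refine mem_ptsM_iff.mpr ⟨mem_ptsK_iff.mpr ⟨⟨isEvenSMat_one, ?_⟩, ?_, ?_, ?_⟩, ?_⟩
  · rw [superTranspose_one, one_mul, mul_one]
  · exact ⟨fun _ => rfl, fun _ => rfl⟩
  · rw [Matrix.one_apply_eq, map_one]
  · rw [hone]
    exact one_mem _
  · exact ⟨fun _ => rfl, fun _ => rfl⟩

theorem mem_ptsM_of_inr_col_eq_zero {k : SMat q (Gr V)} (hk : k ∈ ptsK q V)
    (h : ∀ i, k (inr i) (inl 1) = 0) : k ∈ ptsM q V := by
  have hcol : ∀ i, k i (inl 1) = (1 : SMat q (Gr V)) i (inl 1) :=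
    col_eq_of_inr_col_eq hk one_mem_ptsM.1 fun i => by rw [h, Matrix.one_apply_ne (by simp)]
  refine mem_ptsM_iff.mpr ⟨hk, fun j => ?_, hcol⟩
  have hform := (isOSpPt_of_mem_ptsK hk).form_apply_inl 1 j
  simp only [h, zero_mul, Finset.sum_const_zero, add_zero] at hform
  rw [hcol, hcol, Matrix.one_apply_eq, Matrix.one_apply_ne (by simp), zero_mul, neg_zero, zero_add,
    one_mul] at hform
  rw [hform]
  revert j
  simp [Sum.forall, Fin.forall_fin_two, formJ]

theorem mul_mem_ptsM {x y : SMat q (Gr V)} (hx : x ∈ ptsM q V) (hy : y ∈ ptsM q V) :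
    x * y ∈ ptsM q V :=
  ⟨mul_mem_ptsK hx.1 hy.1, by rw [mul_assoc, hy.2, ← mul_assoc, hx.2, mul_assoc]⟩

theorem map_mem_ptsM {x : SMat q (Gr V)} (hx : x ∈ ptsM q V) {φ : Gr V →ₐ[ℂ] Gr W}
    (hφ : IsSuperHom φ) : x.map φ ∈ ptsM q W :=
  mem_ptsM_iff.mpr ⟨map_mem_ptsK hx.1 hφ, (mem_ptsM_iff.mp hx).2.map (φ : Gr V →+* Gr W)⟩

end Subgroups

/-! ### Generators of `K` -/

section StandardPoints

variable {q : ℕ} {V : Type} [AddCommGroup V] [Module ℂ V]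

/-- The point of `K` whose column with index `1` is `(b, ξ)`; here `c` is the inverse of `1 + b`. -/
def stdPt (b c : Gr V) (ξ : Fin 2 × Fin q → Gr V) : SMat q (Gr V) :=
  Matrix.fromBlocks !![1, 0; 0, b] (Matrix.of ![0, symp ξ]) (Matrix.of ![0, ξ]).transpose
    (Matrix.of fun i j => (1 : Matrix _ _ (Gr V)) i j + c * ξ i * symp ξ j)

section

variable {b c : Gr V} {ξ : Fin 2 × Fin q → Gr V}

@[simp] theorem stdPt_inl_one_inl_one : stdPt b c ξ (inl 1) (inl 1) = b := rfl

@[simp] theorem stdPt_inr_inl_one (i : Fin 2 × Fin q) : stdPt b c ξ (inr i) (inl 1) = ξ i := rfl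

@[simp] theorem stdPt_inl_one_inr (i : Fin 2 × Fin q) :
    stdPt b c ξ (inl 1) (inr i) = symp ξ i := rfl

theorem stdPt_inr_inr (i j : Fin 2 × Fin q) : stdPt b c ξ (inr i) (inr j) =
    (1 : Matrix _ _ (Gr V)) i j + c * ξ i * symp ξ j := rfl

theorem fixesIndex_stdPt : FixesIndex (stdPt b c ξ) (inl 0) :=
  fixesIndex_iff.mpr ⟨rfl, by simp [Sum.forall, Fin.forall_fin_two, stdPt],
    by simp [Sum.forall, Fin.forall_fin_two, stdPt]⟩

theorem isEvenSMat_stdPt (hb : b ∈ parity V 0) (hc : c ∈ parity V 0)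
    (hξ : ∀ i, ξ i ∈ parity V 1) : IsEvenSMat q V (stdPt b c ξ) := by
  refine ⟨fun i j => ?_, fun i j => ?_, fun i j => ?_, fun i j => ?_⟩
  · fin_cases i <;> fin_cases j
    exacts [one_mem_parity_zero, zero_mem _, zero_mem _, hb]
  · fin_cases i
    exacts [zero_mem _, symp_mem hξ j]
  · fin_cases j
    exacts [zero_mem _, hξ i]
  · refine add_mem ?_ (odd_mul_odd (even_mul_odd hc (hξ i)) (symp_mem hξ j))
    rw [Matrix.one_apply]
    split_ifs
    exacts [one_mem_parity_zero, zero_mem _]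

theorem symp_stdPt_inr (i k : Fin 2 × Fin q) : symp (fun l => stdPt b c ξ (inr l) (inr i)) k =
    symp (fun l => (1 : Matrix _ _ (Gr V)) l i) k + c * symp ξ k * symp ξ i := by
  rw [← symp_mul c (symp ξ i) ξ k]
  exact congrFun (symp_add _ _) k

theorem mul_sympForm_eq_one_sub (hc : c ∈ parity V 0) (hn : b * b + sympForm ξ ξ = 1)
    (hbc : (1 + b) * c = 1) : c * sympForm ξ ξ = 1 - b := by
  have hfactor : sympForm ξ ξ = (1 + b) * (1 - b) := by
    rw [← sub_eq_iff_eq_add'.mpr hn.symm]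
    noncomm_ring
  rw [hfactor, ← mul_assoc, (commute_of_even hc _).eq, hbc, one_mul]

theorem sum_mul_symp_stdPt_inr (hc : c ∈ parity V 0) (hn : b * b + sympForm ξ ξ = 1)
    (hbc : (1 + b) * c = 1) (i : Fin 2 × Fin q) :
    ∑ k, ξ k * symp (fun l => stdPt b c ξ (inr l) (inr i)) k = -(b * symp ξ i) := by
  have hquad : ∑ k, ξ k * (c * symp ξ k * symp ξ i) = c * sympForm ξ ξ * symp ξ i := by
    rw [sympForm, Finset.mul_sum, Finset.sum_mul]
    refine Finset.sum_congr rfl fun k _ => ?_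
    rw [mul_assoc c, ← mul_assoc (ξ k), ← (commute_of_even hc (ξ k)).eq]
    simp only [mul_assoc]
  simp only [symp_stdPt_inr, mul_add, Finset.sum_add_distrib]
  rw [sum_mul_symp_one, hquad, mul_sympForm_eq_one_sub hc hn hbc]
  noncomm_ring

theorem sum_stdPt_inr_mul (i : Fin 2 × Fin q) (v : Fin 2 × Fin q → Gr V)
    (hξ : ∀ k, ξ k ∈ parity V 1) : ∑ k, stdPt b c ξ (inr k) (inr i) * v k =
      v i - c * symp ξ i * ∑ k, ξ k * v k := by
  simp only [stdPt_inr_inr, add_mul, Finset.sum_add_distrib, Matrix.one_apply, ite_mul, one_mul,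
    zero_mul, Finset.sum_ite_eq', Finset.mem_univ, if_true]
  rw [sub_eq_add_neg, Finset.mul_sum, ← Finset.sum_neg_distrib]
  refine congrArg _ (Finset.sum_congr rfl fun k _ => ?_)
  rw [mul_assoc c, odd_mul_odd_eq_neg (hξ k) (symp_mem hξ i)]
  noncomm_ring

theorem sum_stdPt_inr_mul_symp (hc : c ∈ parity V 0)
    (hξ : ∀ k, ξ k ∈ parity V 1) (hn : b * b + sympForm ξ ξ = 1) (hbc : (1 + b) * c = 1)
    (i : Fin 2 × Fin q) :
    ∑ k, stdPt b c ξ (inr k) (inr i) * symp ξ k = symp ξ i * b := by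
  have hform : c * symp ξ i * sympForm ξ ξ = symp ξ i * (1 - b) := by
    rw [(commute_of_even hc _).eq, mul_assoc, mul_sympForm_eq_one_sub hc hn hbc]
  rw [sum_stdPt_inr_mul i _ hξ, ← sympForm, hform]
  noncomm_ring

theorem sum_stdPt_inr_mul_symp_stdPt_inr (hb : b ∈ parity V 0) (hc : c ∈ parity V 0)
    (hξ : ∀ k, ξ k ∈ parity V 1) (hn : b * b + sympForm ξ ξ = 1) (hbc : (1 + b) * c = 1)
    (i j : Fin 2 × Fin q) :
    ∑ k, stdPt b c ξ (inr k) (inr i) * symp (fun l => stdPt b c ξ (inr l) (inr j)) k =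
      formJ q (Gr V) (inr i) (inr j) + symp ξ i * symp ξ j := by
  rw [sum_stdPt_inr_mul i _ hξ, sum_mul_symp_stdPt_inr hc hn hbc, symp_stdPt_inr, formJ_inr_inr,
    add_sub_assoc]
  congr 1
  calc c * symp ξ i * symp ξ j - c * symp ξ i * -(b * symp ξ j)
      = c * (1 + b) * symp ξ i * symp ξ j := by
        rw [mul_assoc c, mul_assoc c, ← neg_mul, ← mul_assoc (symp ξ i), mul_neg,
          ← (commute_of_even hb (symp ξ i)).eq]
        noncomm_ring
    _ = symp ξ i * symp ξ j := by rw [(commute_of_even hc _).eq, hbc, one_mul]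

theorem isOSpPt_stdPt (hb : b ∈ parity V 0) (hc : c ∈ parity V 0) (hξ : ∀ i, ξ i ∈ parity V 1)
    (hn : b * b + sympForm ξ ξ = 1) (hbc : (1 + b) * c = 1) : IsOSpPt (stdPt b c ξ) := by
  refine ⟨isEvenSMat_stdPt hb hc hξ, ?_⟩
  have hsymp : symp (fun _ : Fin 2 × Fin q => (0 : Gr V)) = 0 := by
    funext ⟨a, k⟩
    fin_cases a <;> simp
  have hr : ∀ j, stdPt b c ξ (inl 0) j = _ := fixesIndex_stdPt.1
  have hl : ∀ i, stdPt b c ξ i (inl 0) = _ := fixesIndex_stdPt.2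
  have hcol : b * b + ∑ i, ξ i * symp ξ i = 1 := hn
  ext (i | i) (j | j) <;> rw [mul_formJ_mul_apply] <;>
    simp only [superTranspose_inl_inl, superTranspose_inl_inr, superTranspose_inr_inl,
      superTranspose_inr_inr]
  · fin_cases i <;> fin_cases j <;> simp [hr, hl, formJ, hsymp, hcol]
  · fin_cases i <;> simp [hr, hl, formJ, sum_mul_symp_stdPt_inr hc hn hbc]
  · fin_cases j <;> simp [hr, hl, formJ, hsymp, sum_stdPt_inr_mul_symp hc hξ hn hbc]
  · rw [sum_stdPt_inr_mul_symp_stdPt_inr hb hc hξ hn hbc]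
    simp [hr]

end

theorem stdPt_mem_ptsK {b c : Gr V} {ξ : Fin 2 × Fin q → Gr V} (hb : b ∈ parity V 0)
    (hb1 : body b = 1) (hc : c ∈ parity V 0) (hξ : ∀ i, ξ i ∈ parity V 1)
    (hn : b * b + sympForm ξ ξ = 1) (hbc : (1 + b) * c = 1) : stdPt b c ξ ∈ ptsK q V := by
  refine mem_ptsK_iff.mpr ⟨isOSpPt_stdPt hb hc hξ hn hbc, fixesIndex_stdPt, hb1, ?_⟩
  have hbody : (stdPt b c ξ).toBlocks₂₂.map body = 1 := by
    ext i j
    rw [Matrix.map_apply, Matrix.toBlocks₂₂, Matrix.of_apply, stdPt_inr_inr, map_add, map_mul,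
      body_of_odd (symp_mem hξ j), mul_zero, add_zero, Matrix.one_apply, Matrix.one_apply,
      apply_ite body, map_one, map_zero]
  rw [hbody]
  exact one_mem _

/-- The elementary point of `K` in the direction of the `i`-th odd coordinate. -/
def elemPt (i : Fin 2 × Fin q) (η : Gr V) : SMat q (Gr V) :=
  stdPt 1 (algebraMap ℂ (Gr V) 2⁻¹) (Pi.single i η)

section

variable (i : Fin 2 × Fin q) {η : Gr V}

theorem single_mul_symp_single (hη : η ∈ parity V 1) (k l : Fin 2 × Fin q) :
    (Pi.single i η : Fin 2 × Fin q → Gr V) k * symp (Pi.single i η) l = 0 := by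
  obtain ⟨a, l⟩ := l
  fin_cases a <;> simp [Pi.single_apply, odd_mul_self hη]

theorem elemPt_mem_ptsK (hη : η ∈ parity V 1) : elemPt i η ∈ ptsK q V := by
  refine stdPt_mem_ptsK one_mem_parity_zero (map_one _) (algebraMap_mem_parity_zero _)
    (fun k => ?_) ?_ ?_
  · rw [Pi.single_apply]
    split_ifs
    exacts [hη, zero_mem _]
  · rw [sympForm, Finset.sum_eq_zero fun k _ => single_mul_symp_single i hη k k, one_mul, add_zero]
  · rw [one_add_one_eq_two, ← map_ofNat (algebraMap ℂ (Gr V)) 2, ← map_mul,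
      mul_inv_cancel₀ two_ne_zero, map_one]

theorem elemPt_inr_inr (hη : η ∈ parity V 1) (k l : Fin 2 × Fin q) :
    elemPt i η (inr k) (inr l) = (1 : Matrix _ _ (Gr V)) k l := by
  rw [elemPt, stdPt_inr_inr, mul_assoc, single_mul_symp_single i hη, mul_zero, add_zero]

theorem elemPt_mul_inr (hη : η ∈ parity V 1) {k : SMat q (Gr V)} (hk : FixesIndex k (inl 0))
    (l : Fin 2 × Fin q) : (elemPt i η * k) (inr l) (inl 1) =
      k (inr l) (inl 1) + (Pi.single i η : Fin 2 × Fin q → Gr V) l * k (inl 1) (inl 1) := by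
  have hcol : elemPt i η (inr l) (inl 1) = (Pi.single i η : Fin 2 × Fin q → Gr V) l := rfl
  simp only [Matrix.mul_apply, Fintype.sum_sum_type, Fin.sum_univ_two, hk.1, elemPt_inr_inr i hη,
    hcol]
  simp [Matrix.one_apply, add_comm]

theorem elemPt_sub_one (hη : η ∈ parity V 1) : elemPt i η - 1 =
    Matrix.fromBlocks 0 (Matrix.of ![0, symp (Pi.single i η)])
      (Matrix.of ![0, Pi.single i η]).transpose 0 := by
  ext (a | k) (b | l) <;> rw [Matrix.sub_apply]
  · fin_cases a <;> fin_cases b <;> simp [elemPt, stdPt]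
  · fin_cases a <;> simp [elemPt, stdPt]
  · fin_cases b <;> simp [elemPt, stdPt]
  · rw [elemPt_inr_inr i hη]
    simp [Matrix.one_apply]

theorem elemPt_sub_one_mul_self (hη : η ∈ parity V 1) :
    (elemPt i η - 1) * (elemPt i η - 1) = 0 := by
  rw [elemPt_sub_one i hη, Matrix.fromBlocks_multiply, ← Matrix.fromBlocks_zero]
  congr 1
  · have hz : ∀ k, symp (Pi.single i η) k * (Pi.single i η : Fin 2 × Fin q → Gr V) k = 0 := by
      rintro ⟨a, k⟩
      fin_cases a <;> simp [Pi.single_apply, odd_mul_self hη]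
    ext a b
    rw [zero_mul, zero_add, Matrix.mul_apply]
    refine Finset.sum_eq_zero fun k _ => ?_
    fin_cases a <;> fin_cases b <;> simp [hz]
  · simp
  · simp
  · ext k l
    simp [Matrix.mul_apply, single_mul_symp_single i hη]

theorem elemPt_mul_elemPt_neg (hη : η ∈ parity V 1) : elemPt i η * elemPt i (-η) = 1 := by
  have hneg : elemPt i (-η) - 1 = -(elemPt i η - 1) := by
    rw [elemPt_sub_one i hη, elemPt_sub_one i (neg_mem hη), Matrix.fromBlocks_neg]
    congr 1
    · simp
    · ext a l
      fin_cases a <;> simp [Pi.single_neg, symp_neg]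
    · ext k a
      fin_cases a <;> simp [Pi.single_neg]
    · simp
  calc elemPt i η * elemPt i (-η) = 1 - (elemPt i η - 1) * (elemPt i η - 1) := by
        rw [← sub_add_cancel (elemPt i (-η)) 1, hneg]
        noncomm_ring
    _ = 1 := by rw [elemPt_sub_one_mul_self i hη, sub_zero]

end

theorem exists_eq_elemPt_mul {k : SMat q (Gr V)} (hk : k ∈ ptsK q V) (i : Fin 2 × Fin q) :
    ∃ η ∈ parity V 1, ∃ l ∈ ptsK q V, k = elemPt i η * l ∧ l (inr i) (inl 1) = 0 ∧
      ∀ j ≠ i, l (inr j) (inl 1) = k (inr j) (inl 1) := by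
  have heven := (isOSpPt_of_mem_ptsK hk).isEvenSMat
  have hfix := fixesIndex_zero_of_mem_ptsK hk
  obtain ⟨b', hb', -, hb'b⟩ : ∃ b ∈ parity V 0, _ ∧ b * k (inl 1) (inl 1) = 1 :=
    exists_even_inverse (heven.1 1 1)
      ((body_one_one_of_mem_ptsK hk).trans_ne one_ne_zero)
  have hη : k (inr i) (inl 1) * b' ∈ parity V 1 := odd_mul_even (heven.2.2.1 i 1) hb'
  refine ⟨_, hη, elemPt i (-(k (inr i) (inl 1) * b')) * k,
    mul_mem_ptsK (elemPt_mem_ptsK i (neg_mem hη)) hk, ?_, ?_, fun j hj => ?_⟩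
  · rw [← mul_assoc, elemPt_mul_elemPt_neg i hη, one_mul]
  · rw [elemPt_mul_inr i (neg_mem hη) hfix, Pi.single_eq_same, neg_mul, mul_assoc, hb'b, mul_one,
      add_neg_cancel]
  · rw [elemPt_mul_inr i (neg_mem hη) hfix, Pi.single_eq_of_ne hj, zero_mul, add_zero]

theorem ptsK_induction {P : SMat q (Gr V) → Prop} (hM : ∀ m ∈ ptsM q V, P m)
    (hE : ∀ i, ∀ η ∈ parity V 1, ∀ k ∈ ptsK q V, P k → P (elemPt i η * k))
    {k : SMat q (Gr V)} (hk : k ∈ ptsK q V) : P k := by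
  suffices h : ∀ s : Finset (Fin 2 × Fin q), ∀ k ∈ ptsK q V,
      (∀ i ∉ s, k (inr i) (inl 1) = 0) → P k from
    h Finset.univ k hk fun i hi => absurd (Finset.mem_univ i) hi
  intro s
  induction s using Finset.induction_on with
  | empty => exact fun k hk h => hM k (mem_ptsM_of_inr_col_eq_zero hk fun i => h i (by simp))
  | insert i s _ ih =>
    intro k hk h
    obtain ⟨η, hη, l, hl, rfl, hli, hlj⟩ := exists_eq_elemPt_mul hk i
    refine hE i η hη l hl (ih l hl fun j hj => ?_)
    obtain rfl | hji := eq_or_ne j i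
    · exact hli
    · rw [hlj j hji, h j (by simp [hji, hj])]

end StandardPoints

/-! ### The standard chart -/

section Chart

variable {q : ℕ} {V : Type} [AddCommGroup V] [Module ℂ V]

theorem exists_mem_ptsM_eq_mul_iff [FiniteDimensional ℂ V] {k l : SMat q (Gr V)}
    (hk : k ∈ ptsK q V) (hl : l ∈ ptsK q V) :
    (∃ m ∈ ptsM q V, k = l * m) ↔ ∀ i, k (inr i) (inl 1) = l (inr i) (inl 1) := by
  constructor
  · rintro ⟨m, hm, rfl⟩ i
    exact (mem_ptsM_iff.mp hm).2.mul_apply_col l _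
  · intro h
    obtain ⟨y, hy, hly, hyl⟩ := exists_inv_mem_ptsK hl
    refine ⟨y * k, mem_ptsM_of_inr_col_eq_zero (mul_mem_ptsK hy hk) fun i => ?_,
      by rw [← mul_assoc, hly, one_mul]⟩
    have hcol : (y * k) (inr i) (inl 1) = (y * l) (inr i) (inl 1) := by
      simp only [Matrix.mul_apply, col_eq_of_inr_col_eq hk hl h]
    rw [hcol, hyl, Matrix.one_apply_ne (by simp)]

/-- The numbering of the odd coordinates. -/
def idx (q : ℕ) : Fin 2 × Fin q ≃ Fin (2 * q) := finProdFinEquiv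

/-- The coordinates as a column vector. -/
def coordCol (q : ℕ) (i : Fin 2 × Fin q) : Gr (Coord (2 * q)) := oddCoord (idx q i)

theorem coordCol_mem (i : Fin 2 × Fin q) : coordCol q i ∈ parity (Coord (2 * q)) 1 :=
  oddCoord_mem _

theorem isChart_of_col_eq_coordCol {s : SMat q (Gr (Coord (2 * q)))}
    (hs : s ∈ ptsK q (Coord (2 * q))) (h : ∀ i, s (inr i) (inl 1) = coordCol q i) :
    IsChart q s := by
  refine ⟨hs, ?_⟩
  intro V _ _ _ k hk
  have hodd : ∀ i, k (inr ((idx q).symm i)) (inl 1) ∈ parity V 1 := fun i => hk.1.1.2.2.1 _ 1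
  have hlift := isSuperHom_coordLift _ hodd
  refine ⟨coordLift _ hodd, ⟨hlift, ?_⟩, ?_⟩
  · rw [exists_mem_ptsM_eq_mul_iff hk (map_mem_ptsK hs hlift)]
    intro i
    rw [Matrix.map_apply, h, coordCol, coordLift_oddCoord, Equiv.symm_apply_apply]
  · rintro y ⟨hy, hky⟩
    rw [exists_mem_ptsM_eq_mul_iff hk (map_mem_ptsK hs hy)] at hky
    refine algHom_ext_oddCoord fun i => ?_
    rw [coordLift_oddCoord, hky, Matrix.map_apply, h, coordCol, Equiv.apply_symm_apply]

/-- The invariant quadratic form in the odd coordinates. -/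
def coordForm (q : ℕ) : Gr (Coord (2 * q)) := sympForm (coordCol q) (coordCol q)

theorem coordForm_mem : coordForm q ∈ parity (Coord (2 * q)) 0 := by
  rw [coordForm, sympForm]
  exact sum_mem fun i _ => odd_mul_odd (coordCol_mem i) (symp_mem coordCol_mem i)

theorem body_coordForm : body (coordForm q) = 0 := by
  rw [coordForm, sympForm, map_sum]
  exact Finset.sum_eq_zero fun i _ => by rw [map_mul, body_of_odd (coordCol_mem i), zero_mul]

theorem exists_chartRoot (q : ℕ) : ∃ b ∈ parity (Coord (2 * q)) 0, body b = 1 ∧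
    b * b = 1 - coordForm q :=
  exists_even_sqrt (sub_mem one_mem_parity_zero coordForm_mem)
    (by rw [map_sub, map_one, body_coordForm, sub_zero])

/-- The entry `√(1 - τ)` of the standard chart in position `(1, 1)`, where `τ` is the quadratic form
in the coordinates. -/
def chartRoot (q : ℕ) : Gr (Coord (2 * q)) := (exists_chartRoot q).choose

theorem chartRoot_mem : chartRoot q ∈ parity (Coord (2 * q)) 0 :=
  (exists_chartRoot q).choose_spec.1

theorem body_chartRoot : body (chartRoot q) = 1 := (exists_chartRoot q).choose_spec.2.1

theorem chartRoot_mul_self : chartRoot q * chartRoot q = 1 - coordForm q :=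
  (exists_chartRoot q).choose_spec.2.2

theorem exists_one_add_chartRoot_inv (q : ℕ) :
    ∃ c ∈ parity (Coord (2 * q)) 0, (1 + chartRoot q) * c = 1 := by
  obtain ⟨c, hc, hbc, -⟩ := exists_even_inverse (add_mem one_mem_parity_zero chartRoot_mem)
    (show body (1 + chartRoot q) ≠ 0 by rw [map_add, map_one, body_chartRoot]; norm_num)
  exact ⟨c, hc, hbc⟩

/-- The standard chart, whose column with index `1` consists of `√(1 - τ)` and the coordinates. -/
def stdChart (q : ℕ) : SMat q (Gr (Coord (2 * q))) :=
  stdPt (chartRoot q) (exists_one_add_chartRoot_inv q).choose (coordCol q)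

theorem stdChart_inl : stdChart q (inl 1) (inl 1) = chartRoot q := rfl

theorem stdChart_inr (i : Fin 2 × Fin q) : stdChart q (inr i) (inl 1) = coordCol q i := rfl

theorem isChart_stdChart : IsChart q (stdChart q) := by
  obtain ⟨hc, hbc⟩ := (exists_one_add_chartRoot_inv q).choose_spec
  refine isChart_of_col_eq_coordCol
    (stdPt_mem_ptsK chartRoot_mem body_chartRoot hc coordCol_mem ?_ hbc) fun _ => rfl
  rw [chartRoot_mul_self, coordForm, sub_add_cancel]

end Chart

/-! ### The restricted root space and the subgroups `A` and `N` -/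

section RootMatrices

variable {q : ℕ} {R : Type} [Ring R]

/-- The general solution of `[h₀, x] = x`: the first two rows are equal to `w`, and the first two
columns are `u` and `-u`. -/
def rootMat (w u : Fin 2 × Fin q → R) : SMat q R :=
  Matrix.fromBlocks 0 (Matrix.of ![w, w]) (Matrix.of ![u, -u]).transpose 0

/-- The vector `e₀ + e₁`, which is annihilated by `𝔤^α` and an eigenvector of `h₀`. -/
def weightVec (q : ℕ) (R : Type) [Ring R] : Fin 2 ⊕ (Fin 2 × Fin q) → R := Sum.elim 1 0

theorem mulVec_weightVec (x : SMat q R) (i : Fin 2 ⊕ (Fin 2 × Fin q)) :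
    x.mulVec (weightVec q R) i = x i (inl 0) + x i (inl 1) := by
  simp [Matrix.mulVec, dotProduct, weightVec]

theorem rootMat_mulVec_weightVec (w u : Fin 2 × Fin q → R) :
    (rootMat w u).mulVec (weightVec q R) = 0 := by
  ext i
  rw [mulVec_weightVec]
  revert i
  simp [Sum.forall, rootMat]

theorem rootMat_apply_inr (w u : Fin 2 × Fin q → R) (i : Fin 2 ⊕ (Fin 2 × Fin q))
    (j : Fin 2 × Fin q) : rootMat w u i (inr j) = weightVec q R i * w j := by
  revert i
  simp [Sum.forall, Fin.forall_fin_two, rootMat, weightVec]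

theorem mul_rootMat_apply_inr (x : SMat q R) (w u : Fin 2 × Fin q → R)
    (i : Fin 2 ⊕ (Fin 2 × Fin q)) (j : Fin 2 × Fin q) :
    (x * rootMat w u) i (inr j) = x.mulVec (weightVec q R) i * w j := by
  simp only [Matrix.mul_apply, rootMat_apply_inr, Matrix.mulVec, dotProduct, Finset.sum_mul,
    mul_assoc]

theorem rootMat_pow_three (w u : Fin 2 × Fin q → R) : rootMat w u ^ 3 = 0 := by
  have hCB : (Matrix.of ![u, -u]).transpose * Matrix.of ![w, w] = 0 := by
    ext i j
    simp [Matrix.mul_apply]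
  simp only [pow_three, rootMat, Matrix.fromBlocks_multiply, hCB, Matrix.mul_zero, Matrix.zero_mul,
    add_zero, zero_add]
  rw [← Matrix.mul_assoc, hCB, Matrix.zero_mul, Matrix.fromBlocks_zero]

theorem rootMat_neg (w u : Fin 2 × Fin q → R) : rootMat (-w) (-u) = -rootMat w u := by
  ext i j
  revert i j
  simp [Sum.forall, Fin.forall_fin_two, rootMat]

theorem commutator_rootMat (w u : Fin 2 × Fin q → R) :
    hZero q R * rootMat w u - rootMat w u * hZero q R = rootMat w u := by
  ext i j
  rw [Matrix.sub_apply, mul_hZero_apply, hZero_mul_apply]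
  revert i j
  simp [Sum.forall, Fin.forall_fin_two, rootMat]

theorem isOsp_rootMat_symp (w : Fin 2 × Fin q → R) : IsOsp (rootMat w (symp w)) := by
  have hL := mul_formJ_mul_apply (superTranspose (rootMat w (symp w))) 1
  have hR := mul_formJ_mul_apply 1 (rootMat w (symp w))
  have hcolumn : (fun i => symp w i) = symp w := rfl
  have hnegColumn : (fun i => -symp w i) = -symp w := rfl
  have hzero : symp (fun _ => 0 : Fin 2 × Fin q → R) = 0 := by
    ext ⟨a, j⟩
    fin_cases a <;> simp
  have hdual : ∀ j, ∑ i, symp w i * symp (fun k => (1 : Matrix _ _ R) k j) i = w j := fun j => by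
    rw [sum_mul_symp_one, symp_symp, Pi.neg_apply, neg_neg]
  simp only [Matrix.one_apply] at hdual
  simp only [Matrix.mul_one, Matrix.one_mul] at hL hR
  rw [IsOsp]
  ext i j
  rw [Matrix.add_apply, hL, hR]
  revert i j
  simp [Sum.forall, Fin.forall_fin_two, superTranspose_inl_inl, superTranspose_inl_inr,
    superTranspose_inr_inl, superTranspose_inr_inr, rootMat, Matrix.one_apply, symp_symp, symp_neg,
    hcolumn, hnegColumn, hzero, hdual, -Prod.forall]

theorem eq_zero_of_rotated_sub {E : Type} [AddCommGroup E] [Module ℂ E] {a b c d : E}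
    (ha : c - b = a) (hb : d - a = b) (hc : a - d = c) (hd : b - c = d) :
    a = 0 ∧ b = 0 ∧ c = 0 ∧ d = 0 := by
  refine ⟨?_, ?_, ?_, ?_⟩
  · linear_combination (norm := module)
      (-1 / 3 : ℂ) • ha + (-1 / 3 : ℂ) • hb + (1 / 3 : ℂ) • hc + (-2 / 3 : ℂ) • hd
  · linear_combination (norm := module)
      (-1 / 3 : ℂ) • ha + (-1 / 3 : ℂ) • hb + (-2 / 3 : ℂ) • hc + (1 / 3 : ℂ) • hd
  · linear_combination (norm := module)
      (1 / 3 : ℂ) • ha + (-2 / 3 : ℂ) • hb + (-1 / 3 : ℂ) • hc + (-1 / 3 : ℂ) • hd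
  · linear_combination (norm := module)
      (-2 / 3 : ℂ) • ha + (1 / 3 : ℂ) • hb + (-1 / 3 : ℂ) • hc + (-1 / 3 : ℂ) • hd

theorem eq_rootMat [Algebra ℂ R] {x : SMat q R} (hx : hZero q R * x - x * hZero q R = x) :
    x = rootMat (fun j => x (inl 0) (inr j)) (fun i => x (inr i) (inl 0)) := by
  have hentry : ∀ i j,
      (if i = inl 0 then x (inl 1) j else if i = inl 1 then x (inl 0) j else 0) -
        (if j = inl 0 then x i (inl 1) else if j = inl 1 then x i (inl 0) else 0) = x i j := by
    intro i j
    rw [← mul_hZero_apply, ← hZero_mul_apply, ← Matrix.sub_apply, hx]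
  obtain ⟨h00, h01, h10, h11⟩ : x (inl 0) (inl 0) = 0 ∧ x (inl 0) (inl 1) = 0 ∧
      x (inl 1) (inl 0) = 0 ∧ x (inl 1) (inl 1) = 0 :=
    eq_zero_of_rotated_sub (hentry (inl 0) (inl 0)) (hentry (inl 0) (inl 1))
      (hentry (inl 1) (inl 0)) (hentry (inl 1) (inl 1))
  ext (i | i) (j | j)
  · revert i j
    simp [Fin.forall_fin_two, rootMat, h00, h01, h10, h11]
  · revert i
    simpa [Fin.forall_fin_two, rootMat] using (hentry (inl 1) (inr j)).symm
  · revert j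
    simpa [Fin.forall_fin_two, rootMat] using (hentry (inr i) (inl 1)).symm
  · simpa [rootMat] using (hentry (inr i) (inr j)).symm

end RootMatrices

section ExpN

variable {q : ℕ} {V : Type} [AddCommGroup V] [Module ℂ V]

theorem superTranspose_add {R : Type} [Ring R] (x y : SMat q R) :
    superTranspose (x + y) = superTranspose x + superTranspose y := by
  ext (i | i) (j | j) <;> simp [superTranspose, Matrix.toBlocks₁₁, Matrix.toBlocks₁₂,
    Matrix.toBlocks₂₁, Matrix.toBlocks₂₂, add_comm]

theorem superTranspose_sum {R α : Type} [Ring R] (s : Finset α) (x : α → SMat q R) :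
    superTranspose (∑ i ∈ s, x i) = ∑ i ∈ s, superTranspose (x i) := by
  let f : SMat q R →+ SMat q R := AddMonoidHom.mk' superTranspose superTranspose_add
  exact map_sum f x s

theorem superTranspose_smul {R : Type} [Ring R] [Module ℂ R] (c : ℂ) (x : SMat q R) :
    superTranspose (c • x) = c • superTranspose x := by
  ext (i | i) (j | j) <;> simp [superTranspose, Matrix.toBlocks₁₁, Matrix.toBlocks₁₂,
    Matrix.toBlocks₂₁, Matrix.toBlocks₂₂]

theorem IsEvenSMat.pow {x : SMat q (Gr V)} (hx : IsEvenSMat q V x) (n : ℕ) :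
    IsEvenSMat q V (x ^ n) := by
  induction n with
  | zero => simpa using isEvenSMat_one
  | succ n ih => simpa only [pow_succ] using ih.mul hx

theorem IsEvenSMat.nilExp {x : SMat q (Gr V)} (hx : IsEvenSMat q V x) (hn : IsNilpotent x) :
    IsEvenSMat q V (nilExp x) := by
  obtain ⟨n, hn⟩ := hn
  rw [nilExp_eq_sum hn, isEvenSMat_iff]
  intro i j
  rw [Matrix.sum_apply]
  exact sum_mem fun k _ => Submodule.smul_mem _ _ (isEvenSMat_iff.mp (hx.pow k) i j)

theorem IsOsp.superTranspose_pow_mul_formJ {x : SMat q (Gr V)} (ho : IsOsp x)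
    (hx : IsEvenSMat q V x) (n : ℕ) :
    superTranspose (x ^ n) * formJ q (Gr V) = formJ q (Gr V) * (-x) ^ n := by
  induction n with
  | zero => rw [pow_zero, pow_zero, superTranspose_one, one_mul, mul_one]
  | succ n ih =>
    have hone : superTranspose x * formJ q (Gr V) = formJ q (Gr V) * -x := by
      rw [mul_neg]
      exact eq_neg_of_add_eq_zero_left ho
    rw [pow_succ, superTranspose_mul (hx.pow n) hx, mul_assoc, ih, ← mul_assoc, hone, mul_assoc,
      ← pow_succ']

theorem IsOsp.isOSpPt_nilExp {x : SMat q (Gr V)} (ho : IsOsp x) (hx : IsEvenSMat q V x)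
    (hn : IsNilpotent x) : IsOSpPt (nilExp x) := by
  refine ⟨hx.nilExp hn, ?_⟩
  have htranspose : superTranspose (nilExp x) * formJ q (Gr V) =
      formJ q (Gr V) * nilExp (-x) := by
    obtain ⟨n, hn⟩ := hn
    rw [nilExp_eq_sum hn, nilExp_eq_sum (a := -x) (by rw [neg_pow, hn, mul_zero]),
      superTranspose_sum, Finset.sum_mul, Finset.mul_sum]
    simp only [superTranspose_smul, Matrix.smul_mul, Matrix.mul_smul,
      ho.superTranspose_pow_mul_formJ hx]
  have hinv := nilExp_mul_nilExp_neg hn.neg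
  rw [neg_neg] at hinv
  rw [htranspose, mul_assoc, hinv, mul_one]

variable {w u : Fin 2 × Fin q → Gr V}

theorem isNilpotent_rootMat (w u : Fin 2 × Fin q → Gr V) : IsNilpotent (rootMat w u) :=
  ⟨3, rootMat_pow_three w u⟩

theorem isEvenSMat_rootMat (hw : ∀ i, w i ∈ parity V 1) (hu : ∀ i, u i ∈ parity V 1) :
    IsEvenSMat q V (rootMat w u) := by
  rw [isEvenSMat_iff]
  simpa [Sum.forall, Fin.forall_fin_two, rootMat, indexParity, -Prod.forall] using ⟨hw, hu⟩

theorem nilExp_rootMat (w u : Fin 2 × Fin q → Gr V) :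
    nilExp (rootMat w u) = 1 + rootMat w u + (2⁻¹ : ℂ) • (rootMat w u * rootMat w u) := by
  simp [nilExp_eq_sum (rootMat_pow_three w u), Finset.sum_range_succ, pow_two]

theorem nilExp_rootMat_mulVec_weightVec (w u : Fin 2 × Fin q → Gr V) :
    (nilExp (rootMat w u)).mulVec (weightVec q (Gr V)) = weightVec q (Gr V) := by
  rw [nilExp_rootMat, Matrix.add_mulVec, Matrix.add_mulVec, Matrix.smul_mulVec,
    ← Matrix.mulVec_mulVec, rootMat_mulVec_weightVec, Matrix.mulVec_zero, Matrix.one_mulVec,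
    smul_zero, add_zero, add_zero]

theorem nilExp_rootMat_apply_inr (w u : Fin 2 × Fin q → Gr V) (i : Fin 2 ⊕ (Fin 2 × Fin q))
    (j : Fin 2 × Fin q) : nilExp (rootMat w u) i (inr j) =
      (1 : SMat q (Gr V)) i (inr j) + weightVec q (Gr V) i * w j := by
  rw [nilExp_rootMat, Matrix.add_apply, Matrix.add_apply, Matrix.smul_apply,
    mul_rootMat_apply_inr, rootMat_mulVec_weightVec, Pi.zero_apply, zero_mul, smul_zero, add_zero,
    rootMat_apply_inr]

theorem mul_nilExp_rootMat_apply_inr (x : SMat q (Gr V)) (w u : Fin 2 × Fin q → Gr V)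
    (i : Fin 2 ⊕ (Fin 2 × Fin q)) (j : Fin 2 × Fin q) :
    (x * nilExp (rootMat w u)) i (inr j) =
      x i (inr j) + x.mulVec (weightVec q (Gr V)) i * w j := by
  have hsum := congrArg (fun y : SMat q (Gr V) => y i (inr j)) (mul_one x)
  simp only [Matrix.mul_apply] at hsum
  simp only [Matrix.mul_apply, nilExp_rootMat_apply_inr, mul_add, Finset.sum_add_distrib, hsum,
    Matrix.mulVec, dotProduct, Finset.sum_mul, mul_assoc]

theorem nilExp_rootMat_toBlocks₁₁_map_body (hw : ∀ i, w i ∈ parity V 1) :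
    (nilExp (rootMat w u)).toBlocks₁₁.map body = 1 := by
  have hsq : (rootMat w u * rootMat w u).toBlocks₁₁.map body = 0 := by
    ext i j
    have hbody : ∀ k, body (w k) = 0 := fun k => body_of_odd (hw k)
    revert i j
    simp [Fin.forall_fin_two, Matrix.toBlocks₁₁, Matrix.mul_apply, rootMat, hbody]
  ext i j
  have hij := congrFun (congrFun hsq i) j
  simp only [Matrix.toBlocks₁₁, Matrix.map_apply, Matrix.of_apply, Matrix.zero_apply] at hij ⊢
  rw [nilExp_rootMat, Matrix.add_apply, Matrix.add_apply, Matrix.smul_apply, map_add, map_add,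
    map_smul, hij]
  simp [rootMat, Matrix.one_apply, apply_ite body]

theorem nilExp_rootMat_toBlocks₂₂ (w u : Fin 2 × Fin q → Gr V) :
    (nilExp (rootMat w u)).toBlocks₂₂ = 1 := by
  ext i j
  simp [Matrix.toBlocks₂₂, nilExp_rootMat_apply_inr, weightVec, Matrix.one_apply]

theorem nilExp_rootMat_symp_mem_ptsN (hw : ∀ i, w i ∈ parity V 1) :
    nilExp (rootMat w (symp w)) ∈ ptsN q V :=
  ⟨_, isEvenSMat_rootMat hw (symp_mem hw), isOsp_rootMat_symp w, commutator_rootMat _ _, rfl⟩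

theorem isOSpPt_nilExp_rootMat_symp (hw : ∀ i, w i ∈ parity V 1) :
    IsOSpPt (nilExp (rootMat w (symp w))) :=
  (isOsp_rootMat_symp w).isOSpPt_nilExp (isEvenSMat_rootMat hw (symp_mem hw))
    (isNilpotent_rootMat _ _)

theorem nilExp_rootMat_neg_mul (w u : Fin 2 × Fin q → Gr V) :
    nilExp (rootMat (-w) (-u)) * nilExp (rootMat w u) = 1 := by
  have h := nilExp_mul_nilExp_neg (isNilpotent_rootMat (-w) (-u))
  rwa [← rootMat_neg, neg_neg, neg_neg] at h

end ExpN

section ExpA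

variable {q : ℕ} {V W : Type} [AddCommGroup V] [Module ℂ V] [AddCommGroup W] [Module ℂ W]
  {h : Gr V}

/-- The superfunction `cosh h`, a diagonal entry of `e^{h h₀}`. -/
def grCosh (h : Gr V) : Gr V := (2⁻¹ : ℂ) • (grExp h + grExp (-h))

/-- The superfunction `sinh h`, an off-diagonal entry of `e^{h h₀}`. -/
def grSinh (h : Gr V) : Gr V := (2⁻¹ : ℂ) • (grExp h - grExp (-h))

theorem grCosh_add_grSinh (h : Gr V) : grCosh h + grSinh h = grExp h := by
  rw [grCosh, grSinh]
  module

theorem grCosh_neg (h : Gr V) : grCosh (-h) = grCosh h := by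
  rw [grCosh, grCosh, neg_neg, add_comm]

theorem grSinh_neg (h : Gr V) : grSinh (-h) = -grSinh h := by
  rw [grSinh, grSinh, neg_neg]
  module

theorem grCosh_mem_parity (hh : h ∈ parity V 0) : grCosh h ∈ parity V 0 :=
  Submodule.smul_mem _ _ (add_mem (grExp_mem_parity hh) (grExp_mem_parity (neg_mem hh)))

theorem grSinh_mem_parity (hh : h ∈ parity V 0) : grSinh h ∈ parity V 0 :=
  Submodule.smul_mem _ _ (sub_mem (grExp_mem_parity hh) (grExp_mem_parity (neg_mem hh)))

theorem grCosh_mul_grSinh (hh : h ∈ parity V 0) : grCosh h * grSinh h = grSinh h * grCosh h :=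
  (commute_of_even (grCosh_mem_parity hh) _).eq

theorem grCosh_sq_sub_grSinh_sq (hh : h ∈ parity V 0) :
    grCosh h * grCosh h - grSinh h * grSinh h = 1 := by
  have hplus := grExp_mul_grExp_neg hh
  have hminus : grExp (-h) * grExp h = 1 := by
    rw [← hplus, (commute_of_even (grExp_mem_parity hh) _).eq]
  simp only [grCosh, grSinh, smul_mul_smul_comm, add_mul, mul_add, sub_mul, mul_sub, hplus, hminus]
  module

theorem body_grCosh (hh : h ∈ parity V 0) : body (grCosh h) = Complex.cosh (body h) := by
  rw [grCosh, map_smul, map_add, body_grExp hh, body_grExp (neg_mem hh), map_neg, Complex.cosh,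
    smul_eq_mul]
  ring

theorem body_grSinh (hh : h ∈ parity V 0) : body (grSinh h) = Complex.sinh (body h) := by
  rw [grSinh, map_smul, map_sub, body_grExp hh, body_grExp (neg_mem hh), map_neg, Complex.sinh,
    smul_eq_mul]
  ring

theorem grCosh_algebraMap (z : ℂ) :
    grCosh (algebraMap ℂ (Gr V) z) = algebraMap ℂ (Gr V) (Complex.cosh z) := by
  rw [grCosh, ← map_neg, grExp_algebraMap, grExp_algebraMap, ← map_add, Complex.cosh,
    Algebra.algebraMap_eq_smul_one, Algebra.algebraMap_eq_smul_one, smul_smul, inv_mul_eq_div]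

theorem grSinh_algebraMap (z : ℂ) :
    grSinh (algebraMap ℂ (Gr V) z) = algebraMap ℂ (Gr V) (Complex.sinh z) := by
  rw [grSinh, ← map_neg, grExp_algebraMap, grExp_algebraMap, ← map_sub, Complex.sinh,
    Algebra.algebraMap_eq_smul_one, Algebra.algebraMap_eq_smul_one, smul_smul, inv_mul_eq_div]

theorem map_grCosh {φ : Gr V →ₐ[ℂ] Gr W} (hφ : IsSuperHom φ) (hh : h ∈ parity V 0) :
    φ (grCosh h) = grCosh (φ h) := by
  rw [grCosh, map_smul, map_add, map_grExp hφ hh, map_grExp hφ (neg_mem hh), map_neg, grCosh]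

theorem map_grSinh {φ : Gr V →ₐ[ℂ] Gr W} (hφ : IsSuperHom φ) (hh : h ∈ parity V 0) :
    φ (grSinh h) = grSinh (φ h) := by
  rw [grSinh, map_smul, map_sub, map_grExp hφ hh, map_grExp hφ (neg_mem hh), map_neg, grSinh]

theorem expA_eq_fromBlocks (h : Gr V) : expA q h =
    Matrix.fromBlocks !![grCosh h, grSinh h; grSinh h, grCosh h] 0 0 1 := rfl

theorem map_expA {φ : Gr V →ₐ[ℂ] Gr W} (hφ : IsSuperHom φ) (hh : h ∈ parity V 0) :
    (expA q h).map φ = expA q (φ h) := by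
  rw [expA_eq_fromBlocks, expA_eq_fromBlocks, Matrix.fromBlocks_map, ← map_grCosh hφ hh,
    ← map_grSinh hφ hh, Matrix.map_zero _ (map_zero φ), Matrix.map_zero _ (map_zero φ),
    Matrix.map_one _ (map_zero φ) (map_one φ)]
  congr 1
  ext i j
  fin_cases i <;> fin_cases j <;> rfl

theorem expA_toBlocks₂₂ (h : Gr V) : (expA q h).toBlocks₂₂ = 1 := rfl

theorem isEvenSMat_expA (hh : h ∈ parity V 0) : IsEvenSMat q V (expA q h) := by
  refine ⟨fun i j => ?_, fun _ _ => zero_mem _, fun _ _ => zero_mem _, fun i j => ?_⟩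
  · fin_cases i <;> fin_cases j
    exacts [grCosh_mem_parity hh, grSinh_mem_parity hh, grSinh_mem_parity hh, grCosh_mem_parity hh]
  · rw [expA_toBlocks₂₂, Matrix.one_apply]
    split_ifs
    exacts [one_mem_parity_zero, zero_mem _]

theorem isOSpPt_expA (hh : h ∈ parity V 0) : IsOSpPt (expA q h) := by
  refine ⟨isEvenSMat_expA hh, ?_⟩
  rw [expA_eq_fromBlocks, superTranspose_fromBlocks, formJ, Matrix.fromBlocks_multiply,
    Matrix.fromBlocks_multiply]
  congr 1
  · have hone := grCosh_sq_sub_grSinh_sq hh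
    have hneg : -(grCosh h * grCosh h) + grSinh h * grSinh h = -1 := by
      rw [← hone]
      abel
    have hpos : -(grSinh h * grSinh h) + grCosh h * grCosh h = 1 := by
      rw [← hone]
      abel
    ext i j
    fin_cases i <;> fin_cases j <;>
      simp [Matrix.mul_apply, Fin.sum_univ_two, grCosh_mul_grSinh hh, hneg, hpos]
  all_goals simp

theorem expA_mul_expA_neg (hh : h ∈ parity V 0) : expA q h * expA q (-h) = 1 := by
  rw [expA_eq_fromBlocks, expA_eq_fromBlocks, Matrix.fromBlocks_multiply, ← Matrix.fromBlocks_one,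
    grCosh_neg, grSinh_neg]
  congr 1
  · have hone := grCosh_sq_sub_grSinh_sq hh
    ext i j
    fin_cases i <;> fin_cases j <;>
      simp [grCosh_mul_grSinh hh, ← hone, sub_eq_add_neg, add_comm]
  all_goals simp

theorem mul_expA_apply_inr (x : SMat q (Gr V)) (h : Gr V) (i : Fin 2 ⊕ (Fin 2 × Fin q))
    (j : Fin 2 × Fin q) : (x * expA q h) i (inr j) = x i (inr j) := by
  simp [Matrix.mul_apply, expA_eq_fromBlocks, Matrix.one_apply]

theorem mul_expA_mulVec_weightVec (x : SMat q (Gr V)) (h : Gr V)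
    (i : Fin 2 ⊕ (Fin 2 × Fin q)) : (x * expA q h).mulVec (weightVec q (Gr V)) i =
      x.mulVec (weightVec q (Gr V)) i * grExp h := by
  simp only [mulVec_weightVec, ← grCosh_add_grSinh, expA_eq_fromBlocks, Matrix.mul_apply,
    Fintype.sum_sum_type, Fin.sum_univ_two, Matrix.fromBlocks_apply₁₁, Matrix.fromBlocks_apply₂₁,
    Matrix.zero_apply, mul_zero, Finset.sum_const_zero, add_zero, Matrix.cons_val', Matrix.of_apply,
    Matrix.cons_val_zero, Matrix.cons_val_one, Matrix.cons_val_fin_one]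
  noncomm_ring

theorem expA_toBlocks₁₁_map_body (hh : h ∈ parity V 0) : (expA q h).toBlocks₁₁.map body =
    !![Complex.cosh (body h), Complex.sinh (body h);
      Complex.sinh (body h), Complex.cosh (body h)] := by
  ext i j
  fin_cases i <;> fin_cases j
  exacts [body_grCosh hh, body_grSinh hh, body_grSinh hh, body_grCosh hh]

theorem expA_toBlocks₂₂_map_body (h : Gr V) : (expA q h).toBlocks₂₂.map body = 1 := by
  rw [expA_toBlocks₂₂, Matrix.map_one _ (map_zero _) (map_one _)]

end ExpA

section Iwasawa

variable {q : ℕ} {V : Type} [AddCommGroup V] [Module ℂ V]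

theorem exists_grExp_eq {c : Gr V} (hc : c ∈ parity V 0) {z : ℂ} (hz : body c = Complex.exp z) :
    ∃ h ∈ parity V 0, body h = z ∧ grExp h = c := by
  obtain ⟨N, hN, hNnil, hexp⟩ := exists_even_log (x := Complex.exp (-z) • c)
    (Submodule.smul_mem _ _ hc) (by rw [map_smul, hz, smul_eq_mul, ← Complex.exp_add,
      neg_add_cancel, Complex.exp_zero])
  refine ⟨algebraMap ℂ (Gr V) z + N, add_mem (algebraMap_mem_parity_zero z) hN, ?_, ?_⟩
  · rw [map_add, body_algebraMap, body_of_isNilpotent hNnil, add_zero]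
  · rw [grExp_algebraMap_add z hNnil, hexp, smul_smul, ← Complex.exp_add, add_neg_cancel,
      Complex.exp_zero, one_smul]

theorem eq_cosh_sinh_of_hyperbolic {a : Matrix (Fin 2) (Fin 2) ℝ} (hdet : a.det = 1)
    (hpos : 0 < a 0 0) (hcol : a 0 0 * a 0 0 - a 1 0 * a 1 0 = 1)
    (hcols : a 0 0 * a 0 1 = a 1 0 * a 1 1) :
    ∃ t : ℝ, a = !![Real.cosh t, Real.sinh t; Real.sinh t, Real.cosh t] := by
  rw [Matrix.det_fin_two] at hdet
  have hdiag : a 1 1 = a 0 0 := by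
    linear_combination a 0 0 * hdet - a 1 1 * hcol + a 1 0 * hcols
  have hoff : a 0 1 = a 1 0 := by
    linear_combination a 1 0 * hdet - a 0 1 * hcol + a 0 0 * hcols
  have hcosh : Real.cosh (Real.arsinh (a 1 0)) = a 0 0 := by
    rw [Real.cosh_arsinh, Real.sqrt_eq_iff_mul_self_eq (by positivity) hpos.le]
    linear_combination -hcol
  refine ⟨Real.arsinh (a 1 0), ?_⟩
  ext i j
  fin_cases i <;> fin_cases j <;> simp [hcosh, hdiag, hoff]

theorem isOSpPt_of_mem_ptsG {g : SMat q (Gr V)} (hg : g ∈ ptsG q V) : IsOSpPt g :=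
  ⟨hg.1, hg.2.1⟩

theorem IsOSpPt.body_form_apply {g : SMat q (Gr V)} (hg : IsOSpPt g) (a b : Fin 2) :
    -(body (g (inl 0) (inl a)) * body (g (inl 0) (inl b))) +
      body (g (inl 1) (inl a)) * body (g (inl 1) (inl b)) = !![-1, 0; 0, 1] a b := by
  have hodd : ∑ k, body (g (inr k) (inl a)) * body (symp (fun l => g (inr l) (inl b)) k) = 0 :=
    Finset.sum_eq_zero fun k _ => by
      have hk : body (g (inr k) (inl a)) = 0 := body_of_odd (hg.isEvenSMat.2.2.1 k a)
      rw [hk, zero_mul]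
  have hform := congrArg body (hg.form_apply_inl a (inl b))
  rw [map_add, map_add, map_neg, map_mul, map_mul, map_sum] at hform
  simp only [map_mul, hodd, add_zero] at hform
  rw [hform]
  revert a b
  simp [formJ, Fin.forall_fin_two]

theorem exists_toBlocks₁₁_map_body_eq {g : SMat q (Gr V)} (hg : g ∈ ptsG q V) :
    ∃ t : ℝ, g.toBlocks₁₁.map body =
      !![Complex.cosh t, Complex.sinh t; Complex.sinh t, Complex.cosh t] := by
  have hform := (isOSpPt_of_mem_ptsG hg).body_form_apply
  obtain ⟨a, ha, hdet, hpos⟩ := hg.2.2.1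
  have hentry : ∀ i j, body (g (inl i) (inl j)) = (a i j : ℂ) := fun i j =>
    congrFun (congrFun ha i) j
  simp only [hentry] at hform
  have hcol : a 0 0 * a 0 0 - a 1 0 * a 1 0 = 1 := by
    have h : -((a 0 0 : ℂ) * a 0 0) + a 1 0 * a 1 0 = -1 := by simpa using hform 0 0
    have hcast : ((a 0 0 * a 0 0 - a 1 0 * a 1 0 : ℝ) : ℂ) = 1 := by
      push_cast
      linear_combination -h
    exact_mod_cast hcast
  have hcols : a 0 0 * a 0 1 = a 1 0 * a 1 1 := by
    have h : -((a 0 0 : ℂ) * a 0 1) + a 1 0 * a 1 1 = 0 := by simpa using hform 0 1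
    have hcast : ((a 0 0 * a 0 1 : ℝ) : ℂ) = (a 1 0 * a 1 1 : ℝ) := by
      push_cast
      linear_combination -h
    exact_mod_cast hcast
  obtain ⟨t, rfl⟩ := eq_cosh_sinh_of_hyperbolic hdet hpos hcol hcols
  refine ⟨t, ?_⟩
  rw [ha]
  ext i j
  fin_cases i <;> fin_cases j <;> simp

variable [FiniteDimensional ℂ V]

theorem IsOSpPt.fixesIndex_zero {k : SMat q (Gr V)} (hk : IsOSpPt k)
    (hinr : ∀ j, k (inl 0) (inr j) = 0) (hsum : k.mulVec (weightVec q (Gr V)) (inl 0) = 1) :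
    FixesIndex k (inl 0) := by
  rw [mulVec_weightVec] at hsum
  set ε : SMat q (Gr V) := Matrix.fromBlocks 1 0 0 (-1) with hε
  have hinv : k * formJ q (Gr V) * (ε * superTranspose k) = formJ q (Gr V) * ε := by
    rw [← formJInv_eq_formJ_mul, ← mul_assoc, mul_assoc k, ← formJInv_eq_formJ_mul]
    have h := congrArg (· * formJInv q (Gr V)) (mul_eq_one_comm.mp hk.inv_mul)
    simpa only [mul_assoc, formJ_mul_formJInv, mul_one, one_mul] using h
  have hcol : ∀ i, -(k i (inl 0) * k (inl 0) (inl 0)) + k i (inl 1) * k (inl 0) (inl 1) =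
      -(1 : SMat q (Gr V)) i (inl 0) := fun i => by
    have h := congrFun (congrFun hinv i) (inl 0)
    have hl : ∀ a, (ε * superTranspose k) (inl a) (inl 0) = k (inl 0) (inl a) := fun a => by
      simp [hε, Matrix.mul_apply, Matrix.one_apply, superTranspose_inl_inl]
    have hr : (fun l => (ε * superTranspose k) (inr l) (inl 0)) = 0 := funext fun l => by
      simp [hε, Matrix.mul_apply, Matrix.one_apply, superTranspose_inr_inl, hinr]
    have hJ : (formJ q (Gr V) * ε) i (inl 0) = -(1 : SMat q (Gr V)) i (inl 0) := by
      revert i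
      simp [hε, formJ, Matrix.fromBlocks_multiply, Sum.forall, Fin.forall_fin_two, -Prod.forall]
    rw [mul_formJ_mul_apply, hl, hl, hr, hJ] at h
    simpa [symp] using h
  have hdiff : k (inl 0) (inl 0) - k (inl 0) (inl 1) = 1 := by
    have hcomm : k (inl 0) (inl 0) * k (inl 0) (inl 1) = k (inl 0) (inl 1) * k (inl 0) (inl 0) :=
      (commute_of_even (hk.isEvenSMat.1 0 0) _).eq
    calc k (inl 0) (inl 0) - k (inl 0) (inl 1)
        = (k (inl 0) (inl 0) + k (inl 0) (inl 1)) * (k (inl 0) (inl 0) - k (inl 0) (inl 1)) := by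
          rw [hsum, one_mul]
      _ = -(-(k (inl 0) (inl 0) * k (inl 0) (inl 0)) + k (inl 0) (inl 1) * k (inl 0) (inl 1)) := by
          rw [add_mul, mul_sub, mul_sub, hcomm]
          noncomm_ring
      _ = 1 := by rw [hcol, Matrix.one_apply_eq, neg_neg]
  have hone : k (inl 0) (inl 0) = 1 := by
    linear_combination (norm := module) (2⁻¹ : ℂ) • hsum + (2⁻¹ : ℂ) • hdiff
  have hzero : k (inl 0) (inl 1) = 0 := by
    linear_combination (norm := module) (2⁻¹ : ℂ) • hsum - (2⁻¹ : ℂ) • hdiff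
  refine ⟨?_, fun i => ?_⟩
  · simp [Sum.forall, Fin.forall_fin_two, hone, hzero, hinr]
  · simpa [hone, hzero] using hcol i

theorem IsOSpPt.mul_expA_mem_ptsK {g : SMat q (Gr V)} {h : Gr V} (hg : IsOSpPt g)
    (hh : h ∈ parity V 0) (hinr : ∀ j, g (inl 0) (inr j) = 0)
    (hsum : g.mulVec (weightVec q (Gr V)) (inl 0) = grExp h)
    (hbody : g.toBlocks₁₁.map body = (expA q h).toBlocks₁₁.map body)
    (hu : g.toBlocks₂₂.map body ∈ Matrix.unitaryGroup (Fin 2 × Fin q) ℂ) :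
    g * expA q (-h) ∈ ptsK q V := by
  have hA : IsOSpPt (expA q (-h)) := isOSpPt_expA (neg_mem hh)
  refine mem_ptsK_iff.mpr ⟨hg.mul hA, (hg.mul hA).fixesIndex_zero (fun j => ?_) ?_, ?_, ?_⟩
  · rw [mul_expA_apply_inr, hinr]
  · rw [mul_expA_mulVec_weightVec, hsum, grExp_mul_grExp_neg hh]
  · have hone : (g * expA q (-h)).toBlocks₁₁.map body =
        (1 : SMat q (Gr V)).toBlocks₁₁.map body := by
      rw [hg.isEvenSMat.toBlocks₁₁_mul_map_body hA.isEvenSMat, hbody,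
        ← (isEvenSMat_expA hh).toBlocks₁₁_mul_map_body hA.isEvenSMat, expA_mul_expA_neg hh]
    exact (congrFun (congrFun hone 1) 1).trans (map_one body)
  · rwa [hg.isEvenSMat.toBlocks₂₂_mul_map_body hA.isEvenSMat, expA_toBlocks₂₂_map_body, mul_one]

theorem exists_iwasawa_decomposition {g : SMat q (Gr V)} (hg : g ∈ ptsG q V) :
    ∃ h ∈ ptsa V, ∃ k ∈ ptsK q V, ∃ n ∈ ptsN q V, g = k * expA q h * n := by
  obtain ⟨t, ht⟩ := exists_toBlocks₁₁_map_body_eq hg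
  have hgo := isOSpPt_of_mem_ptsG hg
  set c := g.mulVec (weightVec q (Gr V)) (inl 0) with hc
  have hcsum : c = g (inl 0) (inl 0) + g (inl 0) (inl 1) := mulVec_weightVec g _
  have hbody : body c = Complex.exp t := by
    rw [hcsum, map_add, ← Complex.cosh_add_sinh]
    exact congrArg₂ (· + ·) (congrFun (congrFun ht 0) 0) (congrFun (congrFun ht 0) 1)
  obtain ⟨h, hh, hht, hexp⟩ :=
    exists_grExp_eq (hcsum ▸ add_mem (hgo.isEvenSMat.1 0 0) (hgo.isEvenSMat.1 0 1)) hbody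
  set w : Fin 2 × Fin q → Gr V := fun j => grExp (-h) * g (inl 0) (inr j) with hw
  have hwo : ∀ j, w j ∈ parity V 1 := fun j =>
    even_mul_odd (grExp_mem_parity (neg_mem hh)) (hgo.isEvenSMat.2.1 0 j)
  have hwo' : ∀ j, (-w) j ∈ parity V 1 := fun j => neg_mem (hwo j)
  set n' := nilExp (rootMat (-w) (symp (-w))) with hn'
  have hn'o : IsOSpPt n' := isOSpPt_nilExp_rootMat_symp hwo'
  have hinv : n' * nilExp (rootMat w (symp w)) = 1 := by
    rw [hn', symp_neg, nilExp_rootMat_neg_mul]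
  have hk : g * n' * expA q (-h) ∈ ptsK q V := by
    refine (hgo.mul hn'o).mul_expA_mem_ptsK hh (fun j => ?_) ?_ ?_ ?_
    · rw [hn', mul_nilExp_rootMat_apply_inr, ← hc, ← hexp, Pi.neg_apply, hw, mul_neg, ← mul_assoc,
        grExp_mul_grExp_neg hh, one_mul, add_neg_cancel]
    · rw [← Matrix.mulVec_mulVec, hn', nilExp_rootMat_mulVec_weightVec, ← hc, hexp]
    · rw [hgo.isEvenSMat.toBlocks₁₁_mul_map_body hn'o.isEvenSMat, hn',
        nilExp_rootMat_toBlocks₁₁_map_body hwo', mul_one, ht, expA_toBlocks₁₁_map_body hh, hht]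
    · rw [hgo.isEvenSMat.toBlocks₂₂_mul_map_body hn'o.isEvenSMat, hn', nilExp_rootMat_toBlocks₂₂,
        Matrix.map_one _ (map_zero _) (map_one _), mul_one]
      exact hg.2.2.2
  refine ⟨h, ⟨hh, by rw [hht, Complex.ofReal_im]⟩, _, hk, _,
    nilExp_rootMat_symp_mem_ptsN hwo, ?_⟩
  rw [mul_assoc (g * n'), mul_eq_one_comm.mp (expA_mul_expA_neg hh), mul_one, mul_assoc, hinv,
    mul_one]

end Iwasawa

section IwasawaProjection

variable {q : ℕ} {V : Type} [AddCommGroup V] [Module ℂ V]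

theorem mulVec_weightVec_of_decomposition {k n : SMat q (Gr V)} {h : Gr V} (hk : k ∈ ptsK q V)
    (hn : n ∈ ptsN q V) : (k * expA q h * n).mulVec (weightVec q (Gr V)) (inl 0) = grExp h := by
  obtain ⟨x, -, -, hx, rfl⟩ := hn
  have hrow := (fixesIndex_zero_of_mem_ptsK hk).1
  rw [← Matrix.mulVec_mulVec, eq_rootMat hx, nilExp_rootMat_mulVec_weightVec,
    mul_expA_mulVec_weightVec, mulVec_weightVec, hrow, hrow]
  simp

theorem toBlocks₁₁_map_body_of_mem_ptsK {k : SMat q (Gr V)} (hk : k ∈ ptsK q V) :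
    k.toBlocks₁₁.map body = 1 := by
  obtain ⟨hrow, hcol⟩ := fixesIndex_zero_of_mem_ptsK hk
  ext i j
  fin_cases i <;> fin_cases j <;>
    simp [Matrix.toBlocks₁₁, hrow, hcol, body_one_one_of_mem_ptsK hk]

theorem expA_mul_mem_ptsG {k : SMat q (Gr V)} (hk : k ∈ ptsK q V) (t : ℝ) :
    expA q (algebraMap ℂ (Gr V) t) * k ∈ ptsG q V := by
  have ht := algebraMap_mem_parity_zero (V := V) (t : ℂ)
  have hA := isOSpPt_expA (q := q) ht
  have hko := isOSpPt_of_mem_ptsK hk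
  refine ⟨(hA.mul hko).isEvenSMat, (hA.mul hko).form_eq,
    ⟨!![Real.cosh t, Real.sinh t; Real.sinh t, Real.cosh t], ?_, ?_, Real.cosh_pos t⟩, ?_⟩
  · rw [hA.isEvenSMat.toBlocks₁₁_mul_map_body hko.isEvenSMat, toBlocks₁₁_map_body_of_mem_ptsK hk,
      expA_toBlocks₁₁_map_body ht, body_algebraMap, mul_one]
    ext i j
    fin_cases i <;> fin_cases j <;> simp
  · rw [Matrix.det_fin_two_of, ← sq, ← sq, Real.cosh_sq_sub_sinh_sq]
  · rw [hA.isEvenSMat.toBlocks₂₂_mul_map_body hko.isEvenSMat, expA_toBlocks₂₂_map_body, one_mul]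
    exact hk.1.2.2.2

theorem expA_mul_mulVec_weightVec {k : SMat q (Gr V)} (hk : k ∈ ptsK q V) (t : ℝ) :
    (expA q (algebraMap ℂ (Gr V) t) * k).mulVec (weightVec q (Gr V)) (inl 0) =
      Complex.exp t • (1 + ((1 - Complex.exp (-2 * t)) / 2) • (k (inl 1) (inl 1) - 1)) := by
  obtain ⟨hrow, hcol⟩ := fixesIndex_zero_of_mem_ptsK hk
  have hzero : k.mulVec (weightVec q (Gr V)) (inl 0) = 1 := by
    rw [mulVec_weightVec, hrow, hrow]
    simp
  have hone : k.mulVec (weightVec q (Gr V)) (inl 1) = k (inl 1) (inl 1) := by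
    rw [mulVec_weightVec, hcol]
    simp
  have hsinh : Complex.exp t * ((1 - Complex.exp (-2 * t)) / 2) = Complex.sinh t := by
    rw [mul_div_assoc', mul_sub, ← Complex.exp_add, Complex.sinh]
    ring_nf
  calc (expA q (algebraMap ℂ (Gr V) t) * k).mulVec (weightVec q (Gr V)) (inl 0)
      = Complex.cosh t • 1 + Complex.sinh t • k (inl 1) (inl 1) := by
        rw [← Matrix.mulVec_mulVec, Matrix.mulVec, dotProduct, Fintype.sum_sum_type,
          Fin.sum_univ_two, hzero, hone, expA_eq_fromBlocks, grCosh_algebraMap, grSinh_algebraMap]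
        simp [Algebra.algebraMap_eq_smul_one]
    _ = Complex.exp t • (1 + ((1 - Complex.exp (-2 * t)) / 2) • (k (inl 1) (inl 1) - 1)) := by
        rw [smul_add, smul_smul, hsinh, ← Complex.cosh_add_sinh]
        module

variable [FiniteDimensional ℂ V]

theorem iwasawaH_spec {g : SMat q (Gr V)} (hg : g ∈ ptsG q V) :
    iwasawaH q g ∈ ptsa V ∧ grExp (iwasawaH q g) = g.mulVec (weightVec q (Gr V)) (inl 0) := by
  have hex := exists_iwasawa_decomposition hg
  have hH : iwasawaH q g = hex.choose := dif_pos hex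
  obtain ⟨ha, k, hk, n, hn, heq⟩ := hex.choose_spec
  rw [← hH] at ha heq
  refine ⟨ha, ?_⟩
  rw [← mulVec_weightVec_of_decomposition (h := iwasawaH q g) hk hn, ← heq]

theorem body_iwasawaH_expA_mul {k : SMat q (Gr V)} (hk : k ∈ ptsK q V) (t : ℝ) :
    body (iwasawaH q (expA q (algebraMap ℂ (Gr V) t) * k)) = t := by
  obtain ⟨⟨heven, him⟩, hexp⟩ := iwasawaH_spec (expA_mul_mem_ptsG hk t)
  set h := iwasawaH q (expA q (algebraMap ℂ (Gr V) t) * k)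
  have hbody : Complex.exp (body h) = Complex.exp t := by
    rw [← body_grExp heven, hexp, expA_mul_mulVec_weightVec hk]
    simp [body_one_one_of_mem_ptsK hk]
  have hre : body h = ((body h).re : ℂ) := Complex.ext rfl (by simpa using him)
  rw [hre, ← Complex.ofReal_exp, ← Complex.ofReal_exp, Complex.ofReal_inj,
    Real.exp_eq_exp] at hbody
  rw [hre, hbody]

end IwasawaProjection

section CoordForm

theorem add_pow_succ_of_mul_self_eq_zero {A : Type*} [Semiring A] {x p : A} (h : Commute x p)
    (hp : p * p = 0) (n : ℕ) : (x + p) ^ (n + 1) = x ^ (n + 1) + (n + 1) • (x ^ n * p) := by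
  induction n with
  | zero => simp
  | succ n ih =>
    have hsq : x ^ n * p * p = 0 := by rw [mul_assoc, hp, mul_zero]
    have hcomm : x ^ n * p * x = x ^ (n + 1) * p := by
      rw [mul_assoc, ← h.eq, ← mul_assoc, pow_succ]
    rw [pow_succ, ih, add_mul, mul_add, smul_mul_assoc, mul_add, hsq, hcomm, add_zero, ← pow_succ,
      add_assoc, add_comm (x ^ (n + 1) * p), ← succ_nsmul]

theorem oddDeriv_pow_eq_zero {U : Type} [AddCommGroup U] [Module ℂ U] {d : Module.Dual ℂ U}
    {x : Gr U} (h : oddDeriv d x = 0) (n : ℕ) : oddDeriv d (x ^ n) = 0 := by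
  induction n with
  | zero => rw [pow_zero, ← map_one (algebraMap ℂ (Gr U)), contractLeft_algebraMap]
  | succ n ih => rw [pow_succ, oddDeriv_mul, ih, h, zero_mul, mul_zero, add_zero]

variable {q : ℕ}

/-- The product of the two odd coordinates of the `j`-th symplectic plane. -/
def planeForm (j : Fin q) : Gr (Coord (2 * q)) := coordCol q (0, j) * coordCol q (1, j)

theorem planeForm_mem (j : Fin q) : planeForm j ∈ parity (Coord (2 * q)) 0 :=
  odd_mul_odd (coordCol_mem _) (coordCol_mem _)

theorem coordForm_eq_two_smul_sum : coordForm q = (2 : ℂ) • ∑ j : Fin q, planeForm j := by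
  rw [coordForm, sympForm, Fintype.sum_prod_type, Fin.sum_univ_two, ← Finset.sum_add_distrib,
    Finset.smul_sum]
  refine Finset.sum_congr rfl fun j _ => ?_
  rw [symp_zero, symp_one, mul_neg,
    odd_mul_odd_eq_neg (coordCol_mem (1, j)) (coordCol_mem (0, j)), neg_neg, two_smul, planeForm]

theorem planeForm_mul_coordCol (a : Fin 2) (j : Fin q) : planeForm j * coordCol q (a, j) = 0 := by
  fin_cases a
  · change coordCol q (0, j) * coordCol q (1, j) * coordCol q (0, j) = 0
    rw [mul_assoc, odd_mul_odd_eq_neg (coordCol_mem (1, j)) (coordCol_mem (0, j)), mul_neg,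
      ← mul_assoc, odd_mul_self (coordCol_mem _), zero_mul, neg_zero]
  · change coordCol q (0, j) * coordCol q (1, j) * coordCol q (1, j) = 0
    rw [mul_assoc, odd_mul_self (coordCol_mem _), mul_zero]

theorem planeForm_mul_self (j : Fin q) : planeForm j * planeForm j = 0 := by
  nth_rw 2 [planeForm]
  rw [← mul_assoc, planeForm_mul_coordCol, zero_mul]

theorem sum_insert_planeForm_pow {s : Finset (Fin q)} {j : Fin q} (hj : j ∉ s) (n : ℕ) :
    (∑ l ∈ insert j s, planeForm l) ^ (n + 1) =
      (∑ l ∈ s, planeForm l) ^ (n + 1) + (n + 1) • ((∑ l ∈ s, planeForm l) ^ n * planeForm j) := by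
  rw [Finset.sum_insert hj, add_comm (planeForm j)]
  exact add_pow_succ_of_mul_self_eq_zero (commute_of_even (planeForm_mem j) _).symm
    (planeForm_mul_self j) n

theorem sum_planeForm_pow_card_add_one (s : Finset (Fin q)) :
    (∑ j ∈ s, planeForm j) ^ (s.card + 1) = 0 := by
  induction s using Finset.induction_on with
  | empty => simp
  | insert j s hj ih =>
    rw [sum_insert_planeForm_pow hj, Finset.card_insert_of_notMem hj, pow_succ _ (s.card + 1), ih,
      zero_mul, zero_mul, smul_zero, add_zero]

theorem coordForm_pow_succ : coordForm q ^ (q + 1) = 0 := by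
  have h := sum_planeForm_pow_card_add_one (Finset.univ : Finset (Fin q))
  rw [Finset.card_univ, Fintype.card_fin] at h
  rw [coordForm_eq_two_smul_sum, smul_pow, h, smul_zero]

theorem coordForm_pow_mul_coordCol (i : Fin 2 × Fin q) : coordForm q ^ q * coordCol q i = 0 := by
  obtain ⟨a, j⟩ := i
  have hq : q - 1 + 1 = q := Nat.sub_add_cancel (Fin.pos j)
  have hpow := sum_planeForm_pow_card_add_one ((Finset.univ : Finset (Fin q)).erase j)
  have hinsert := sum_insert_planeForm_pow (Finset.notMem_erase j Finset.univ) (q - 1)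
  rw [Finset.card_erase_of_mem (Finset.mem_univ j), Finset.card_univ, Fintype.card_fin] at hpow
  rw [hpow, zero_add, hq, Finset.insert_erase (Finset.mem_univ j)] at hinsert
  rw [coordForm_eq_two_smul_sum, smul_pow, hinsert, smul_mul_assoc, smul_mul_assoc, mul_assoc,
    planeForm_mul_coordCol, mul_zero, smul_zero, smul_zero]

theorem coordForm_pow_mul (a : Gr (Coord (2 * q))) :
    coordForm q ^ q * a = body a • coordForm q ^ q := by
  have hcoord : ∀ i, coordForm q ^ q * oddCoord i = 0 := fun i => by
    have h := coordForm_pow_mul_coordCol ((idx q).symm i)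
    rwa [coordCol, Equiv.apply_symm_apply] at h
  induction a using ExteriorAlgebra.induction with
  | algebraMap r => rw [body_algebraMap, ← Algebra.commutes, ← Algebra.smul_def]
  | ι v => simp [ι_eq_sum_smul_oddCoord v, Finset.mul_sum, hcoord, body_of_odd (oddCoord_mem _)]
  | mul x y hx hy => rw [← mul_assoc, hx, smul_mul_assoc, hy, smul_smul, map_mul]
  | add x y hx hy => rw [mul_add, hx, hy, map_add, add_smul]

/-- The derivative with respect to an odd coordinate of `K/M`. -/
abbrev coordDeriv (i : Fin 2 × Fin q) : Gr (Coord (2 * q)) →ₗ[ℂ] Gr (Coord (2 * q)) :=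
  oddDeriv (coordDual (idx q i))

theorem coordDeriv_coordCol (i j : Fin 2 × Fin q) :
    coordDeriv i (coordCol q j) = if i = j then 1 else 0 := by
  rw [coordCol, oddCoord, contractLeft_ι, coordDual_single]
  by_cases h : i = j
  · simp [h]
  · rw [if_neg (fun e => h ((idx q).injective e)), if_neg h, map_zero]

theorem coordDeriv_planeForm_of_ne (a : Fin 2) {j l : Fin q} (h : j ≠ l) :
    coordDeriv (a, j) (planeForm l) = 0 := by
  rw [planeForm, oddDeriv_mul, coordDeriv_coordCol, coordDeriv_coordCol, if_neg (by simp [h]),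
    if_neg (by simp [h]), zero_mul, mul_zero, add_zero]

theorem coordDeriv_coordDeriv_mul_planeForm {a : Gr (Coord (2 * q))} {j : Fin q}
    (ha : a ∈ parity (Coord (2 * q)) 0) (hd : ∀ i, coordDeriv (i, j) a = 0) :
    coordDeriv (1, j) (coordDeriv (0, j) (a * planeForm j)) = a := by
  have hplane : coordDeriv (0, j) (planeForm j) = coordCol q (1, j) := by
    rw [planeForm, oddDeriv_mul, coordDeriv_coordCol, coordDeriv_coordCol, if_pos rfl,
      if_neg (by simp), mul_zero, add_zero, one_mul]
  have hinner : coordDeriv (0, j) (a * planeForm j) = a * coordCol q (1, j) := by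
    rw [oddDeriv_mul, hd, zero_mul, zero_add, parityAut_of_even ha, hplane]
  rw [hinner, oddDeriv_mul, hd, zero_mul, zero_add, parityAut_of_even ha, coordDeriv_coordCol,
    if_pos rfl, mul_one]

theorem sum_planeForm_pow_card_ne_zero (s : Finset (Fin q)) :
    (∑ j ∈ s, planeForm j) ^ s.card ≠ 0 := by
  induction s using Finset.induction_on with
  | empty => simp
  | insert j s hj ih =>
    have hderiv : ∀ a, coordDeriv (a, j) ((∑ l ∈ s, planeForm l) ^ s.card) = 0 := fun a => by
      refine oddDeriv_pow_eq_zero ?_ _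
      rw [map_sum]
      exact Finset.sum_eq_zero fun l hl => coordDeriv_planeForm_of_ne a fun e => hj (e ▸ hl)
    have heven : (∑ l ∈ s, planeForm l) ^ s.card ∈ parity (Coord (2 * q)) 0 :=
      even_pow (sum_mem fun l _ => planeForm_mem l) _
    rw [Finset.card_insert_of_notMem hj, sum_insert_planeForm_pow hj,
      sum_planeForm_pow_card_add_one, zero_add, ← Nat.cast_smul_eq_nsmul ℂ]
    refine smul_ne_zero (Nat.cast_ne_zero.mpr (Nat.succ_ne_zero _)) fun hzero => ih ?_
    rw [← coordDeriv_coordDeriv_mul_planeForm heven hderiv, hzero, map_zero, map_zero]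

theorem berezin_coordForm_pow_ne_zero (q : ℕ) : berezin (coordForm q ^ q) ≠ 0 := by
  refine berezin_ne_zero ?_ fun i => ?_
  · have h := sum_planeForm_pow_card_ne_zero (Finset.univ : Finset (Fin q))
    rw [Finset.card_univ, Fintype.card_fin] at h
    rw [coordForm_eq_two_smul_sum, smul_pow]
    exact smul_ne_zero (pow_ne_zero _ two_ne_zero) h
  · rw [coordForm_pow_mul, body_of_odd (oddCoord_mem i), zero_smul]

end CoordForm

section ChartRootInv

variable {q : ℕ}

theorem exists_chartRootInv (q : ℕ) : ∃ b ∈ parity (Coord (2 * q)) 0,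
    chartRoot q * b = 1 ∧ b * chartRoot q = 1 :=
  exists_even_inverse chartRoot_mem (by rw [body_chartRoot]; exact one_ne_zero)

/-- The superfunction `1 / √(1 - τ)`, the coefficient of the invariant density. -/
def chartRootInv (q : ℕ) : Gr (Coord (2 * q)) := (exists_chartRootInv q).choose

theorem chartRootInv_mem : chartRootInv q ∈ parity (Coord (2 * q)) 0 :=
  (exists_chartRootInv q).choose_spec.1

theorem chartRoot_mul_inv : chartRoot q * chartRootInv q = 1 :=
  (exists_chartRootInv q).choose_spec.2.1

theorem chartRootInv_mul : chartRootInv q * chartRoot q = 1 :=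
  (exists_chartRootInv q).choose_spec.2.2

end ChartRootInv

/-! ### The invariant density -/

section Homs

variable {U V W : Type} [AddCommGroup U] [Module ℂ U] [AddCommGroup V] [Module ℂ V]
  [AddCommGroup W] [Module ℂ W]

theorem algHom_ext_pull {A : Type} [Ring A] [Algebra ℂ A] {φ ψ : Gr (V × W) →ₐ[ℂ] A}
    (hfst : φ.comp (pullFst V W) = ψ.comp (pullFst V W))
    (hsnd : φ.comp (pullSnd V W) = ψ.comp (pullSnd V W)) : φ = ψ := by
  refine ExteriorAlgebra.hom_ext (LinearMap.prod_ext ?_ ?_)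
  · ext v
    have h := DFunLike.congr_fun hfst (ι ℂ v)
    rwa [AlgHom.comp_apply, AlgHom.comp_apply, pullFst, ExteriorAlgebra.map_apply_ι] at h
  · ext w
    have h := DFunLike.congr_fun hsnd (ι ℂ w)
    rwa [AlgHom.comp_apply, AlgHom.comp_apply, pullSnd, ExteriorAlgebra.map_apply_ι] at h

/-- As `η * η = 0`, moving along the vector field `η b ∂` is given by its first order term. -/
theorem algHom_eq_sub_mul_oddDeriv {φ ψ : Gr W →ₐ[ℂ] Gr U} (hφ : IsSuperHom φ) {η : Gr U}
    (hη : η ∈ parity U 1) {b : Gr W} (hb : b ∈ parity W 0) (d : Module.Dual ℂ W)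
    (h : ∀ v, ψ (ι ℂ v) = φ (ι ℂ v) + d v • (η * φ b)) (a : Gr W) :
    ψ a = φ a - φ (b * oddDeriv d (parityAut W a)) * η := by
  have hcomm : ∀ x, η * φ x = φ (parityAut W x) * η := fun x => by
    rw [odd_mul_eq_parityAut_mul hη, hφ.apply_parityAut]
  induction a using ExteriorAlgebra.induction with
  | algebraMap r =>
    rw [AlgHom.commutes, AlgHom.commutes, AlgHom.commutes, contractLeft_algebraMap, mul_zero,
      map_zero, zero_mul, sub_zero]
  | ι v =>
    rw [h, parityAut_ι, map_neg, contractLeft_ι, hcomm, parityAut_of_even hb, mul_neg, map_neg,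
      neg_mul, sub_neg_eq_add, ← Algebra.commutes, ← Algebra.smul_def, map_smul, smul_mul_assoc]
  | mul x z hx hz =>
    have hderiv : oddDeriv d (parityAut W (x * z)) =
        oddDeriv d (parityAut W x) * parityAut W z + x * oddDeriv d (parityAut W z) := by
      rw [map_mul, oddDeriv_mul, parityAut_parityAut]
    have hbx : b * (x * oddDeriv d (parityAut W z)) = x * (b * oddDeriv d (parityAut W z)) := by
      rw [← mul_assoc, (commute_of_even hb x).eq, mul_assoc]
    have hsq : ∀ u : Gr U, η * (u * η) = 0 := fun u => by
      rw [← mul_assoc, odd_mul_eq_parityAut_mul hη, mul_assoc, odd_mul_self hη, mul_zero]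
    rw [map_mul, hx, hz, hderiv, mul_add, hbx, ← mul_assoc b, map_add,
      map_mul φ (b * _) (parityAut W z), map_mul φ x, map_mul φ x, add_mul,
      mul_assoc (φ (b * _)) (φ (parityAut W z)), ← hcomm, sub_mul, mul_sub, mul_sub,
      mul_assoc _ η (_ * η), hsq]
    noncomm_ring
  | add x z hx hz =>
    rw [map_add, hx, hz, map_add, map_add, map_add, mul_add, map_add, add_mul]
    abel

end Homs

section Action

variable {q : ℕ} {V W : Type} [AddCommGroup V] [Module ℂ V] [AddCommGroup W] [Module ℂ W]

theorem stdPt_map (φ : Gr V →ₐ[ℂ] Gr W) (b c : Gr V) (ξ : Fin 2 × Fin q → Gr V) :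
    (stdPt b c ξ).map φ = stdPt (φ b) (φ c) (fun i => φ (ξ i)) := by
  have h : ∀ k, φ (symp ξ k) = symp (fun k => φ (ξ k)) k := symp_map (φ : Gr V →+* Gr W) ξ
  ext (i | i) (j | j)
  · fin_cases i <;> fin_cases j <;> simp [stdPt]
  · fin_cases i <;> simp [stdPt, h]
  · fin_cases j <;> simp [stdPt]
  · simp [stdPt_inr_inr, h, Matrix.one_apply, apply_ite]

theorem elemPt_map (φ : Gr V →ₐ[ℂ] Gr W) (i : Fin 2 × Fin q) (η : Gr V) :
    (elemPt i η).map φ = elemPt i (φ η) := by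
  rw [elemPt, stdPt_map, map_one, AlgHom.commutes, elemPt]
  congr 1
  ext k
  rw [Pi.apply_single (fun _ => φ) fun _ => map_zero φ]

/-- The standard chart, over a parameter space. -/
abbrev relChart (q : ℕ) (V : Type) [AddCommGroup V] [Module ℂ V] :
    SMat q (Gr (V × Coord (2 * q))) := (stdChart q).map (pullSnd V (Coord (2 * q)))

theorem relChart_inl : relChart q V (inl 1) (inl 1) = pullSnd V _ (chartRoot q) := rfl

theorem relChart_inr (i : Fin 2 × Fin q) :
    relChart q V (inr i) (inl 1) = pullSnd V _ (coordCol q i) := rfl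

theorem relChart_mem_ptsK : relChart q V ∈ ptsK q (V × Coord (2 * q)) :=
  map_mem_ptsK isChart_stdChart.1 isSuperHom_pullSnd

/-- The image of the standard chart under a point of `K`. -/
abbrev movedChart (g : SMat q (Gr V)) : SMat q (Gr (V × Coord (2 * q))) :=
  g.map (pullFst V (Coord (2 * q))) * relChart q V

theorem movedChart_mem_ptsK {g : SMat q (Gr V)} (hg : g ∈ ptsK q V) :
    movedChart g ∈ ptsK q (V × Coord (2 * q)) :=
  mul_mem_ptsK (map_mem_ptsK hg isSuperHom_pullFst) relChart_mem_ptsK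

theorem movedChart_apply (g : SMat q (Gr V)) (i j : Fin 2 ⊕ (Fin 2 × Fin q)) :
    movedChart g i j = ∑ l, pullFst V _ (g i l) * relChart q V l j := Matrix.mul_apply

theorem movedChart_mul_apply (g k : SMat q (Gr V)) (i j : Fin 2 ⊕ (Fin 2 × Fin q)) :
    movedChart (g * k) i j = ∑ l, pullFst V _ (g i l) * movedChart k l j := by
  rw [movedChart, Matrix.map_mul, mul_assoc, Matrix.mul_apply]
  rfl

/-- The images of the generators under the action of a point of `K`. -/
def actLin (g : SMat q (Gr V)) : V × Coord (2 * q) →ₗ[ℂ] Gr (V × Coord (2 * q)) :=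
  (ι ℂ ∘ₗ LinearMap.inl ℂ V (Coord (2 * q))).coprod
    (Fintype.linearCombination ℂ fun i => movedChart g (inr ((idx q).symm i)) (inl 1))

theorem actLin_apply (g : SMat q (Gr V)) (v : V × Coord (2 * q)) : actLin g v =
    ι ℂ (v.1, 0) + ∑ i, v.2 i • movedChart g (inr ((idx q).symm i)) (inl 1) := rfl

theorem actLin_mem {g : SMat q (Gr V)} (hg : g ∈ ptsK q V) (v : V × Coord (2 * q)) :
    actLin g v ∈ parity (V × Coord (2 * q)) 1 := by
  rw [actLin_apply]
  exact add_mem (ι_mem_parity_one _) (sum_mem fun _ _ => Submodule.smul_mem _ _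
    ((isOSpPt_of_mem_ptsK (movedChart_mem_ptsK hg)).isEvenSMat.2.2.1 _ 1))

/-- The action of a point of `K` on the superfunctions on `K/M`, in the standard chart. -/
def actHom (g : SMat q (Gr V)) (hg : g ∈ ptsK q V) :
    Gr (V × Coord (2 * q)) →ₐ[ℂ] Gr (V × Coord (2 * q)) :=
  ExteriorAlgebra.lift ℂ ⟨actLin g, fun v => odd_mul_self (actLin_mem hg v)⟩

variable {g : SMat q (Gr V)} (hg : g ∈ ptsK q V)

theorem actHom_ι (v : V × Coord (2 * q)) : actHom g hg (ι ℂ v) = actLin g v := by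
  rw [actHom, ExteriorAlgebra.lift_ι_apply]

theorem isSuperHom_actHom : IsSuperHom (actHom g hg) :=
  isSuperHom_of_ι fun v => by rw [actHom_ι]; exact actLin_mem hg v

theorem actHom_comp_pullFst :
    (actHom g hg).comp (pullFst V (Coord (2 * q))) = pullFst V (Coord (2 * q)) := by
  ext v
  change actHom g hg (pullFst V _ (ι ℂ v)) = pullFst V _ (ι ℂ v)
  rw [pullFst, ExteriorAlgebra.map_apply_ι, actHom_ι, actLin_apply]
  simp

theorem actHom_pullFst (v : Gr V) :
    actHom g hg (pullFst V (Coord (2 * q)) v) = pullFst V (Coord (2 * q)) v :=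
  DFunLike.congr_fun (actHom_comp_pullFst hg) v

theorem actHom_coordCol (i : Fin 2 × Fin q) :
    actHom g hg (pullSnd V (Coord (2 * q)) (coordCol q i)) = movedChart g (inr i) (inl 1) := by
  rw [coordCol, oddCoord, pullSnd, ExteriorAlgebra.map_apply_ι, actHom_ι, actLin_apply]
  simp [Pi.single_apply]

theorem actHom_relChart (a : Fin 2 ⊕ (Fin 2 × Fin q)) :
    actHom g hg (relChart q V a (inl 1)) = movedChart g a (inl 1) := by
  have hact := map_mem_ptsK (relChart_mem_ptsK (q := q) (V := V)) (isSuperHom_actHom hg)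
  have hmoved := movedChart_mem_ptsK hg
  obtain ⟨hactO, hactfix, hactbody, -⟩ := mem_ptsK_iff.mp hact
  obtain ⟨hmovedO, hmovedfix, hmovedbody, -⟩ := mem_ptsK_iff.mp hmoved
  rcases a with a | i
  · fin_cases a
    · exact (hactfix.1 (inl 1)).trans (hmovedfix.1 (inl 1)).symm
    · refine eq_of_mul_self_eq_of_body_eq_one (hactO.isEvenSMat.1 1 1) (hmovedO.isEvenSMat.1 1 1)
        hactbody hmovedbody ?_
      have hcol := (mul_self_add_sympForm_col_eq_one hact).trans
        (mul_self_add_sympForm_col_eq_one hmoved).symm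
      simp only [Matrix.map_apply (f := actHom g hg), relChart_inr, actHom_coordCol] at hcol
      exact add_right_cancel hcol
  · exact actHom_coordCol hg i

theorem actHom_mul {k : SMat q (Gr V)} (hk : k ∈ ptsK q V) :
    actHom (g * k) (mul_mem_ptsK hg hk) = (actHom k hk).comp (actHom g hg) := by
  refine algHom_ext_pull ?_ (algHom_ext_oddCoord fun i => ?_)
  · rw [AlgHom.comp_assoc, actHom_comp_pullFst, actHom_comp_pullFst, actHom_comp_pullFst]
  · rw [← (idx q).apply_symm_apply i]
    change actHom (g * k) (mul_mem_ptsK hg hk) (pullSnd V _ (coordCol q _)) =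
      actHom k hk (actHom g hg (pullSnd V _ (coordCol q _)))
    rw [actHom_coordCol, actHom_coordCol, movedChart_mul_apply, movedChart_apply, map_sum]
    refine Finset.sum_congr rfl fun l _ => ?_
    rw [map_mul, actHom_relChart, actHom_pullFst]

/-- Invariance of the density `|Dξ| / √(1 - τ)` under a point of `K`. -/
def FixesDensity (g : SMat q (Gr V)) : Prop :=
  ∀ (hg : g ∈ ptsK q V) (a : Gr (V × Coord (2 * q))),
    berezinFibre V (pullSnd V _ (chartRootInv q) * actHom g hg a) =
      berezinFibre V (pullSnd V _ (chartRootInv q) * a)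

theorem FixesDensity.mul {g k : SMat q (Gr V)} (hg : g ∈ ptsK q V) (hk : k ∈ ptsK q V)
    (hgfix : FixesDensity g) (hkfix : FixesDensity k) : FixesDensity (g * k) := by
  intro _ a
  rw [actHom_mul hg hk, AlgHom.comp_apply, hkfix hk, hgfix hg]

end Action

section Elementary

variable {q : ℕ} {V : Type} [AddCommGroup V] [Module ℂ V]

theorem movedChart_elemPt_inr (i : Fin 2 × Fin q) {η : Gr V} (hη : η ∈ parity V 1)
    (l : Fin 2 × Fin q) : movedChart (elemPt i η) (inr l) (inl 1) =
      pullSnd V _ (coordCol q l) + (Pi.single i (pullFst V _ η) : _ → Gr (V × Coord (2 * q))) l *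
        pullSnd V _ (chartRoot q) := by
  rw [movedChart, elemPt_map, elemPt_mul_inr i (isSuperHom_pullFst 1 η hη)
    (mem_ptsK_iff.mp relChart_mem_ptsK).2.1, relChart_inr, relChart_inl]

theorem actHom_elemPt_ι (i : Fin 2 × Fin q) {η : Gr V} (hη : η ∈ parity V 1)
    (v : V × Coord (2 * q)) : actHom (elemPt i η) (elemPt_mem_ptsK i hη) (ι ℂ v) =
      ι ℂ v + fibreDual V (idx q i) v • (pullFst V _ η * pullSnd V _ (chartRoot q)) := by
  have hcoord : ∑ l, v.2 l • pullSnd V _ (coordCol q ((idx q).symm l)) =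
      ι ℂ ((0, v.2) : V × Coord (2 * q)) := by
    have h := congrArg (pullSnd V (Coord (2 * q))) (ι_eq_sum_smul_oddCoord v.2)
    rw [pullSnd, ExteriorAlgebra.map_apply_ι] at h
    simpa [pullSnd, coordCol] using h.symm
  rw [actHom_ι, actLin_apply]
  simp only [movedChart_elemPt_inr i hη, smul_add, Finset.sum_add_distrib, hcoord]
  rw [← add_assoc, ← map_add, Prod.mk_add_mk, add_zero, zero_add]
  congr 1
  rw [Finset.sum_eq_single (idx q i) (fun l _ hl => ?_) (by simp), Equiv.symm_apply_apply,
    Pi.single_eq_same]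
  · rfl
  · rw [Pi.single_eq_of_ne (fun h => hl ((idx q).symm_apply_eq.mp h)), zero_mul, smul_zero]

theorem fixesDensity_elemPt (i : Fin 2 × Fin q) {η : Gr V} (hη : η ∈ parity V 1) :
    FixesDensity (elemPt i η) := by
  intro hg a
  have hflow := algHom_eq_sub_mul_oddDeriv (ψ := actHom _ hg) isSuperHom_id
    (isSuperHom_pullFst 1 η hη) (isSuperHom_pullSnd 0 _ chartRoot_mem)
    (fibreDual V (idx q i)) (actHom_elemPt_ι i hη) a
  simp only [AlgHom.coe_id, id_eq] at hflow
  rw [hflow, mul_sub, ← mul_assoc, ← mul_assoc, ← map_mul, chartRootInv_mul, map_one, one_mul,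
    ← berezinFibreLinear_apply, map_sub, berezinFibreLinear_apply, berezinFibreLinear_apply,
    berezinFibre_mul_pullFst, berezinFibre_oddDeriv, zero_mul, sub_zero]

end Elementary

section Isotropy

variable {q : ℕ} {V : Type} [AddCommGroup V] [Module ℂ V] {m : SMat q (Gr V)}

theorem movedChart_inl_of_mem_ptsM (hm : m ∈ ptsM q V) :
    movedChart m (inl 1) (inl 1) = pullSnd V _ (chartRoot q) := by
  have hfix := (mem_ptsM_iff.mp hm).2.map
    (pullFst V (Coord (2 * q)) : Gr V →+* Gr (V × Coord (2 * q)))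
  exact (hfix.mul_apply_row (relChart q V) (inl 1)).trans relChart_inl

theorem movedChart_inr_of_mem_ptsM (hm : m ∈ ptsM q V) (i : Fin 2 × Fin q) :
    movedChart m (inr i) (inl 1) =
      ∑ k, pullFst V _ (m (inr i) (inr k)) * pullSnd V _ (coordCol q k) := by
  obtain ⟨hK, hfix⟩ := mem_ptsM_iff.mp hm
  rw [movedChart_apply, Fintype.sum_sum_type, Fin.sum_univ_two, hfix.2,
    (mem_ptsK_iff.mp hK).2.1.2]
  simp [stdChart_inr]

theorem inr_inr_mem_of_mem_ptsK {k : SMat q (Gr V)} (hk : k ∈ ptsK q V) (i j : Fin 2 × Fin q) :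
    k (inr i) (inr j) ∈ parity V 0 := (isOSpPt_of_mem_ptsK hk).isEvenSMat.2.2.2 i j

theorem oddDeriv_movedChart_of_mem_ptsM (hm : m ∈ ptsM q V) (i j : Fin 2 × Fin q) :
    oddDeriv (fibreDual V (idx q j)) (movedChart m (inr i) (inl 1)) =
      pullFst V _ (m (inr i) (inr j)) := by
  have hmem : ∀ k, pullFst V (Coord (2 * q)) (m (inr i) (inr k)) ∈ parity (V × Coord (2 * q)) 0 :=
    fun k => isSuperHom_pullFst 0 _ (inr_inr_mem_of_mem_ptsK (mem_ptsM_iff.mp hm).1 i k)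
  simp only [movedChart_inr_of_mem_ptsM hm, map_sum, oddDeriv_mul, oddDeriv_pullFst, zero_mul,
    zero_add, parityAut_of_even (hmem _), oddDeriv_pullSnd, coordDeriv_coordCol]
  simp

theorem sum_oddDeriv_movedChart {y : SMat q (Gr V)} (hm : m ∈ ptsM q V) (hy : y ∈ ptsK q V)
    (hmy : m * y = 1) (l i : Fin 2 × Fin q) :
    ∑ j, pullFst V _ (y (inr j) (inr i)) *
      oddDeriv (fibreDual V (idx q j)) (movedChart m (inr l) (inl 1)) =
        if l = i then 1 else 0 := by
  obtain ⟨hK, hfix⟩ := mem_ptsM_iff.mp hm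
  have hprod := congrFun (congrFun hmy (inr l)) (inr i)
  rw [Matrix.mul_apply, Fintype.sum_sum_type, Fin.sum_univ_two, hfix.2,
    (mem_ptsK_iff.mp hK).2.1.2] at hprod
  simp only [Matrix.one_apply, reduceCtorEq, if_false, zero_mul, zero_add, inr.injEq] at hprod
  simp only [oddDeriv_movedChart_of_mem_ptsM hm]
  rw [← map_one (pullFst V (Coord (2 * q))), ← map_zero (pullFst V (Coord (2 * q))), ← apply_ite,
    ← hprod, map_sum]
  refine Finset.sum_congr rfl fun j _ => ?_
  rw [← map_mul, (commute_of_even (inr_inr_mem_of_mem_ptsK hy j i) _).eq]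

theorem actHom_oddDeriv {y : SMat q (Gr V)} (hm : m ∈ ptsM q V) (hy : y ∈ ptsK q V)
    (hmy : m * y = 1) (i : Fin 2 × Fin q) (a : Gr (V × Coord (2 * q))) :
    actHom m hm.1 (oddDeriv (fibreDual V (idx q i)) a) = ∑ j, pullFst V _ (y (inr j) (inr i)) *
      oddDeriv (fibreDual V (idx q j)) (actHom m hm.1 a) := by
  have heven : ∀ j, pullFst V (Coord (2 * q)) (y (inr j) (inr i)) ∈ parity (V × Coord (2 * q)) 0 :=
    fun j => isSuperHom_pullFst 0 _ (inr_inr_mem_of_mem_ptsK hy j i)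
  induction a using ExteriorAlgebra.induction with
  | algebraMap r =>
    rw [contractLeft_algebraMap, map_zero, AlgHom.commutes]
    exact (Finset.sum_eq_zero fun j _ => by rw [contractLeft_algebraMap, mul_zero]).symm
  | ι v =>
    rw [contractLeft_ι, AlgHom.commutes, actHom_ι, actLin_apply]
    simp only [map_add, map_sum, map_smul, mul_add, Finset.mul_sum, mul_smul_comm,
      Finset.sum_add_distrib]
    rw [Finset.sum_comm]
    simp only [← Finset.smul_sum, sum_oddDeriv_movedChart hm hy hmy, contractLeft_ι,
      Equiv.symm_apply_eq]
    simp [Algebra.algebraMap_eq_smul_one]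
  | mul x z hx hz =>
    rw [oddDeriv_mul, map_add, map_mul, map_mul, hx, hz, map_mul, Finset.sum_mul, Finset.mul_sum,
      ← Finset.sum_add_distrib]
    refine Finset.sum_congr rfl fun j _ => ?_
    rw [oddDeriv_mul, mul_add, (isSuperHom_actHom hm.1).apply_parityAut, mul_assoc,
      ← mul_assoc (parityAut _ (actHom m hm.1 x)), ← (commute_of_even (heven j) _).eq, mul_assoc]
  | add x z hx hz => simp only [map_add, mul_add, Finset.sum_add_distrib, hx, hz]

theorem actHom_chartRoot_of_mem_ptsM (hm : m ∈ ptsM q V) :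
    actHom m hm.1 (pullSnd V _ (chartRoot q)) = pullSnd V _ (chartRoot q) := by
  rw [← relChart_inl, actHom_relChart, movedChart_inl_of_mem_ptsM hm, relChart_inl]

theorem actHom_chartRootInv_of_mem_ptsM (hm : m ∈ ptsM q V) :
    actHom m hm.1 (pullSnd V _ (chartRootInv q)) = pullSnd V _ (chartRootInv q) := by
  refine left_inv_eq_right_inv (a := pullSnd V _ (chartRoot q)) ?_ ?_
  · rw [← actHom_chartRoot_of_mem_ptsM hm, ← map_mul, ← map_mul, chartRootInv_mul, map_one,
      map_one]
  · rw [← map_mul, chartRoot_mul_inv, map_one]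

theorem actHom_coordForm_of_mem_ptsM (hm : m ∈ ptsM q V) :
    actHom m hm.1 (pullSnd V _ (coordForm q)) = pullSnd V _ (coordForm q) := by
  have hform : coordForm q = 1 - chartRoot q * chartRoot q := by
    rw [chartRoot_mul_self, sub_sub_cancel]
  rw [hform, map_sub, map_sub, map_one, map_one, map_mul, map_mul, actHom_chartRoot_of_mem_ptsM hm]

theorem berezinFibre_actHom_oddDeriv [FiniteDimensional ℂ V] (hm : m ∈ ptsM q V) (i : Fin (2 * q))
    (a : Gr (V × Coord (2 * q))) :
    berezinFibre V (actHom m hm.1 (oddDeriv (fibreDual V i) a)) = 0 := by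
  obtain ⟨y, hy, hmy, -⟩ := exists_inv_mem_ptsK hm.1
  obtain ⟨i, rfl⟩ := (idx q).surjective i
  rw [actHom_oddDeriv hm hy hmy, ← berezinFibreLinear_apply, map_sum]
  refine Finset.sum_eq_zero fun j _ => ?_
  rw [(commute_of_even (isSuperHom_pullFst 0 _ (inr_inr_mem_of_mem_ptsK hy j i)) _).eq,
    berezinFibreLinear_apply, berezinFibre_mul_pullFst, berezinFibre_oddDeriv, zero_mul]

theorem exists_berezinFibre_actHom_eq_mul [FiniteDimensional ℂ V] (hm : m ∈ ptsM q V) :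
    ∃ c, ∀ a, berezinFibre V (actHom m hm.1 a) = c * berezinFibre V a := by
  obtain ⟨T, hT⟩ := exists_apply_eq_apply_mul_pullFst_berezinFibre V (2 * q)
  refine ⟨berezinFibre V (actHom m hm.1 T), fun a => ?_⟩
  have h := hT (berezinFibreLinear V (2 * q) ∘ₗ (actHom m hm.1).toLinearMap)
    (fun i a => (berezinFibreLinear_apply _).trans (berezinFibre_actHom_oddDeriv hm i a)) a
  simp only [LinearMap.comp_apply, AlgHom.toLinearMap_apply, berezinFibreLinear_apply] at h
  rw [h, map_mul, actHom_pullFst, berezinFibre_mul_pullFst]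

/-- The constant by which the fibre integral is multiplied is found by integrating `τ ^ q`. -/
theorem berezinFibre_actHom_of_mem_ptsM [FiniteDimensional ℂ V] (hm : m ∈ ptsM q V)
    (a : Gr (V × Coord (2 * q))) : berezinFibre V (actHom m hm.1 a) = berezinFibre V a := by
  obtain ⟨c, hc⟩ := exists_berezinFibre_actHom_eq_mul hm
  have htop := hc (pullSnd V _ (coordForm q ^ q))
  rw [map_pow, map_pow, actHom_coordForm_of_mem_ptsM hm, ← map_pow, berezinFibre_pullSnd,
    ← Algebra.commutes, ← Algebra.smul_def, Algebra.algebraMap_eq_smul_one] at htop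
  rw [hc, ← smul_right_injective _ (berezin_coordForm_pow_ne_zero q) htop, one_mul]

theorem fixesDensity_of_mem_ptsM [FiniteDimensional ℂ V] (hm : m ∈ ptsM q V) :
    FixesDensity m := fun _ a => by
  rw [← berezinFibre_actHom_of_mem_ptsM hm (_ * a), map_mul, actHom_chartRootInv_of_mem_ptsM hm]

theorem fixesDensity [FiniteDimensional ℂ V] {g : SMat q (Gr V)} (hg : g ∈ ptsK q V) :
    FixesDensity g :=
  ptsK_induction (P := FixesDensity) (fun _ hm => fixesDensity_of_mem_ptsM hm)
    (fun i _ hη _ hk h => (fixesDensity_elemPt i hη).mul (elemPt_mem_ptsK i hη) hk h) hg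

end Isotropy

section StdDensity

variable {q : ℕ}

/-- The invariant density `|Dξ| / √(1 - τ)` in the standard chart. -/
def stdDensity (q : ℕ) : BerDensity q := ⟨stdChart q, isChart_stdChart, chartRootInv q⟩

theorem chartRootInv_ne_zero : chartRootInv q ≠ 0 :=
  right_ne_zero_of_mul_eq_one chartRoot_mul_inv

theorem isInvariant_stdDensity : (stdDensity q).IsInvariant := by
  intro V _ _ _ g hg y _ m hm hmove f
  replace hmove : movedChart g = (stdChart q).map y * m := hmove
  have hy : y = (actHom g hg).comp (pullSnd V (Coord (2 * q))) := algHom_ext_oddCoord fun i => by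
    have hentry : movedChart g (inr ((idx q).symm i)) (inl 1) = y (oddCoord i) := by
      rw [hmove, (mem_ptsM_iff.mp hm).2.mul_apply_col, Matrix.map_apply,
        stdChart_inr, coordCol, Equiv.apply_symm_apply]
    rw [← hentry, ← actHom_coordCol hg, coordCol, Equiv.apply_symm_apply, AlgHom.comp_apply]
  change berezinFibre V (pullSnd V _ (chartRootInv q) * y f) =
    algebraMap ℂ _ (berezin (chartRootInv q * f))
  rw [hy, AlgHom.comp_apply, fixesDensity hg hg, ← map_mul, berezinFibre_pullSnd]

end StdDensity

/-! ### Moments of the invariant density -/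

theorem berezin_oddDeriv {n : ℕ} (i : Fin n) (a : Gr (Coord n)) :
    berezin (oddDeriv (coordDual i) a) = 0 := by
  rw [berezin, oddDerivs_eq_oddDerivList,
    oddDerivList_oddDeriv_of_mem _ (List.mem_finRange i), map_zero]

section Euler

variable {q : ℕ}

/-- The Euler operator `∑ ξᵢ ∂ᵢ` on superfunctions of the odd coordinates. -/
def euler (q : ℕ) : Gr (Coord (2 * q)) →ₗ[ℂ] Gr (Coord (2 * q)) :=
  ∑ i, LinearMap.mulLeft ℂ (coordCol q i) ∘ₗ coordDeriv i

theorem euler_apply (a : Gr (Coord (2 * q))) : euler q a = ∑ i, coordCol q i * coordDeriv i a := by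
  simp [euler]

theorem berezin_euler (a : Gr (Coord (2 * q))) : berezin (euler q a) = 2 * q * berezin a := by
  have hcoord : ∀ i, coordCol q i * coordDeriv i a = a - coordDeriv i (coordCol q i * a) :=
    fun i => by
      rw [oddDeriv_mul, coordDeriv_coordCol, if_pos rfl, one_mul, parityAut_of_odd (coordCol_mem i)]
      noncomm_ring
  have hderiv : ∀ i, berezinLinear (2 * q) (coordDeriv i (coordCol q i * a)) = 0 :=
    fun i => (berezinLinear_apply _).trans (berezin_oddDeriv _ _)
  rw [euler_apply, ← berezinLinear_apply, map_sum]
  simp only [hcoord, map_sub, hderiv, sub_zero, berezinLinear_apply, Finset.sum_const,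
    Finset.card_univ, Fintype.card_prod, Fintype.card_fin, nsmul_eq_mul]
  push_cast
  rfl

theorem euler_mul (a b : Gr (Coord (2 * q))) : euler q (a * b) = euler q a * b + a * euler q b := by
  simp only [euler_apply, Finset.sum_mul, Finset.mul_sum, ← Finset.sum_add_distrib]
  refine Finset.sum_congr rfl fun i _ => ?_
  rw [oddDeriv_mul, mul_add, ← mul_assoc, ← mul_assoc (coordCol q i) (parityAut _ a),
    odd_mul_eq_parityAut_mul (coordCol_mem i) (parityAut _ a), parityAut_parityAut, mul_assoc a]

theorem euler_one : euler q 1 = 0 := by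
  rw [euler_apply]
  refine Finset.sum_eq_zero fun i _ => ?_
  rw [← map_one (algebraMap ℂ _), contractLeft_algebraMap, mul_zero]

theorem euler_coordCol (i : Fin 2 × Fin q) : euler q (coordCol q i) = coordCol q i := by
  rw [euler_apply]
  simp only [coordDeriv_coordCol]
  simp

theorem euler_coordForm : euler q (coordForm q) = (2 : ℂ) • coordForm q := by
  rw [coordForm_eq_two_smul_sum, map_smul, map_sum]
  congr 1
  rw [Finset.smul_sum]
  refine Finset.sum_congr rfl fun j _ => ?_
  rw [planeForm, euler_mul, euler_coordCol, euler_coordCol, two_smul]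

theorem euler_chartRoot : euler q (chartRoot q) = chartRoot q - chartRootInv q := by
  have hsq : (2 : ℂ) • (chartRoot q * euler q (chartRoot q)) = (2 : ℂ) • -coordForm q := by
    rw [smul_neg, ← euler_coordForm, ← zero_sub, ← euler_one, ← map_sub, ← chartRoot_mul_self,
      euler_mul, ← (commute_of_even chartRoot_mem (euler q (chartRoot q))).eq, two_smul]
  have hroot : chartRoot q * euler q (chartRoot q) = chartRoot q * chartRoot q - 1 := by
    rw [smul_right_injective _ two_ne_zero hsq, chartRoot_mul_self]
    abel
  calc euler q (chartRoot q)
      = chartRootInv q * (chartRoot q * euler q (chartRoot q)) := by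
        rw [← mul_assoc, chartRootInv_mul, one_mul]
    _ = chartRoot q - chartRootInv q := by
        rw [hroot, mul_sub, ← mul_assoc, chartRootInv_mul, one_mul, mul_one]

theorem chartRoot_sub_one_mem : chartRoot q - 1 ∈ parity (Coord (2 * q)) 0 :=
  sub_mem chartRoot_mem one_mem_parity_zero

theorem euler_sub_one_pow (j : ℕ) : euler q ((chartRoot q - 1) ^ j) =
    (j : ℂ) • (chartRootInv q * (chartRoot q - 1) ^ (j + 1) +
      (2 : ℂ) • (chartRootInv q * (chartRoot q - 1) ^ j)) := by
  induction j with
  | zero => rw [pow_zero, euler_one, Nat.cast_zero, zero_smul]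
  | succ j ih =>
    have hfactor : chartRoot q - chartRootInv q =
        chartRootInv q * ((chartRoot q - 1) ^ 2 + (2 : ℂ) • (chartRoot q - 1)) := by
      have hexpand : (chartRoot q - 1) ^ 2 + (2 : ℂ) • (chartRoot q - 1) =
          chartRoot q * chartRoot q - 1 := by
        rw [two_smul]
        noncomm_ring
      rw [hexpand, mul_sub, ← mul_assoc, chartRootInv_mul, one_mul, mul_one]
    have hcomm := (commute_of_even (even_pow (chartRoot_sub_one_mem (q := q)) j)
      (chartRootInv q)).eq
    rw [pow_succ, euler_mul, ih, map_sub, euler_one, sub_zero, euler_chartRoot, hfactor,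
      ← mul_assoc, hcomm, mul_assoc, mul_add, mul_smul_comm, ← pow_add, ← pow_succ,
      smul_mul_assoc, add_mul, smul_mul_assoc, mul_assoc, mul_assoc, ← pow_succ, ← pow_succ,
      mul_add, mul_smul_comm, Nat.cast_succ]
    module

end Euler

section Moments

variable {q : ℕ}

/-- The `j`-th moment of `√(1 - τ) - 1` with respect to the invariant density. -/
def moment (q j : ℕ) : ℂ := berezin (chartRootInv q * (chartRoot q - 1) ^ j)

theorem berezin_sub_one_pow (j : ℕ) :
    berezin ((chartRoot q - 1) ^ j) = moment q (j + 1) + moment q j := by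
  have hsplit : (chartRoot q - 1) ^ j =
      chartRootInv q * (chartRoot q - 1) ^ (j + 1) + chartRootInv q * (chartRoot q - 1) ^ j := by
    rw [pow_succ', ← mul_add, ← add_one_mul, sub_add_cancel, ← mul_assoc, chartRootInv_mul, one_mul]
  have hberezin := congrArg (berezinLinear (2 * q)) hsplit
  rwa [map_add, berezinLinear_apply, berezinLinear_apply, berezinLinear_apply] at hberezin

/-- Integrating the Euler operator applied to `(√(1 - τ) - 1) ^ j` in two ways. -/
theorem moment_succ (j : ℕ) :
    (2 * q - j : ℂ) * moment q (j + 1) = -2 * (q - j : ℂ) * moment q j := by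
  have hdegree := berezin_euler (q := q) ((chartRoot q - 1) ^ j)
  rw [euler_sub_one_pow, ← berezinLinear_apply, map_smul, map_add, map_smul, berezinLinear_apply,
    berezinLinear_apply, berezin_sub_one_pow, smul_eq_mul, smul_eq_mul] at hdegree
  change (j : ℂ) * (moment q (j + 1) + 2 * moment q j) = _ at hdegree
  linear_combination -hdegree

theorem exists_chartRoot_sub_one_eq (q : ℕ) : ∃ d ∈ parity (Coord (2 * q)) 0, body d ≠ 0 ∧
    chartRoot q - 1 = coordForm q * d := by
  obtain ⟨c, hc, hbc⟩ := exists_one_add_chartRoot_inv q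
  refine ⟨-c, neg_mem hc, ?_, ?_⟩
  · have hbody := congrArg body hbc
    rw [map_mul, map_one] at hbody
    rw [map_neg]
    exact neg_ne_zero.mpr (right_ne_zero_of_mul_eq_one hbody)
  · have hfactor : coordForm q = -((chartRoot q - 1) * (1 + chartRoot q)) := by
      rw [← sub_sub_cancel 1 (coordForm q), ← chartRoot_mul_self]
      noncomm_ring
    rw [hfactor, neg_mul_neg, mul_assoc, hbc, mul_one]

theorem chartRoot_sub_one_pow_succ : (chartRoot q - 1) ^ (q + 1) = 0 := by
  obtain ⟨d, -, -, h⟩ := exists_chartRoot_sub_one_eq q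
  rw [h, (commute_of_even coordForm_mem d).mul_pow, coordForm_pow_succ, zero_mul]

theorem moment_self_ne_zero (q : ℕ) : moment q q ≠ 0 := by
  obtain ⟨d, -, hd, h⟩ := exists_chartRoot_sub_one_eq q
  have hbody : body (chartRootInv q) ≠ 0 := by
    have hmul := congrArg body (chartRoot_mul_inv (q := q))
    rw [map_mul, map_one] at hmul
    exact right_ne_zero_of_mul_eq_one hmul
  rw [moment, h, (commute_of_even coordForm_mem d).mul_pow, coordForm_pow_mul, mul_smul_comm,
    (commute_of_even chartRootInv_mem _).eq, coordForm_pow_mul, ← berezinLinear_apply, map_smul,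
    map_smul, berezinLinear_apply, map_pow]
  exact mul_ne_zero (pow_ne_zero _ hd) (mul_ne_zero hbody (berezin_coordForm_pow_ne_zero q))

theorem moment_eq_of_moment_zero_eq {c : ℂ} (h : moment q 0 = c * ((2 * q).choose q : ℂ)) {j : ℕ}
    (hj : j ≤ q) : moment q j = c * ((-2) ^ j * ((2 * q - j).choose q : ℂ)) := by
  induction j with
  | zero => simpa using h
  | succ j ih =>
    have hrec := moment_succ (q := q) j
    rw [ih (Nat.le_of_succ_le hj)] at hrec
    obtain ⟨n, hn⟩ : ∃ n, 2 * q = n + 1 + j := ⟨2 * q - (j + 1), by omega⟩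
    have hcast : (2 * q : ℂ) = n + 1 + j := by exact_mod_cast hn
    have hchoose : (n.choose q : ℂ) * (n + 1) = (n + 1).choose q * (n + 1 - q) := by
      have hnat := congrArg (Nat.cast (R := ℂ)) (Nat.choose_mul_succ_eq n q)
      push_cast [Nat.cast_sub (show q ≤ n + 1 by omega)] at hnat
      exact hnat
    have hne : (n + 1 : ℂ) ≠ 0 := Nat.cast_add_one_ne_zero n
    rw [hn, Nat.add_sub_cancel, hcast] at hrec
    rw [show 2 * q - (j + 1) = n by omega]
    refine mul_left_cancel₀ hne ?_
    linear_combination hrec + 2 * c * (-2) ^ j * hchoose -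
      2 * c * (-2) ^ j * (n + 1).choose q * hcast

theorem exists_moment_eq (q : ℕ) : ∃ c : ℂ, c ≠ 0 ∧ ∀ j ≤ q,
    moment q j = c * ((-2) ^ j * ((2 * q - j).choose q : ℂ)) := by
  have hchoose : ((2 * q).choose q : ℂ) ≠ 0 :=
    Nat.cast_ne_zero.mpr (Nat.choose_pos (by omega)).ne'
  have hmoment : ∀ j ≤ q, moment q j =
      moment q 0 / (2 * q).choose q * ((-2) ^ j * ((2 * q - j).choose q : ℂ)) :=
    fun j => moment_eq_of_moment_zero_eq (div_mul_cancel₀ _ hchoose).symm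
  refine ⟨_, fun hzero => moment_self_ne_zero q ?_, hmoment⟩
  rw [hmoment q le_rfl, hzero, zero_mul]

end Moments

/-! ### Uniqueness of the invariant density -/

section Uniqueness

variable {q : ℕ} {φ : Gr (Coord (2 * q)) →ₐ[ℂ] Gr (Coord (2 * q))}

theorem IsChart.surjective_of_eq_map_mul {s s' m : SMat q (Gr (Coord (2 * q)))} (hs : IsChart q s)
    (hs' : IsChart q s') (hφ : IsSuperHom φ) (hm : m ∈ ptsM q (Coord (2 * q)))
    (h : s = s'.map φ * m) : Function.Surjective φ := by
  obtain ⟨ψ, ⟨hψ, m', hm', h'⟩, -⟩ := hs.2 _ _ hs'.1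
  have hcomp : s = s.map (φ.comp ψ) * (m'.map φ * m) := by
    conv_lhs => rw [h, h', Matrix.map_mul, mul_assoc]
    rfl
  have hid : s = s.map (AlgHom.id ℂ (Gr (Coord (2 * q)))) * 1 := by
    rw [mul_one]
    rfl
  have hφψ : φ.comp ψ = AlgHom.id ℂ _ := (hs.2 _ s hs.1).unique
    ⟨hφ.comp hψ, _, mul_mem_ptsM (map_mem_ptsM hm' hφ) hm, hcomp⟩
    ⟨isSuperHom_id, 1, one_mem_ptsM, hid⟩
  exact fun a => ⟨ψ a, DFunLike.congr_fun hφψ a⟩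

theorem IsChart.exists_surjective {s : SMat q (Gr (Coord (2 * q)))} (hs : IsChart q s) :
    ∃ φ : Gr (Coord (2 * q)) →ₐ[ℂ] Gr (Coord (2 * q)), IsSuperHom φ ∧ Function.Surjective φ ∧
      ∀ a, s a (inl 1) = φ (stdChart q a (inl 1)) := by
  obtain ⟨φ, ⟨hφ, m, hm, hsm⟩, -⟩ := isChart_stdChart.2 _ s hs.1
  refine ⟨φ, hφ, hs.surjective_of_eq_map_mul isChart_stdChart hφ hm hsm, fun a => ?_⟩
  conv_lhs => rw [hsm, (mem_ptsM_iff.mp hm).2.mul_apply_col]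
  rfl

theorem oddCoord_ne_zero {n : ℕ} (i : Fin n) : oddCoord i ≠ 0 := by
  rw [oddCoord, Ne, ExteriorAlgebra.ι_eq_zero_iff, Pi.single_eq_zero_iff]
  exact one_ne_zero

theorem apply_ι_of_elemPt_mul_eq {s : SMat q (Gr (Coord (2 * q)))}
    (hsK : s ∈ ptsK q (Coord (2 * q))) (hs : ∀ a, s a (inl 1) = φ (stdChart q a (inl 1)))
    {V : Type} [AddCommGroup V] [Module ℂ V] (i : Fin 2 × Fin q) {η : Gr V} (hη : η ∈ parity V 1)
    {y : Gr (Coord (2 * q)) →ₐ[ℂ] Gr (V × Coord (2 * q))} {m : SMat q (Gr (V × Coord (2 * q)))}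
    (hm : m ∈ ptsM q (V × Coord (2 * q)))
    (h : (elemPt i η).map (pullFst V (Coord (2 * q))) * s.map (pullSnd V (Coord (2 * q))) =
      s.map y * m) (v : Coord (2 * q)) :
    y (φ (ι ℂ v)) = pullSnd V _ (φ (ι ℂ v)) +
      coordDual (idx q i) v • (pullFst V _ η * pullSnd V _ (φ (chartRoot q))) := by
  have hcoord : ∀ l, y (φ (oddCoord l)) = pullSnd V _ (φ (oddCoord l)) +
      (Pi.single i (pullFst V _ η) : _ → Gr (V × Coord (2 * q))) ((idx q).symm l) *
        pullSnd V _ (φ (chartRoot q)) := fun l => by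
    have hentry := congrFun (congrFun h (inr ((idx q).symm l))) (inl 1)
    rw [(mem_ptsM_iff.mp hm).2.mul_apply_col, elemPt_map,
      elemPt_mul_inr i (isSuperHom_pullFst 1 η hη)
        (mem_ptsK_iff.mp (map_mem_ptsK hsK isSuperHom_pullSnd)).2.1] at hentry
    simp only [Matrix.map_apply, hs, stdChart_inr, stdChart_inl, coordCol,
      Equiv.apply_symm_apply] at hentry
    exact hentry.symm
  rw [ι_eq_sum_smul_oddCoord]
  simp only [map_sum, map_smul, hcoord, smul_add, Finset.sum_add_distrib]
  congr 1
  rw [Finset.sum_eq_single (idx q i) (fun l _ hl => ?_) (by simp), Equiv.symm_apply_apply,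
    Pi.single_eq_same]
  · rfl
  · rw [Pi.single_eq_of_ne (fun h => hl ((idx q).symm_apply_eq.mp h)), zero_mul, smul_zero]

namespace BerDensity.IsInvariant

variable {ω : BerDensity q} (hω : ω.IsInvariant)
include hω

/-- The infinitesimal form of invariance, tested on `elemPt i η` with `η` the coordinate of a
superpoint of dimension `0|1`. -/
theorem berezin_mul_chartRoot_mul_coordDeriv (hφ : IsSuperHom φ)
    (hs : ∀ a, ω.chart a (inl 1) = φ (stdChart q a (inl 1))) (i : Fin 2 × Fin q)
    (a : Gr (Coord (2 * q))) : berezin (ω.coeff * φ (chartRoot q * coordDeriv i a)) = 0 := by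
  set η : Gr (Coord 1) := oddCoord 0
  have hη : η ∈ parity (Coord 1) 1 := oddCoord_mem 0
  have hg := elemPt_mem_ptsK i hη
  obtain ⟨y, ⟨hy, m, hm, hmove⟩, -⟩ := ω.isChart.2 (Coord 1 × Coord (2 * q)) _
    (mul_mem_ptsK (map_mem_ptsK hg isSuperHom_pullFst)
      (map_mem_ptsK ω.isChart.1 isSuperHom_pullSnd))
  have hflow : y (φ (parityAut _ a)) = pullSnd (Coord 1) _ (φ (parityAut _ a)) -
      pullSnd (Coord 1) _ (φ (chartRoot q * coordDeriv i (parityAut _ (parityAut _ a)))) *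
        pullFst (Coord 1) _ η :=
    algHom_eq_sub_mul_oddDeriv (φ := (pullSnd (Coord 1) (Coord (2 * q))).comp φ) (ψ := y.comp φ)
      (isSuperHom_pullSnd.comp hφ) (isSuperHom_pullFst 1 η hη) chartRoot_mem
      (coordDual (idx q i)) (apply_ι_of_elemPt_mul_eq ω.isChart.1 hs i hη hm hmove) _
  have hinv := hω (Coord 1) _ hg y hy m hm hmove (φ (parityAut _ a))
  rw [hflow, parityAut_parityAut, mul_sub, ← mul_assoc, ← map_mul, ← map_mul,
    ← berezinFibreLinear_apply, map_sub, berezinFibreLinear_apply, berezinFibreLinear_apply,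
    berezinFibre_mul_pullFst, berezinFibre_pullSnd, berezinFibre_pullSnd, sub_eq_self,
    ← Algebra.smul_def] at hinv
  exact (smul_eq_zero.mp hinv).resolve_right (oddCoord_ne_zero 0)

theorem exists_berezin_mul_eq (hφ : IsSuperHom φ)
    (hs : ∀ a, ω.chart a (inl 1) = φ (stdChart q a (inl 1))) :
    ∃ c : ℂ, ∀ a, berezin (ω.coeff * φ a) = c * berezin (chartRootInv q * a) := by
  obtain ⟨c, hc⟩ := exists_eq_mul_berezin
    (berezinLinear (2 * q) ∘ₗ LinearMap.mulLeft ℂ (ω.coeff * φ (chartRoot q)) ∘ₗ φ.toLinearMap)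
    fun i a => by
      have hderiv := hω.berezin_mul_chartRoot_mul_coordDeriv hφ hs ((idx q).symm i) a
      rw [coordDeriv, Equiv.apply_symm_apply, map_mul, ← mul_assoc] at hderiv
      exact (berezinLinear_apply _).trans hderiv
  refine ⟨c, fun a => ?_⟩
  have ha : berezin (ω.coeff * φ (chartRoot q) * φ (chartRootInv q * a)) = _ :=
    (berezinLinear_apply _).symm.trans (hc _)
  rwa [mul_assoc, ← map_mul, ← mul_assoc, chartRoot_mul_inv, one_mul] at ha

theorem exists_berezin_mul_eq_of_coeff_ne_zero (hne : ω.coeff ≠ 0) (hφ : IsSuperHom φ)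
    (hsurj : Function.Surjective φ) (hs : ∀ a, ω.chart a (inl 1) = φ (stdChart q a (inl 1))) :
    ∃ c : ℂ, c ≠ 0 ∧ ∀ a, berezin (ω.coeff * φ a) = c * berezin (chartRootInv q * a) := by
  obtain ⟨c, hc⟩ := hω.exists_berezin_mul_eq hφ hs
  refine ⟨c, fun hzero => ?_, hc⟩
  obtain ⟨b, hb⟩ := exists_berezin_mul_ne_zero hne
  obtain ⟨a, rfl⟩ := hsurj b
  rw [hc, hzero, zero_mul] at hb
  exact hb rfl

end BerDensity.IsInvariant

end Uniqueness

/-! ### The spherical superfunction -/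

section Spherical

variable {q : ℕ}

theorem grExp_smul_iwasawaH_expA_mul {V : Type} [AddCommGroup V] [Module ℂ V]
    [FiniteDimensional ℂ V] {k : SMat q (Gr V)} (hk : k ∈ ptsK q V) {n : ℕ}
    (hn : (k (inl 1) (inl 1) - 1) ^ n = 0) (μ : ℂ) (t : ℝ) :
    grExp (μ • iwasawaH q (expA q (algebraMap ℂ (Gr V) t) * k)) =
      Complex.exp (μ * t) • ∑ j ∈ Finset.range n, (Ring.choose μ j *
        ((1 - Complex.exp (-2 * t)) / 2) ^ j) • (k (inl 1) (inl 1) - 1) ^ j := by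
  obtain ⟨ha, hexp⟩ := iwasawaH_spec (expA_mul_mem_ptsG hk t)
  have hbody := body_iwasawaH_expA_mul hk t
  have hgrExp : grExp (iwasawaH q (expA q (algebraMap ℂ (Gr V) t) * k)) =
      Complex.exp (body (iwasawaH q (expA q (algebraMap ℂ (Gr V) t) * k))) •
        (1 + ((1 - Complex.exp (-2 * t)) / 2) • (k (inl 1) (inl 1) - 1)) := by
    rw [hexp, hbody, expA_mul_mulVec_weightVec hk]
  rw [grExp_smul_eq_sum_ringChoose ha.1 hgrExp (by rw [smul_pow, hn, smul_zero]), hbody]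
  simp only [smul_pow, smul_smul]

theorem sphericalAt_eq_sum_moment {ω : BerDensity q} (hω : ω.IsInvariant) (hne : ω.coeff ≠ 0) :
    ∃ c : ℂ, c ≠ 0 ∧ ∀ (lam : ℂ) (t : ℝ), sphericalAt ω lam t =
      c * (Complex.exp ((lam - (rho q : ℂ)) * t) * ∑ j ∈ Finset.range (q + 1),
        Ring.choose (lam - (rho q : ℂ)) j *
          (((1 - Complex.exp (-2 * t)) / 2) ^ j * moment q j)) := by
  obtain ⟨φ, hφ, hsurj, hs⟩ := ω.isChart.exists_surjective
  obtain ⟨c, hc, hberezin⟩ := hω.exists_berezin_mul_eq_of_coeff_ne_zero hne hφ hsurj hs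
  refine ⟨c, hc, fun lam t => ?_⟩
  have hroot : ω.chart.map (pullSnd (Coord 0) (Coord (2 * q))) (inl 1) (inl 1) - 1 =
      pullSnd (Coord 0) (Coord (2 * q)) (φ (chartRoot q - 1)) := by
    rw [Matrix.map_apply, hs, stdChart_inl, map_sub, map_sub, map_one, map_one]
  have hnil : (ω.chart.map (pullSnd (Coord 0) (Coord (2 * q))) (inl 1) (inl 1) - 1) ^ (q + 1) =
      0 := by
    rw [hroot, ← map_pow, ← map_pow, chartRoot_sub_one_pow_succ, map_zero, map_zero]
  rw [sphericalAt, sphericalFn, map_expA isSuperHom_pullFst (algebraMap_mem_parity_zero _),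
    AlgHom.commutes, grExp_smul_iwasawaH_expA_mul
      (map_mem_ptsK ω.isChart.1 isSuperHom_pullSnd) hnil, hroot, ← berezinFibreLinear_apply]
  simp only [mul_smul_comm, Finset.mul_sum, map_smul, map_sum, Finset.smul_sum, ← map_pow,
    ← map_mul, berezinFibreLinear_apply, berezinFibre_pullSnd, body_algebraMap, hberezin,
    smul_eq_mul, moment]
  refine Finset.sum_congr rfl fun j _ => ?_
  ring

end Spherical

/-! ### The root multiplicity -/

section Root

variable {q : ℕ}

/-- The root space, parametrised by the odd part of the first row. -/
def rootMap (q : ℕ) : (Fin 2 × Fin q → ℂ) →ₗ[ℂ] SMat q ℂ where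
  toFun w := rootMat w (symp w)
  map_add' v w := by
    ext i j
    revert i j
    simp [Sum.forall, Fin.forall_fin_two, rootMat, symp_add, -neg_add_rev, neg_add]
  map_smul' c w := by
    have hsymp : symp (c • w) = c • symp w := by
      ext ⟨a, j⟩
      fin_cases a <;> simp
    ext i j
    revert i j
    simp [Sum.forall, Fin.forall_fin_two, rootMat, hsymp]

theorem rootMap_injective : Function.Injective (rootMap q) := fun v w h => by
  ext j
  simpa [rootMap, rootMat] using congrFun (congrFun h (inl 0)) (inr j)

theorem eq_symp_of_isOsp_rootMat {w u : Fin 2 × Fin q → ℂ} (h : IsOsp (rootMat w u)) :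
    u = symp w := by
  have hsymp : symp u = -w := by
    ext i
    have hentry := congrFun (congrFun h (inr i)) (inl 0)
    have hleft : (superTranspose (rootMat w u) * formJ q ℂ) (inr i) (inl 0) = w i := by
      simp [Matrix.mul_apply, superTranspose_inr_inl, superTranspose_inr_inr, formJ, rootMat]
    have hright : (formJ q ℂ * rootMat w u) (inr i) (inl 0) = symp u i :=
      formJ_mulVec_inr (fun k => rootMat w u k (inl 0)) i
    rw [Matrix.add_apply, hleft, hright] at hentry
    exact eq_neg_of_add_eq_zero_right hentry
  rw [← neg_neg w, ← hsymp, symp_neg, symp_symp, neg_neg]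

theorem rootSpace_eq_range : rootSpace q = LinearMap.range (rootMap q) := by
  ext x
  constructor
  · rintro ⟨hosp, hroot⟩
    have hx := eq_rootMat hroot
    rw [hx] at hosp
    exact ⟨_, (congrArg (rootMat _) (eq_symp_of_isOsp_rootMat hosp)).symm.trans hx.symm⟩
  · rintro ⟨w, rfl⟩
    exact ⟨isOsp_rootMat_symp w, commutator_rootMat _ _⟩

theorem rootSpace_inf_evenMat : rootSpace q ⊓ evenMat q = ⊥ := by
  rw [rootSpace_eq_range, eq_bot_iff]
  rintro _ ⟨⟨w, rfl⟩, heven, -⟩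
  have hw : w = 0 := funext fun j => by simpa [rootMap, rootMat] using heven 0 j
  rw [hw, map_zero]
  exact zero_mem _

theorem rootSpace_le_oddMat : rootSpace q ≤ oddMat q := by
  rw [rootSpace_eq_range]
  rintro _ ⟨w, rfl⟩
  exact ⟨fun _ _ => by simp [rootMap, rootMat], fun _ _ => by simp [rootMap, rootMat]⟩

theorem rho_eq (q : ℕ) : rho q = -(q : ℝ) := by
  rw [rho, rootMult, rootSpace_inf_evenMat, inf_eq_left.mpr rootSpace_le_oddMat, finrank_bot,
    rootSpace_eq_range, LinearMap.finrank_range_of_inj rootMap_injective,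
    Module.finrank_fintype_fun_eq_card, Fintype.card_prod, Fintype.card_fin, Fintype.card_fin]
  push_cast
  ring

end Root

/-! ### The expansion of the spherical superfunction and its limit -/

section Expansion

open Finset Filter Topology

variable {q : ℕ} {ω : BerDensity q}

theorem sphericalAt_eq_sum_exp_pow (hω : ω.IsInvariant) (hne : ω.coeff ≠ 0) :
    ∃ c : ℂ, c ≠ 0 ∧ ∀ (lam : ℂ) (t : ℝ), sphericalAt ω lam t =
      c * (Complex.exp ((lam + q) * t) * ∑ k ∈ range (q + 1),
        Ring.choose (lam + q) k * Ring.choose (-lam + q) (q - k) * Complex.exp (-2 * t) ^ k) := by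
  obtain ⟨c, hc, hspherical⟩ := sphericalAt_eq_sum_moment hω hne
  obtain ⟨c', hc', hmoment⟩ := exists_moment_eq q
  refine ⟨c * c', mul_ne_zero hc hc', fun lam t => ?_⟩
  have hlam : lam - (rho q : ℂ) = lam + q := by
    rw [rho_eq]
    push_cast
    ring
  have hneg : -lam + q = 2 * q - (lam + q) := by ring
  have hexp : Complex.exp (-2 * t) - 1 = (1 - Complex.exp (-2 * t)) / 2 * -2 := by ring
  rw [hspherical, hlam, hneg, ← sum_ringChoose_mul_sub_one_pow]
  simp only [mul_sum]
  refine sum_congr rfl fun j hj => ?_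
  rw [hmoment j (Nat.lt_succ_iff.mp (mem_range.mp hj)), hexp, mul_pow]
  ring

theorem exp_mul_sum_mul_exp_pow (lam : ℂ) (t : ℝ) (n : ℕ) (f : ℕ → ℂ) :
    Complex.exp ((lam + q) * t) * ∑ k ∈ range n, f k * Complex.exp (-2 * t) ^ k =
      Complex.exp (lam * t) * ∑ k ∈ range n, f k * Complex.exp ((q - 2 * k) * t) := by
  have hexp : ∀ k : ℕ, Complex.exp ((lam + q) * t) * Complex.exp (-2 * t) ^ k =
      Complex.exp (lam * t) * Complex.exp ((q - 2 * k) * t) := fun k => by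
    rw [← Complex.exp_nat_mul, ← Complex.exp_add, ← Complex.exp_add]
    ring_nf
  simp only [mul_sum]
  refine sum_congr rfl fun k _ => ?_
  rw [mul_left_comm, hexp, mul_left_comm]

theorem tendsto_exp_neg_two_mul :
    Tendsto (fun t : ℝ => Complex.exp (-2 * t)) atTop (𝓝 0) := by
  rw [Complex.tendsto_exp_nhds_zero_iff]
  simpa using tendsto_id.const_mul_atTop_of_neg (show (-2 : ℝ) < 0 by norm_num)

theorem tendsto_sum_mul_exp_pow (n : ℕ) (f : ℕ → ℂ) :
    Tendsto (fun t : ℝ => ∑ k ∈ range (n + 1), f k * Complex.exp (-2 * t) ^ k) atTop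
      (𝓝 (f 0)) := by
  have hcont : Continuous fun x : ℂ => ∑ k ∈ range (n + 1), f k * x ^ k := by fun_prop
  have hzero : ∑ k ∈ range (n + 1), f k * (0 : ℂ) ^ k = f 0 := by simp [sum_range_succ']
  rw [← hzero]
  exact (hcont.tendsto 0).comp tendsto_exp_neg_two_mul

end Expansion

end OrthoSymplectic

end

theorem mainTheorem6 (q : ℕ) :
    OrthoSymplectic.rho q = -(q : ℝ) ∧
    (∃ ω : OrthoSymplectic.BerDensity q, ω.coeff ≠ 0 ∧ ω.IsInvariant) ∧
    ∀ ω : OrthoSymplectic.BerDensity q, ω.coeff ≠ 0 → ω.IsInvariant →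
      (∃ c₁ : ℂ, c₁ ≠ 0 ∧ ∀ (lam : ℂ) (t : ℝ),
        OrthoSymplectic.sphericalAt ω lam t =
          c₁ * Complex.exp (lam * t) *
            ∑ k ∈ Finset.range (q + 1),
              Ring.choose (lam - (OrthoSymplectic.rho q : ℂ)) k *
                Ring.choose (-lam - (OrthoSymplectic.rho q : ℂ)) (q - k) *
                Complex.exp ((-(OrthoSymplectic.rho q : ℂ) - 2 * (k : ℂ)) * t)) ∧
      (∃ c₀ : ℂ, c₀ ≠ 0 ∧ ∀ lam : ℂ, 0 < lam.re →
        Filter.Tendsto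
          (fun t : ℝ => Complex.exp (-((lam - (OrthoSymplectic.rho q : ℂ)) * t)) *
            OrthoSymplectic.sphericalAt ω lam t)
          Filter.atTop
          (nhds (c₀ * (Complex.Gamma lam /
            Complex.Gamma (lam + (OrthoSymplectic.rho q : ℂ)))))) := by
  have hrho : (OrthoSymplectic.rho q : ℂ) = -q := by simp [OrthoSymplectic.rho_eq]
  refine ⟨OrthoSymplectic.rho_eq q, ⟨OrthoSymplectic.stdDensity q,
    OrthoSymplectic.chartRootInv_ne_zero, OrthoSymplectic.isInvariant_stdDensity⟩,
    fun ω hne hω => ?_⟩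
  obtain ⟨c, hc, hspherical⟩ := OrthoSymplectic.sphericalAt_eq_sum_exp_pow hω hne
  simp only [hrho, sub_neg_eq_add, neg_neg, ← sub_eq_add_neg (G := ℂ)]
  refine ⟨⟨c, hc, fun lam t => ?_⟩, c * ((-1) ^ q * (q.factorial : ℂ)⁻¹), ?_, fun lam hlam => ?_⟩
  · rw [hspherical, OrthoSymplectic.exp_mul_sum_mul_exp_pow, mul_assoc]
  · simp [hc, q.factorial_ne_zero]
  · have hlim := (OrthoSymplectic.tendsto_sum_mul_exp_pow q fun k =>
      Ring.choose (lam + q) k * Ring.choose (-lam + q) (q - k)).const_mul c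
    rw [Ring.choose_zero_right, one_mul, Nat.sub_zero,
      OrthoSymplectic.ringChoose_neg_add_eq_Gamma_div hlam, ← mul_assoc] at hlim
    refine hlim.congr fun t => ?_
    rw [hspherical, mul_left_comm, Complex.exp_neg, inv_mul_cancel_left₀ (Complex.exp_ne_zero _)]
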